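/- Let $k$ be a field, $\lambda\in k$ with $\lambda\neq 0$, and $Z$ a set. Let $\mathcal S(Z)$ be the free semigroup on $Z$, and let $\mathfrak S(Z)$ be the free semigroup with two operators $D=\lfloor\ \rfloor_D$, $P=\lfloor\ \rfloor_P$ on $Z$: its elements (bracketed words) are the nonempty words whose letters are elements of $Z$ or symbols $\lfloor w\rfloor_D$, $\lfloor w\rfloor_P$ with $w$ again a bracketed word. Extend $D$ and $P$ linearly to the nonunital algebra $k\mathfrak S(Z)$. Let $\mathfrak S^\star(Z)$ be the set of elements of $\mathfrak S(Z\sqcup\{\star\})$ in which $\star$ occurs exactly once; $q|_u$ denotes $q$ with $\star$ replaced by $u$, extended linearly in $u$. For a subset $S\subseteq k\mathfrak S(Z)$, $\langle S\rangle$ denotes the smallest two-sided ideal (a $k$-subspace) of $k\mathfrak S(Z)$ that contains $S$ and is closed under $D$ and $P$. A nonunital $\lambda$-differential Rota–Baxter algebra is a nonunital associative $k$-algebra $R$ with $k$-linear maps $D,P:R\to R$ such that $D(uv)=D(u)v+uD(v)+\lambda D(u)D(v)$, $P(u)P(v)=P(uP(v))+P(P(u)v)+\lambda P(uv)$ and $D(P(u))=u$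 for all $u,v\in R$. The free such algebra over a nonunital algebra $A$ is one, $B$, together with an algebra homomorphism $A\to B$ through which every algebra homomorphism from $A$ to a $\lambda$-differential Rota–Baxter algebra factors by a unique homomorphism of algebras commuting with $D$ and $P$. Let $S_{\mathrm{dRB}}(Z)\subseteq k\mathfrak S(Z)$ be the set of all the following elements, for $u,v\in\mathfrak S(Z)$: $$\begin{aligned} \phi_1(u,v)&=P(u)P(v)-P(uP(v))-P(P(u)v)-\lambda P(uv),\\ \phi_2(u,v)&=D(u)D(v)+\lambda^{-1}D(u)v+\lambda^{-1}uD(v)-\lambda^{-1}D(uv),\\ \phi_3(u)&=D(P(u))-u,\\ \phi_4(u,v)&=P(u)D(v)-D(P(u)v)+uv+\lambda uD(v),\\ \phi_5(u,v)&=D(u)P(v)-D(uP(v))+uv+\lambda D(u)v. \end{aligned}$$ Let $I_A$ be an ideal of $k\mathcal S(Z)$ and $A=k\mathcal S(Z)/I_A$. Then: (1) $B=k\mathfrak S(Z)/\langle S_{\mathrm{dRB}}(Z)\cup I_A\rangle$, with the induced operators $D,P$ and the homomorphism $A\to B$ induced by the inclusion $k\mathcal S(Z)\subseteq k\mathfrak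 S(Z)$, is the free nonunital $\lambda$-differential Rota–Baxter algebra over $A$. Now let $Z$ be well ordered. Let $\leq_{\mathrm{dlex}}$ be the degree-lexicographic order on $\mathcal S(Z)$ (length first, then lexicographic). Let $\leq_{\mathrm{Dlex}}$ be the linear order on $\mathfrak S(Z)$ that compares bracketed words first by breadth (the number of outermost letters) and then lexicographically, where the letters are ordered by $z<\lfloor v\rfloor_D<\lfloor w\rfloor_P$ for $z\in Z$, by the order of $Z$, and recursively by $\lfloor v\rfloor_\omega<\lfloor w\rfloor_\omega$ iff $v<_{\mathrm{Dlex}}w$, for $\omega\in\{D,P\}$. Let $\leq_{\mathrm{PD}}$ compare $u,v\in\mathfrak S(Z)$ successively by: the number of brackets $\lfloor\ \rfloor_D$; the number of brackets $\lfloor\ \rfloor_P$; the number of occurrences of elements of $Z$; the sum, over all right half brackets $\rfloor_D$, of the number of elements of $Z$ to the right of it; the sum, over all brackets $\lfloor\ \rfloor_P$, of the number of elements of $Z$ not contained in it; and finally by $\leq_{\mathrm{Dlex}}$. Write $\bar f$ for the leading (largest) monomial of $f\neq 0$. A set $G$ of elements is a Gröbner–Shirshov (GS) basis with respect to a monomial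 order $\leq$ if for all nonzero $f,g\in G$, made monic: $fu-vg$ is trivial modulo $(G,p)$ whenever $p=\bar fu=v\bar g$ for monomials $u,v$ and $\max(|\bar f|,|\bar g|)<|p|<|\bar f|+|\bar g|$ ($|\cdot|$ being the breadth); and $f-q|_g$ is trivial modulo $(G,\bar f)$ whenever $\bar f=q|_{\bar g}$. Here an element is trivial modulo $(G,p)$ if it is a finite sum $\sum_i c_i\,q_i|_{s_i}$ with $c_i\in k$, $s_i\in G$ and $q_i|_{\bar s_i}<p$. In $k\mathfrak S(Z)$ (operated GS bases) $q,q_i$ range over $\mathfrak S^\star(Z)$; in $k\mathcal S(Z)$ they range over the words $a\star b$ with $a,b\in\mathcal S(Z)\sqcup\{1\}$. $G$ is a GS basis of an (operated) ideal if moreover it generates this ideal. Let $G$ be a GS basis of $I_A$ with respect to $\leq_{\mathrm{dlex}}$. Then: (2) $\leq_{\mathrm{PD}}$ is a monomial order on $\mathfrak S(Z)$ (a well order with $u<v\Rightarrow q|_u<q|_v$ for all $q\in\mathfrak S^\star(Z)$), and $S_{\mathrm{dRB}}(Z)\cup G$ is an operated GS basis of $\langle S_{\mathrm{dRB}}(Z)\cup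 I_A\rangle$ in $k\mathfrak S(Z)$ with respect to $\leq_{\mathrm{PD}}$. (3) The set $\operatorname{Irr}(S_{\mathrm{dRB}}(Z)\cup G)$ of all elements of $\mathfrak S(Z)$ that are not of the form $q|_{\bar s}$ with $q\in\mathfrak S^\star(Z)$ and $0\neq s\in S_{\mathrm{dRB}}(Z)\cup G$ (leading monomials with respect to $\leq_{\mathrm{PD}}$) equals the complement in $\mathfrak S(Z)$ of $$\{q|_{\bar s},\ q|_{P(u)P(v)},\ q|_{D(u)D(v)},\ q|_{D(P(u))},\ q|_{P(u)D(v)},\ q|_{D(u)P(v)} \;:\; 0\neq s\in G,\ q\in\mathfrak S^\star(Z),\ u,v\in\mathfrak S(Z)\}$$ (with $\bar s$ taken with respect to $\leq_{\mathrm{dlex}}$), and its image in $B$ is a $k$-linear basis of $B$, the free nonunital $\lambda$-differential Rota–Baxter algebra over $A$. -/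

import Mathlib

universe w

/-! ### The free semigroup with two operators -/

/-- The index set `Ω = {D, P}` of the operators. -/
inductive OpIdx : Type
  | D
  | P
  deriving DecidableEq

/-- The order `D < P` on the operator symbols. -/
def OpIdx.Lt (a b : OpIdx) : Prop := a = OpIdx.D ∧ b = OpIdx.P

/-- The free `Ω`-semigroup `𝔖(Z)`: bracketed words, i.e. nonempty words whose letters are either
elements of `Z` or brackets `⌊w⌋_ω` with `ω ∈ Ω` and `w` again a bracketed word.
A word is a single letter (`of z` or `op ω w`) or a letter followed by a word
(`consOf z w` is `z w`, and `consOp ω v w` is `⌊v⌋_ω w`). -/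
inductive OpWord (Z : Type*) : Type _
  | of (z : Z) : OpWord Z
  | op (ω : OpIdx) (v : OpWord Z) : OpWord Z
  | consOf (z : Z) (w : OpWord Z) : OpWord Z
  | consOp (ω : OpIdx) (v w : OpWord Z) : OpWord Z

namespace OpWord

/-- Concatenation of bracketed words. -/
protected def mul {Z : Type*} : OpWord Z → OpWord Z → OpWord Z
  | of z, b => consOf z b
  | op ω v, b => consOp ω v b
  | consOf z w, b => consOf z (OpWord.mul w b)
  | consOp ω v w, b => consOp ω v (OpWord.mul w b)

instance {Z : Type*} : Mul (OpWord Z) := ⟨OpWord.mul⟩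

theorem mul_def {Z : Type*} (a b : OpWord Z) : a * b = OpWord.mul a b := rfl

protected theorem mul_assoc' {Z : Type*} (a b c : OpWord Z) : a * b * c = a * (b * c) := by
  simp only [mul_def]
  induction a with
  | of z => rfl
  | op ω v _ => rfl
  | consOf z w ih => simp only [OpWord.mul, ih]
  | consOp ω v w _ ih => simp only [OpWord.mul, ih]

instance {Z : Type*} : Semigroup (OpWord Z) where
  mul_assoc := OpWord.mul_assoc'

/-- The breadth `|u|`: the number of (outermost) letters of `u`. -/
def breadth {Z : Type*} : OpWord Z → ℕ
  | of _ => 1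
  | op _ _ => 1
  | consOf _ w => 1 + breadth w
  | consOp _ _ w => 1 + breadth w

/-- `deg_ω(u)`: the number of occurrences of `⌊ ⌋_ω` in `u`, at all depths. -/
def degOp {Z : Type*} (τ : OpIdx) : OpWord Z → ℕ
  | of _ => 0
  | op ω v => (if ω = τ then 1 else 0) + degOp τ v
  | consOf _ w => degOp τ w
  | consOp ω v w => (if ω = τ then 1 else 0) + degOp τ v + degOp τ w

/-- `deg_Z(u)`: the number of elements of `Z` occurring in `u`, counted with repetitions. -/
def degZ {Z : Type*} : OpWord Z → ℕ
  | of _ => 1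
  | op _ v => degZ v
  | consOf _ w => 1 + degZ w
  | consOp _ v w => degZ v + degZ w

/-- The GD-degree: the sum, over all right half brackets `⌋_D` of `u`, of the number of elements
of `Z` that stand to the right of it in `u`. In `⌊v⌋_ω w` each right bracket inside `⌊v⌋_ω` has, in
addition to the elements to its right in `⌊v⌋_ω`, all the `deg_Z(w)` elements of `w` to its right.
-/
def degGD {Z : Type*} : OpWord Z → ℕ
  | of _ => 0
  | op _ v => degGD v
  | consOf _ w => degGD w
  | consOp ω v w => degGD v + degOp OpIdx.D (op ω v) * degZ w + degGD w

/-- The GP-degree: the sum, over all brackets `⌊ ⌋_P` of `u`, of the number of elements of `Z` in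
`u` that are not contained in that bracket. -/
def degGP {Z : Type*} : OpWord Z → ℕ
  | of _ => 0
  | op _ v => degGP v
  | consOf _ w => degOp OpIdx.P w + degGP w
  | consOp ω v w =>
      degGP v + degOp OpIdx.P (op ω v) * degZ w + (degGP w + degOp OpIdx.P w * degZ v)

/-- The strict order `<_Dlex`: words are compared by breadth first, and words of equal breadth
lexicographically by their letters, where `z < ⌊v⌋_D < ⌊w⌋_P` for `z ∈ Z`, elements of `Z` are
compared by the order of `Z`, and `⌊v⌋_ω`, `⌊w⌋_ω` are compared as `v`, `w` are. -/
def DlexLt {Z : Type*} [LT Z] : OpWord Z → OpWord Z → Prop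
  | of z, of z' => z < z'
  | of _, op _ _ => True
  | op _ _, of _ => False
  | op ω v, op ω' v' => OpIdx.Lt ω ω' ∨ (ω = ω' ∧ DlexLt v v')
  | of _, consOf _ _ => True
  | of _, consOp _ _ _ => True
  | op _ _, consOf _ _ => True
  | op _ _, consOp _ _ _ => True
  | consOf _ _, of _ => False
  | consOf _ _, op _ _ => False
  | consOp _ _ _, of _ => False
  | consOp _ _ _, op _ _ => False
  | consOf z w, consOf z' w' =>
      breadth w < breadth w' ∨
        (breadth w = breadth w' ∧ (z < z' ∨ (z = z' ∧ DlexLt w w')))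
  | consOf _ w, consOp _ _ w' => breadth w < breadth w' ∨ breadth w = breadth w'
  | consOp _ _ w, consOf _ w' => breadth w < breadth w'
  | consOp ω v w, consOp ω' v' w' =>
      breadth w < breadth w' ∨
        (breadth w = breadth w' ∧
          (OpIdx.Lt ω ω' ∨ (ω = ω' ∧ (DlexLt v v' ∨ (v = v' ∧ DlexLt w w')))))

/-- The strict order `<_PD`: compare successively the `D`-degree, the `P`-degree, the `Z`-degree,
the GD-degree and the GP-degree, and finally use `<_Dlex`. -/
def PDLt {Z : Type*} [LT Z] (u v : OpWord Z) : Prop :=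
  degOp OpIdx.D u < degOp OpIdx.D v ∨ (degOp OpIdx.D u = degOp OpIdx.D v ∧
  (degOp OpIdx.P u < degOp OpIdx.P v ∨ (degOp OpIdx.P u = degOp OpIdx.P v ∧
  (degZ u < degZ v ∨ (degZ u = degZ v ∧
  (degGD u < degGD v ∨ (degGD u = degGD v ∧
  (degGP u < degGP v ∨ (degGP u = degGP v ∧ DlexLt u v)))))))))

/-- The number of occurrences of the symbol `⋆` (which is `none`) in a word over `Z ∪ {⋆}`. -/
def countStar {Z : Type*} : OpWord (Option Z) → ℕ
  | of z => z.elim 1 (fun _ => 0)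
  | op _ v => countStar v
  | consOf z w => z.elim 1 (fun _ => 0) + countStar w
  | consOp _ v w => countStar v + countStar w

/-- The word obtained from a word over `Z ∪ {⋆}` by replacing `⋆` by `u`. -/
def subst {Z : Type*} (u : OpWord Z) : OpWord (Option Z) → OpWord Z
  | of z => z.elim u of
  | op ω v => op ω (subst u v)
  | consOf z w => z.elim u of * subst u w
  | consOp ω v w => op ω (subst u v) * subst u w

/-- The canonical embedding of the free semigroup `𝒮(Z)` into `𝔖(Z)`. -/
def incl (Z : Type*) : FreeSemigroup Z →ₙ* OpWord Z := FreeSemigroup.lift OpWord.of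

end OpWord

/-- `𝔖⋆(Z)`: the elements of `𝔖(Z ∪ {⋆})` in which `⋆` occurs exactly once. -/
def StarWord (Z : Type*) : Type _ := {q : OpWord (Option Z) // q.countStar = 1}

/-- `q|_u` for `q ∈ 𝔖⋆(Z)` and `u ∈ 𝔖(Z)`. -/
def StarWord.plug {Z : Type*} (q : StarWord Z) (u : OpWord Z) : OpWord Z := OpWord.subst u q.1

/-! ### The free semigroup and the degree-lexicographic order -/

/-- The strict degree-lexicographic order on the free semigroup `𝒮(Z)`. -/
def dlexLt {Z : Type*} [LT Z] (u v : FreeSemigroup Z) : Prop :=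
  List.Shortlex (· < ·) (u.head :: u.tail) (v.head :: v.tail)

/-- The word `a u b`, where `a` and `b` are elements of `𝒮(Z)` or empty (`none`). -/
def assocPlug {Z : Type*} (c : Option (FreeSemigroup Z) × Option (FreeSemigroup Z))
    (u : FreeSemigroup Z) : FreeSemigroup Z :=
  c.1.elim (c.2.elim u (fun b => u * b)) (fun a => a * c.2.elim u (fun b => u * b))

/-! ### Gröbner–Shirshov bases

The definitions are given for the algebra `k S` of a semigroup `S` of "monomials" that is equipped
with a length function `len` and with a family of contexts `plug c : S → S`. They are used for
`S = 𝔖(Z)` with the contexts `u ↦ q|_u`, `q ∈ 𝔖⋆(Z)`, and for `S = 𝒮(Z)` with the contexts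
`u ↦ a u b`. -/

section GroebnerShirshov

/-- A monomial order: a well order that is compatible with all contexts. -/
def IsMonomialOrder {S C : Type*} (plug : C → S → S) (lt : S → S → Prop) : Prop :=
  IsWellOrder S lt ∧ ∀ (q : C) (u v : S), lt u v → lt (plug q u) (plug q v)

/-- `m` is the leading monomial of `f`. A zero element has no leading monomial. -/
def IsLeading {k S : Type*} [Field k] (lt : S → S → Prop) (f : MonoidAlgebra k S) (m : S) : Prop :=
  f.coeff m ≠ 0 ∧ ∀ m' : S, f.coeff m' ≠ 0 → m' = m ∨ lt m' m

/-- `f` divided by the coefficient of the monomial `m`. -/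
noncomputable def monicAt {k S : Type*} [Field k] (f : MonoidAlgebra k S) (m : S) :
    MonoidAlgebra k S :=
  (f.coeff m)⁻¹ • f

/-- `f` is trivial modulo `(G, p)`: it is a linear combination of elements `q|_s` with `s ∈ G` and
`q|_s̄ < p`. -/
def TrivialMod {k S C : Type*} [Field k] (plug : C → S → S) (lt : S → S → Prop)
    (G : Set (MonoidAlgebra k S)) (p : S) (f : MonoidAlgebra k S) : Prop :=
  f ∈ Submodule.span k {h : MonoidAlgebra k S | ∃ s ∈ G, ∃ m : S, IsLeading lt s m ∧
    ∃ q : C, lt (plug q m) p ∧ h = MonoidAlgebra.mapDomain (plug q) s}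

/-- `G` is a Gröbner–Shirshov basis with respect to `lt`: all intersection compositions
`f u - v g` and all inclusion compositions `f - q|_g` of (the monic multiples of) nonzero elements
`f, g` of `G` are trivial. -/
structure IsGSBasis {k S C : Type*} [Field k] [Semigroup S] (len : S → ℕ) (plug : C → S → S)
    (lt : S → S → Prop) (G : Set (MonoidAlgebra k S)) : Prop where
  intersection : ∀ f ∈ G, ∀ g ∈ G, ∀ mf mg : S, IsLeading lt f mf → IsLeading lt g mg →
    ∀ p u v : S, p = mf * u → p = v * mg →
      max (len mf) (len mg) < len p → len p < len mf + len mg →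
      TrivialMod plug lt G p
        (monicAt f mf * MonoidAlgebra.single u 1 - MonoidAlgebra.single v 1 * monicAt g mg)
  inclusion : ∀ f ∈ G, ∀ g ∈ G, ∀ mf mg : S, IsLeading lt f mf → IsLeading lt g mg →
    ∀ q : C, mf = plug q mg →
      TrivialMod plug lt G mf (monicAt f mf - MonoidAlgebra.mapDomain (plug q) (monicAt g mg))

/-- `Irr(G)`: the monomials that are not of the form `q|_s̄` with `s ∈ G` nonzero. -/
def Irr {k S C : Type*} [Field k] (plug : C → S → S) (lt : S → S → Prop)
    (G : Set (MonoidAlgebra k S)) : Set S :=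
  {w | ∃ s ∈ G, ∃ m : S, IsLeading lt s m ∧ ∃ q : C, w = plug q m}ᶜ

/-- Gröbner–Shirshov bases of the nonunital free algebra `k 𝒮(Z)` with respect to `<_dlex`. -/
def IsAssocGSBasis {k Z : Type*} [Field k] [LT Z] (G : Set (MonoidAlgebra k (FreeSemigroup Z))) :
    Prop :=
  IsGSBasis FreeSemigroup.length assocPlug dlexLt G

/-- Operated Gröbner–Shirshov bases of `k 𝔖(Z)` with respect to `<_PD`. -/
def IsOperatedGSBasis {k Z : Type*} [Field k] [LT Z] (G : Set (MonoidAlgebra k (OpWord Z))) :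
    Prop :=
  IsGSBasis OpWord.breadth (StarWord.plug (Z := Z)) OpWord.PDLt G

end GroebnerShirshov

/-! ### Ideals and quotients of nonunital algebras -/

/-- Two-sided ideals of a nonunital associative algebra: subspaces closed under multiplication by
arbitrary elements on both sides. -/
structure AlgIdeal (k R : Type*) [Field k] [NonUnitalRing R] [Module k R]
    extends Submodule k R where
  mul_mem_left : ∀ a x : R, x ∈ toSubmodule → a * x ∈ toSubmodule
  mul_mem_right : ∀ x a : R, x ∈ toSubmodule → x * a ∈ toSubmodule

namespace AlgIdeal

/-- The ideal generated by a set. -/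
def span (k : Type*) {R : Type*} [Field k] [NonUnitalRing R] [Module k R] (s : Set R) :
    AlgIdeal k R where
  toSubmodule := sInf {J | ∃ I : AlgIdeal k R, I.toSubmodule = J ∧ s ⊆ J}
  mul_mem_left a x hx := by
    simp only [Submodule.mem_sInf, Set.mem_ofPred_eq] at hx ⊢
    rintro J ⟨I, rfl, hs⟩
    exact I.mul_mem_left a x (hx _ ⟨I, rfl, hs⟩)
  mul_mem_right x a hx := by
    simp only [Submodule.mem_sInf, Set.mem_ofPred_eq] at hx ⊢
    rintro J ⟨I, rfl, hs⟩
    exact I.mul_mem_right x a (hx _ ⟨I, rfl, hs⟩)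

/-- The operated ideal generated by a set: the smallest ideal that contains the set and is closed
under all operators `T ω`. -/
def opSpan {k R : Type*} [Field k] [NonUnitalRing R] [Module k R] (T : OpIdx → R →ₗ[k] R)
    (s : Set R) : AlgIdeal k R where
  toSubmodule := sInf {J | ∃ I : AlgIdeal k R, I.toSubmodule = J ∧ s ⊆ J ∧
    ∀ ω, ∀ x ∈ J, T ω x ∈ J}
  mul_mem_left a x hx := by
    simp only [Submodule.mem_sInf, Set.mem_ofPred_eq] at hx ⊢
    rintro J ⟨I, rfl, hs⟩
    exact I.mul_mem_left a x (hx _ ⟨I, rfl, hs⟩)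
  mul_mem_right x a hx := by
    simp only [Submodule.mem_sInf, Set.mem_ofPred_eq] at hx ⊢
    rintro J ⟨I, rfl, hs⟩
    exact I.mul_mem_right x a (hx _ ⟨I, rfl, hs⟩)

theorem op_mem_opSpan {k R : Type*} [Field k] [NonUnitalRing R] [Module k R]
    (T : OpIdx → R →ₗ[k] R) (s : Set R) (ω : OpIdx) (x : R)
    (hx : x ∈ (opSpan T s).toSubmodule) : T ω x ∈ (opSpan T s).toSubmodule := by
  simp only [opSpan, Submodule.mem_sInf, Set.mem_ofPred_eq] at hx ⊢
  rintro J ⟨I, rfl, hs, hT⟩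
  exact hT ω x (hx _ ⟨I, rfl, hs, hT⟩)

/-- The quotient algebra `R / I`. -/
def Quotient {k R : Type*} [Field k] [NonUnitalRing R] [Module k R] (I : AlgIdeal k R) : Type _ :=
  R ⧸ I.toSubmodule

section Quotient

variable {k R : Type*} [Field k] [NonUnitalRing R] [Module k R]

instance (I : AlgIdeal k R) : AddCommGroup I.Quotient :=
  inferInstanceAs (AddCommGroup (R ⧸ I.toSubmodule))

instance (I : AlgIdeal k R) : Module k I.Quotient :=
  inferInstanceAs (Module k (R ⧸ I.toSubmodule))

/-- The quotient map, as a linear map. -/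
def mkₗ (I : AlgIdeal k R) : R →ₗ[k] I.Quotient := I.toSubmodule.mkQ

theorem mkₗ_surjective (I : AlgIdeal k R) : Function.Surjective I.mkₗ :=
  I.toSubmodule.mkQ_surjective

theorem mkₗ_eq_iff (I : AlgIdeal k R) (x y : R) : I.mkₗ x = I.mkₗ y ↔ x - y ∈ I.toSubmodule :=
  Submodule.Quotient.eq I.toSubmodule

instance (I : AlgIdeal k R) : Mul I.Quotient where
  mul := Quotient.map₂ (· * ·) (by
    intro a b hab c d hcd
    have hab' := (Submodule.quotientRel_def _).mp hab
    have hcd' := (Submodule.quotientRel_def _).mp hcd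
    refine (Submodule.quotientRel_def _).mpr ?_
    have h : a * c - b * d = (a - b) * c + b * (c - d) := by
      rw [sub_mul, mul_sub]; abel
    rw [h]
    exact I.toSubmodule.add_mem (I.mul_mem_right _ _ hab') (I.mul_mem_left _ _ hcd'))

theorem mkₗ_mul (I : AlgIdeal k R) (x y : R) : I.mkₗ (x * y) = I.mkₗ x * I.mkₗ y := rfl

instance (I : AlgIdeal k R) : NonUnitalRing I.Quotient where
  left_distrib a b c := by
    obtain ⟨a, rfl⟩ := I.mkₗ_surjective a
    obtain ⟨b, rfl⟩ := I.mkₗ_surjective b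
    obtain ⟨c, rfl⟩ := I.mkₗ_surjective c
    simp only [← map_add, ← mkₗ_mul, mul_add]
  right_distrib a b c := by
    obtain ⟨a, rfl⟩ := I.mkₗ_surjective a
    obtain ⟨b, rfl⟩ := I.mkₗ_surjective b
    obtain ⟨c, rfl⟩ := I.mkₗ_surjective c
    simp only [← map_add, ← mkₗ_mul, add_mul]
  zero_mul a := by
    obtain ⟨a, rfl⟩ := I.mkₗ_surjective a
    rw [← map_zero I.mkₗ, ← mkₗ_mul, zero_mul]
  mul_zero a := by
    obtain ⟨a, rfl⟩ := I.mkₗ_surjective a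
    rw [← map_zero I.mkₗ, ← mkₗ_mul, mul_zero]
  mul_assoc a b c := by
    obtain ⟨a, rfl⟩ := I.mkₗ_surjective a
    obtain ⟨b, rfl⟩ := I.mkₗ_surjective b
    obtain ⟨c, rfl⟩ := I.mkₗ_surjective c
    simp only [← mkₗ_mul, mul_assoc]

instance [IsScalarTower k R R] (I : AlgIdeal k R) : IsScalarTower k I.Quotient I.Quotient where
  smul_assoc r a b := by
    obtain ⟨a, rfl⟩ := I.mkₗ_surjective a
    obtain ⟨b, rfl⟩ := I.mkₗ_surjective b
    simp only [smul_eq_mul, ← map_smul, ← mkₗ_mul, smul_mul_assoc]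

instance [SMulCommClass k R R] (I : AlgIdeal k R) : SMulCommClass k I.Quotient I.Quotient where
  smul_comm r a b := by
    obtain ⟨a, rfl⟩ := I.mkₗ_surjective a
    obtain ⟨b, rfl⟩ := I.mkₗ_surjective b
    simp only [smul_eq_mul, ← map_smul, ← mkₗ_mul, mul_smul_comm]

/-- The quotient map `R → R / I` as a homomorphism of nonunital algebras. -/
def quotMk (I : AlgIdeal k R) : R →ₙₐ[k] I.Quotient where
  toFun := I.mkₗ
  map_smul' r x := map_smul I.mkₗ r x
  map_zero' := map_zero I.mkₗ
  map_add' x y := map_add I.mkₗ x y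
  map_mul' x y := I.mkₗ_mul x y

/-- The operator induced on the quotient `R / I` by an operator `T` with `T(I) ⊆ I`. -/
def quotientOp (I : AlgIdeal k R) (T : R →ₗ[k] R)
    (h : ∀ x, x ∈ I.toSubmodule → T x ∈ I.toSubmodule) : I.Quotient →ₗ[k] I.Quotient :=
  Submodule.mapQ I.toSubmodule I.toSubmodule T h

end Quotient

end AlgIdeal

/-! ### Differential Rota–Baxter algebras -/

/-- `(R, D, P)` is a nonunital differential Rota–Baxter algebra of weight `lam`. -/
structure IsDiffRotaBaxter {k R : Type*} [Field k] [NonUnitalRing R] [Module k R] (lam : k)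
    (T : OpIdx → R →ₗ[k] R) : Prop where
  differential : ∀ u v : R, T OpIdx.D (u * v) =
    T OpIdx.D u * v + u * T OpIdx.D v + lam • (T OpIdx.D u * T OpIdx.D v)
  rotaBaxter : ∀ u v : R, T OpIdx.P u * T OpIdx.P v =
    T OpIdx.P (u * T OpIdx.P v) + T OpIdx.P (T OpIdx.P u * v) + lam • T OpIdx.P (u * v)
  section_eq : ∀ u : R, T OpIdx.D (T OpIdx.P u) = u

section OPI

variable {k R : Type*} [Field k] [NonUnitalRing R] [Module k R]

/-- `φ₁(x,y) = P(x)P(y) - P(xP(y)) - P(P(x)y) - λP(xy)` -/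
def phi1 (lam : k) (T : OpIdx → R →ₗ[k] R) (x y : R) : R :=
  T OpIdx.P x * T OpIdx.P y - T OpIdx.P (x * T OpIdx.P y) - T OpIdx.P (T OpIdx.P x * y)
    - lam • T OpIdx.P (x * y)

/-- `φ₂(x,y) = D(x)D(y) + λ⁻¹D(x)y + λ⁻¹xD(y) - λ⁻¹D(xy)` -/
def phi2 (lam : k) (T : OpIdx → R →ₗ[k] R) (x y : R) : R :=
  T OpIdx.D x * T OpIdx.D y + lam⁻¹ • (T OpIdx.D x * y) + lam⁻¹ • (x * T OpIdx.D y)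
    - lam⁻¹ • T OpIdx.D (x * y)

/-- `φ₃(x) = D(P(x)) - x` -/
def phi3 (T : OpIdx → R →ₗ[k] R) (x : R) : R :=
  T OpIdx.D (T OpIdx.P x) - x

/-- `φ₄(x,y) = P(x)D(y) - D(P(x)y) + xy + λxD(y)` -/
def phi4 (lam : k) (T : OpIdx → R →ₗ[k] R) (x y : R) : R :=
  T OpIdx.P x * T OpIdx.D y - T OpIdx.D (T OpIdx.P x * y) + x * y + lam • (x * T OpIdx.D y)

/-- `φ₅(x,y) = D(x)P(y) - D(xP(y)) + xy + λD(x)y` -/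
def phi5 (lam : k) (T : OpIdx → R →ₗ[k] R) (x y : R) : R :=
  T OpIdx.D x * T OpIdx.P y - T OpIdx.D (x * T OpIdx.P y) + x * y + lam • (T OpIdx.D x * y)

/-- For `λ ≠ 0`, differential Rota–Baxter algebras are exactly the operated algebras that satisfy
the identities `φ₁, …, φ₅`. -/
theorem isDiffRotaBaxter_iff [IsScalarTower k R R] [SMulCommClass k R R] {lam : k} (hlam : lam ≠ 0)
    (T : OpIdx → R →ₗ[k] R) :
    IsDiffRotaBaxter lam T ↔ (∀ x y, phi1 lam T x y = 0) ∧ (∀ x y, phi2 lam T x y = 0) ∧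
      (∀ x, phi3 T x = 0) ∧ (∀ x y, phi4 lam T x y = 0) ∧ (∀ x y, phi5 lam T x y = 0) := by
  constructor
  · intro h
    refine ⟨fun x y => ?_, fun x y => ?_, fun x => ?_, fun x y => ?_, fun x y => ?_⟩
    · rw [phi1, h.rotaBaxter]; abel
    · rw [phi2, h.differential, smul_add, smul_add, smul_smul, inv_mul_cancel₀ hlam, one_smul]; abel
    · rw [phi3, h.section_eq, sub_self]
    · rw [phi4, h.differential, h.section_eq]; abel
    · rw [phi5, h.differential, h.section_eq]; abel
  · rintro ⟨h1, h2, h3, -, -⟩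
    refine ⟨fun u v => ?_, fun u v => ?_, fun u => sub_eq_zero.mp (h3 u)⟩
    · have h := congrArg (fun t => lam • t) (h2 u v)
      simp only [phi2, smul_add, smul_sub, smul_smul, mul_inv_cancel₀ hlam, one_smul,
        smul_zero] at h
      rw [← sub_eq_zero.mp h]; abel
    · have h := h1 u v
      rw [phi1, sub_sub, sub_sub, sub_eq_zero] at h
      rw [h]; abel

end OPI

/-! ### The algebra `k 𝔖(Z) / ⟨S_dRB(Z) ∪ I_A⟩` -/

/-- The monomial `u ∈ 𝔖(Z)` as an element of `k 𝔖(Z)`. -/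
noncomputable def mon (k : Type*) {Z : Type*} [Field k] (u : OpWord Z) :
    MonoidAlgebra k (OpWord Z) :=
  MonoidAlgebra.single u 1

/-- The operators `D` and `P` of `k 𝔖(Z)`: the linear extensions of `u ↦ ⌊u⌋_D` and
`u ↦ ⌊u⌋_P`. -/
noncomputable def wordOp (k Z : Type*) [Field k] (ω : OpIdx) :
    MonoidAlgebra k (OpWord Z) →ₗ[k] MonoidAlgebra k (OpWord Z) where
  toFun := MonoidAlgebra.mapDomain (OpWord.op ω)
  map_add' x y := MonoidAlgebra.mapDomain_add _ x y
  map_smul' r x := MonoidAlgebra.mapDomain_smul _ r x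

/-- The map `k 𝒮(Z) → k 𝔖(Z)` induced by the inclusion of `𝒮(Z)` into `𝔖(Z)`. -/
noncomputable def inclAlg {k Z : Type*} [Field k] (f : MonoidAlgebra k (FreeSemigroup Z)) :
    MonoidAlgebra k (OpWord Z) :=
  MonoidAlgebra.mapDomain (OpWord.incl Z) f

/-- `S_dRB(Z)`: the values of `φ₁, …, φ₅` at elements of `𝔖(Z)`. -/
def SdRB {k : Type*} [Field k] (lam : k) (Z : Type*) : Set (MonoidAlgebra k (OpWord Z)) :=
  {f | ∃ u v : OpWord Z,
    f = phi1 lam (wordOp k Z) (mon k u) (mon k v) ∨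
    f = phi2 lam (wordOp k Z) (mon k u) (mon k v) ∨
    f = phi3 (wordOp k Z) (mon k u) ∨
    f = phi4 lam (wordOp k Z) (mon k u) (mon k v) ∨
    f = phi5 lam (wordOp k Z) (mon k u) (mon k v)}

/-- The operated ideal `⟨S_dRB(Z) ∪ I⟩` of `k 𝔖(Z)`. -/
noncomputable def dRBIdeal {k Z : Type*} [Field k] (lam : k)
    (I : AlgIdeal k (MonoidAlgebra k (FreeSemigroup Z))) :
    AlgIdeal k (MonoidAlgebra k (OpWord Z)) :=
  AlgIdeal.opSpan (wordOp k Z) (SdRB lam Z ∪ inclAlg '' (I.toSubmodule : Set _))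

/-- The operators `D` and `P` of the quotient `k 𝔖(Z) / ⟨S_dRB(Z) ∪ I⟩`. -/
noncomputable def dRBOp {k Z : Type*} [Field k] (lam : k)
    (I : AlgIdeal k (MonoidAlgebra k (FreeSemigroup Z))) (ω : OpIdx) :
    (dRBIdeal lam I).Quotient →ₗ[k] (dRBIdeal lam I).Quotient :=
  AlgIdeal.quotientOp (dRBIdeal lam I) (wordOp k Z ω) (AlgIdeal.op_mem_opSpan _ _ ω)

/-- `(B, T)` together with `ι : A → B` is the free nonunital `lam`-differential Rota–Baxter algebra
over the nonunital algebra `A`: every homomorphism of algebras from `A` to a differential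
Rota–Baxter algebra of weight `lam` factors uniquely through `ι` by a homomorphism of operated
algebras. -/
def IsFreeDiffRotaBaxter {k A B : Type*} [Field k]
    [NonUnitalRing A] [Module k A] [NonUnitalRing B] [Module k B]
    (lam : k) (T : OpIdx → B →ₗ[k] B) (ι : A →ₙₐ[k] B) : Prop :=
  IsDiffRotaBaxter lam T ∧
  ∀ (R : Type w) [NonUnitalRing R] [Module k R] [IsScalarTower k R R] [SMulCommClass k R R]
    (U : OpIdx → R →ₗ[k] R), IsDiffRotaBaxter lam U → ∀ f : A →ₙₐ[k] R,
      ∃! F : B →ₙₐ[k] R, (∀ (ω : OpIdx) (b : B), F (T ω b) = U ω (F b)) ∧ ∀ a : A, F (ι a) = f a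

/-! The relations act as rewriting rules on bracketed words: replace a leading monomial by lower
terms. Termination comes from the well order, and confluence from the triviality of the
compositions.

Freeness needs no rewriting. As λ ≠ 0, `isDiffRotaBaxter_iff` replaces the axioms by φ₁, …, φ₅; here
φ₄ and φ₅ are the Leibniz rule for P(u)v and uP(v), simplified by D ∘ P = id. A map on Z extends to
words by `eval`. The kernel of its linear extension is an operated ideal containing the relations
and `I`, so the extension descends to the quotient (`exists_lift`). It is unique because words are
built from Z by products and brackets.

The order is compatible with contexts because each measure is additive on products up to cross terms
fixed by the measures compared earlier. It is well founded because `DlexLt` is well founded among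
words of bounded size (`dlexLtBdd_wf`), and words tied in the first three degrees have equal size.

The composition-diamond lemma rests on `sub_mem_triv`: two reductions of one word differ by terms
with leading monomials below that word. Two occurrences of leading monomials in a word are disjoint,
nested or overlapping; the first case is automatic, the others are compositions. Hence the top term
of an element of the ideal can be lowered until it is the actual leading monomial, which is then
reducible (`exists_eq_of_isLeading`). So irreducible words are linearly independent modulo the
ideal; they span by well-founded reduction.

It remains to list the compositions. The leading monomials are ⌊u⌋⌊v⌋ with any two operators,
D(P(u)), and bracket-free words from G. Overlaps within S_dRB are three brackets in a row, giving
the eight `intersection_*` lemmas. Inclusions at the outer level are D(P(u)) as a factor of a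
two-bracket word, giving four `inclusion_phi*` lemmas; inclusions inside an argument are trivial for
every rule linear in that argument (`inclusion_rule`). Bracket-free monomials interact at the outer
level only with one another, and there `PDLt` is the degree-lexicographic order (`pdLt_incl`), so
the hypothesis on G applies. -/

namespace OpWord

variable {Z : Type*}

/-! ### Words: degrees of products and factorizations. -/

theorem of_mul (z : Z) (b : OpWord Z) : of z * b = consOf z b := rfl
theorem op_mul (ω : OpIdx) (v b : OpWord Z) : op ω v * b = consOp ω v b := rfl
theorem consOf_mul (z : Z) (w b : OpWord Z) : consOf z w * b = consOf z (w * b) := rfl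
theorem consOp_mul (ω : OpIdx) (v w b : OpWord Z) : consOp ω v w * b = consOp ω v (w * b) := rfl

theorem breadth_mul (a b : OpWord Z) : breadth (a * b) = breadth a + breadth b := by
  induction a with
  | of z => rfl
  | op ω v _ => rfl
  | consOf z w ih => simp only [consOf_mul, breadth, ih]; omega
  | consOp ω v w _ ih => simp only [consOp_mul, breadth, ih]; omega

theorem degOp_mul (τ : OpIdx) (a b : OpWord Z) : degOp τ (a * b) = degOp τ a + degOp τ b := by
  induction a with
  | of z => simp [of_mul, degOp]
  | op ω v _ => simp [op_mul, degOp]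
  | consOf z w ih => simp only [consOf_mul, degOp, ih]
  | consOp ω v w _ ih => simp only [consOp_mul, degOp, ih]; omega

theorem degZ_mul (a b : OpWord Z) : degZ (a * b) = degZ a + degZ b := by
  induction a with
  | of z => rfl
  | op ω v _ => rfl
  | consOf z w ih => simp only [consOf_mul, degZ, ih]; omega
  | consOp ω v w _ ih => simp only [consOp_mul, degZ, ih]; omega

theorem degGD_mul (a b : OpWord Z) :
    degGD (a * b) = degGD a + degOp OpIdx.D a * degZ b + degGD b := by
  induction a with
  | of z => simp [of_mul, degOp, degGD]
  | op ω v _ => simp [op_mul, degGD]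
  | consOf z w ih => simp only [consOf_mul, degGD, degOp, ih]
  | consOp ω v w _ ih => simp only [consOp_mul, degGD, degOp, ih, degZ_mul]; ring

theorem degGP_mul (a b : OpWord Z) :
    degGP (a * b) =
      degGP a + degOp OpIdx.P a * degZ b + (degGP b + degOp OpIdx.P b * degZ a) := by
  induction a with
  | of z => simp [of_mul, degOp, degGP, degZ]; omega
  | op ω v _ => simp [op_mul, degGP, degZ]
  | consOf z w ih => simp only [consOf_mul, degGP, degOp, ih, degOp_mul, degZ]; ring
  | consOp ω v w _ ih =>
    simp only [consOp_mul, degGP, degOp, ih, degZ_mul, degOp_mul, degZ]; ring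

theorem breadth_pos (a : OpWord Z) : 0 < breadth a := by
  cases a <;> simp [breadth]

theorem degZ_pos (a : OpWord Z) : 0 < degZ a := by
  induction a <;> simp only [degZ] <;> omega

/-- Two factorizations of a word either agree or one refines the other. -/
theorem mul_eq_mul_cases {a b c d : OpWord Z} (h : a * b = c * d) :
    (a = c ∧ b = d) ∨ (∃ x, a = c * x ∧ d = x * b) ∨ ∃ x, c = a * x ∧ b = x * d := by
  induction a generalizing c with
  | of z =>
    cases c with
    | of z' => simp only [of_mul, consOf.injEq] at h; simp [h]
    | op => simp [of_mul, op_mul] at h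
    | consOf z' w =>
      simp only [of_mul, consOf_mul, consOf.injEq] at h
      exact Or.inr (Or.inr ⟨w, by simp [of_mul, h], h.2⟩)
    | consOp => simp [of_mul, consOp_mul] at h
  | op ω v _ =>
    cases c with
    | of z' => simp [of_mul, op_mul] at h
    | op => simp only [op_mul, consOp.injEq] at h; simp [h]
    | consOf z' w => simp [op_mul, consOf_mul] at h
    | consOp ω' v' w =>
      simp only [op_mul, consOp_mul, consOp.injEq] at h
      exact Or.inr (Or.inr ⟨w, by simp [op_mul, h], h.2.2⟩)
  | consOf z w ih =>
    cases c with
    | of z' =>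
      simp only [of_mul, consOf_mul, consOf.injEq] at h
      exact Or.inr (Or.inl ⟨w, by simp [of_mul, h], h.2.symm⟩)
    | op => simp [consOf_mul, op_mul] at h
    | consOf z' w' =>
      simp only [consOf_mul, consOf.injEq] at h
      obtain ⟨rfl, h⟩ := h
      rcases ih h with ⟨rfl, rfl⟩ | ⟨x, rfl, rfl⟩ | ⟨x, rfl, rfl⟩
      · simp
      · exact Or.inr (Or.inl ⟨x, rfl, rfl⟩)
      · exact Or.inr (Or.inr ⟨x, rfl, rfl⟩)
    | consOp => simp [consOf_mul, consOp_mul] at h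
  | consOp ω v w _ ih =>
    cases c with
    | of z' => simp [consOp_mul, of_mul] at h
    | op ω' v' =>
      simp only [op_mul, consOp_mul, consOp.injEq] at h
      exact Or.inr (Or.inl ⟨w, by simp [op_mul, h], h.2.2.symm⟩)
    | consOf z' w' => simp [consOf_mul, consOp_mul] at h
    | consOp ω' v' w' =>
      simp only [consOp_mul, consOp.injEq] at h
      obtain ⟨rfl, rfl, h⟩ := h
      rcases ih h with ⟨rfl, rfl⟩ | ⟨x, rfl, rfl⟩ | ⟨x, rfl, rfl⟩
      · simp
      · exact Or.inr (Or.inl ⟨x, rfl, rfl⟩)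
      · exact Or.inr (Or.inr ⟨x, rfl, rfl⟩)

theorem breadth_eq_one_or (w : OpWord Z) :
    breadth w = 1 ∨ ∃ x w', breadth x = 1 ∧ w = x * w' := by
  cases w with
  | of z => exact Or.inl rfl
  | op ω v => exact Or.inl rfl
  | consOf z w => exact Or.inr ⟨of z, w, rfl, rfl⟩
  | consOp ω v w => exact Or.inr ⟨op ω v, w, rfl, rfl⟩

theorem mul_ne_of_breadth_eq_one {x a b : OpWord Z} (hx : breadth x = 1) : a * b ≠ x := by
  rintro rfl
  rw [breadth_mul] at hx
  have := breadth_pos a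
  have := breadth_pos b
  omega

/-! ### The orders -/

section Order

theorem DlexLt.breadth_le [LT Z] {u v : OpWord Z} (h : DlexLt u v) : breadth u ≤ breadth v := by
  cases u <;> cases v <;> simp only [DlexLt, breadth] at h ⊢ <;> omega

theorem DlexLt.of_breadth_lt [LT Z] {u v : OpWord Z} (h : breadth u < breadth v) : DlexLt u v := by
  have hu := breadth_pos u
  cases u <;> cases v <;> simp only [DlexLt, breadth] at h hu ⊢ <;> omega

/-- One lexicographic rule covers both kinds of letters. With `letter_induction`, it lets later
arguments split off a first letter without a case distinction on constructors. -/
theorem dlexLt_letter_mul [LT Z] {x y u v : OpWord Z} (hx : breadth x = 1) (hy : breadth y = 1) :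
    DlexLt (x * u) (y * v) ↔
      breadth u < breadth v ∨ (breadth u = breadth v ∧ (DlexLt x y ∨ (x = y ∧ DlexLt u v))) := by
  cases x with
  | of z =>
    cases y with
    | of z' => simp [of_mul, DlexLt]
    | op ω' v' => simp [of_mul, op_mul, DlexLt]
    | consOf z' w' => exact absurd hy (by have := breadth_pos w'; simp only [breadth]; omega)
    | consOp ω' v' w' => exact absurd hy (by have := breadth_pos w'; simp only [breadth]; omega)
  | op ω v =>
    cases y with
    | of z' => simp [of_mul, op_mul, DlexLt]
    | op ω' v' => simp [op_mul, DlexLt]; tauto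
    | consOf z' w' => exact absurd hy (by have := breadth_pos w'; simp only [breadth]; omega)
    | consOp ω' v' w' => exact absurd hy (by have := breadth_pos w'; simp only [breadth]; omega)
  | consOf z' w' => exact absurd hx (by have := breadth_pos w'; simp only [breadth]; omega)
  | consOp ω' v' w' => exact absurd hx (by have := breadth_pos w'; simp only [breadth]; omega)

/-- Induction on words by splitting off the first letter. -/
theorem letter_induction {p : OpWord Z → Prop} (of : ∀ z, p (of z))
    (op : ∀ ω v, p v → p (op ω v)) (mul : ∀ x w, breadth x = 1 → p x → p w → p (x * w))
    (w : OpWord Z) : p w := by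
  induction w with
  | of z => exact of z
  | op ω v ih => exact op ω v ih
  | consOf z w ih => exact mul (.of z) w rfl (of z) ih
  | consOp ω v w ih ih' => exact mul (.op ω v) w rfl (op ω v ih) ih'

theorem DlexLt.mul_left [LT Z] {u v : OpWord Z} (h : DlexLt u v) (a : OpWord Z) :
    DlexLt (a * u) (a * v) := by
  have key : ∀ (x u v : OpWord Z), breadth x = 1 → DlexLt u v → DlexLt (x * u) (x * v) := by
    intro x u v hx h
    rw [dlexLt_letter_mul hx hx]
    rcases h.breadth_le.lt_or_eq with h' | h'
    · exact Or.inl h'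
    · exact Or.inr ⟨h', Or.inr ⟨rfl, h⟩⟩
  induction a using letter_induction with
  | of z => exact key _ _ _ rfl h
  | op ω a _ => exact key _ _ _ rfl h
  | mul x w hx _ ih => rw [mul_assoc, mul_assoc]; exact key _ _ _ hx ih

theorem DlexLt.mul_right [LT Z] {u v : OpWord Z} (h : DlexLt u v) (b : OpWord Z) :
    DlexLt (u * b) (v * b) := by
  rcases h.breadth_le.lt_or_eq with h' | h'
  · exact .of_breadth_lt (by simpa only [breadth_mul, add_lt_add_iff_right] using h')
  have base : ∀ x y : OpWord Z, breadth x = 1 → breadth x = breadth y → DlexLt x y →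
      DlexLt (x * b) (y * b) := fun x y hx hy h =>
    (dlexLt_letter_mul hx (hy ▸ hx)).2 (Or.inr ⟨rfl, Or.inl h⟩)
  induction u using letter_induction generalizing v with
  | of z => exact base _ _ rfl h' h
  | op ω a _ => exact base _ _ rfl h' h
  | mul x w hx _ ih =>
    rcases breadth_eq_one_or v with hv | ⟨y, v, hy, rfl⟩
    · rw [hv] at h'; exact absurd rfl (mul_ne_of_breadth_eq_one h')
    have hwv : breadth w = breadth v := by simpa only [breadth_mul, hx, hy, add_right_inj] using h'
    rw [dlexLt_letter_mul hx hy] at h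
    rw [mul_assoc, mul_assoc, dlexLt_letter_mul hx hy]
    refine Or.inr ⟨by rw [breadth_mul, breadth_mul, hwv], ?_⟩
    rcases h with h | ⟨-, h | ⟨rfl, h⟩⟩
    · omega
    · exact Or.inl h
    · exact Or.inr ⟨rfl, ih h hwv⟩

theorem dlexLt_op [LT Z] {ω : OpIdx} {u v : OpWord Z} : DlexLt (op ω u) (op ω v) ↔ DlexLt u v := by
  have : ¬ OpIdx.Lt ω ω := by rintro ⟨rfl, h⟩; cases h
  simp [DlexLt, this]

theorem DlexLt.trichotomous [LinearOrder Z] (u v : OpWord Z) :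
    DlexLt u v ∨ u = v ∨ DlexLt v u := by
  have hop : ∀ a b : OpIdx, OpIdx.Lt a b ∨ a = b ∨ OpIdx.Lt b a := by
    intro a b; cases a <;> cases b <;> simp [OpIdx.Lt]
  induction u using letter_induction generalizing v with
  | of z =>
    cases v with
    | of z' => simpa [DlexLt] using lt_trichotomy z z'
    | op => simp [DlexLt]
    | consOf => simp [DlexLt]
    | consOp => simp [DlexLt]
  | op ω u ih =>
    cases v with
    | of z' => simp [DlexLt]
    | op ω' u' =>
      have h1 := hop ω ω'
      have h2 := ih u'
      simp only [DlexLt, op.injEq]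
      grind
    | consOf => simp [DlexLt]
    | consOp => simp [DlexLt]
  | mul x w hx ihx ihw =>
    rcases breadth_eq_one_or v with hv | ⟨y, v, hy, rfl⟩
    · refine Or.inr (Or.inr (.of_breadth_lt ?_))
      have := breadth_pos w
      rw [breadth_mul]; omega
    · rw [dlexLt_letter_mul hx hy, dlexLt_letter_mul hy hx]
      rcases lt_trichotomy (breadth w) (breadth v) with h | h | h
      · exact Or.inl (Or.inl h)
      · rcases ihx y with h' | rfl | h'
        · exact Or.inl (Or.inr ⟨h, Or.inl h'⟩)
        · rcases ihw v with h'' | rfl | h''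
          · exact Or.inl (Or.inr ⟨h, Or.inr ⟨rfl, h''⟩⟩)
          · exact Or.inr (Or.inl rfl)
          · exact Or.inr (Or.inr (Or.inr ⟨h.symm, Or.inr ⟨rfl, h''⟩⟩))
        · exact Or.inr (Or.inr (Or.inr ⟨h.symm, Or.inl h'⟩))
      · exact Or.inr (Or.inr (Or.inl h))

/-- The total number of brackets and elements of `Z` in a word. -/
def size (w : OpWord Z) : ℕ := degOp OpIdx.D w + degOp OpIdx.P w + degZ w

theorem size_pos (w : OpWord Z) : 0 < size w := Nat.add_pos_right _ (degZ_pos w)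

theorem size_mul (a b : OpWord Z) : size (a * b) = size a + size b := by
  simp only [size, degOp_mul, degZ_mul]; omega

theorem size_op (ω : OpIdx) (v : OpWord Z) : size (op ω v) = size v + 1 := by
  cases ω <;> simp [size, degOp, degZ] <;> omega

/-- The order `<_Dlex` on words of size at most `n`. -/
def DlexLtBdd [LT Z] (n : ℕ) (u v : OpWord Z) : Prop := size u ≤ n ∧ size v ≤ n ∧ DlexLt u v

/-- Letters form three blocks, Z below the D-brackets below the P-brackets. Inside a bracket block
the comparison is that of the contents, which are smaller by one and so covered by the hypothesis at
`n`. -/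
theorem letter_wf [LinearOrder Z] [WellFoundedLT Z] {n : ℕ}
    (h : WellFounded (DlexLtBdd (Z := Z) n)) :
    WellFounded fun u v : OpWord Z => breadth u = 1 ∧ breadth v = 1 ∧ DlexLtBdd (n + 1) u v := by
  set r := fun u v : OpWord Z => breadth u = 1 ∧ breadth v = 1 ∧ DlexLtBdd (n + 1) u v
  have hz : ∀ z : Z, Acc r (of z) := by
    intro z
    induction z using WellFoundedLT.induction with
    | ind z ih =>
      refine ⟨_, fun y hy => ?_⟩
      obtain ⟨hy1, -, -, -, hlt⟩ := hy
      cases y with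
      | of z' => exact ih z' hlt
      | op => simp [DlexLt] at hlt
      | consOf => simp [DlexLt] at hlt
      | consOp => simp [DlexLt] at hlt
  have hD : ∀ v : OpWord Z, Acc r (op OpIdx.D v) := by
    intro v
    induction v using h.induction with
    | _ v ih =>
      refine ⟨_, fun y hy => ?_⟩
      obtain ⟨hy1, -, hs, hs', hlt⟩ := hy
      cases y with
      | of z' => exact hz z'
      | op ω v' =>
        simp only [DlexLt, OpIdx.Lt] at hlt
        rcases hlt with ⟨-, h⟩ | ⟨rfl, hlt⟩
        · cases h
        · rw [size_op] at hs hs'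
          exact ih v' ⟨by omega, by omega, hlt⟩
      | consOf => simp [DlexLt] at hlt
      | consOp => simp [DlexLt] at hlt
  have hP : ∀ v : OpWord Z, Acc r (op OpIdx.P v) := by
    intro v
    induction v using h.induction with
    | _ v ih =>
      refine ⟨_, fun y hy => ?_⟩
      obtain ⟨hy1, -, hs, hs', hlt⟩ := hy
      cases y with
      | of z' => exact hz z'
      | op ω v' =>
        simp only [DlexLt, OpIdx.Lt] at hlt
        rcases hlt with ⟨rfl, -⟩ | ⟨rfl, hlt⟩
        · exact hD v'
        · rw [size_op] at hs hs'
          exact ih v' ⟨by omega, by omega, hlt⟩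
      | consOf => simp [DlexLt] at hlt
      | consOp => simp [DlexLt] at hlt
  refine ⟨fun w => ?_⟩
  rcases breadth_eq_one_or w with hw | ⟨x, w', hx, rfl⟩
  · cases w with
    | of z => exact hz z
    | op ω v => cases ω; exacts [hD v, hP v]
    | consOf z w => exact absurd hw (by have := breadth_pos w; simp only [breadth]; omega)
    | consOp ω v w => exact absurd hw (by have := breadth_pos w; simp only [breadth]; omega)
  · exact ⟨_, fun y hy => absurd rfl (mul_ne_of_breadth_eq_one hy.2.1)⟩

/-- The size bound is essential: P(z) > D(P(z)) > D(D(P(z))) > … is an infinite descent for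
`DlexLt`. With bounded size, one compares lexicographically the breadth, the first letter, and the
remaining word, which has smaller size. -/
theorem dlexLtBdd_wf [LinearOrder Z] [WellFoundedLT Z] (n : ℕ) :
    WellFounded (DlexLtBdd (Z := Z) n) := by
  induction n with
  | zero =>
    refine ⟨fun w => ⟨_, fun y hy => absurd hy.1 ?_⟩⟩
    have := size_pos y
    omega
  | succ n ih =>
    have key := WellFounded.prod_lex (WellFounded.prod_lex (Nat.lt_wfRel.wf) (letter_wf ih)) ih
    -- A one-letter word has no remainder; the second component is then a dummy, never compared
    -- because the first letters already differ.
    have ht : ∀ w : OpWord Z, ∃ t : OpWord Z × OpWord Z,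
        (breadth w = 1 ∧ t = (w, w)) ∨ (breadth t.1 = 1 ∧ w = t.1 * t.2) := by
      intro w
      rcases breadth_eq_one_or w with hw | ⟨x, w', hx, rfl⟩
      · exact ⟨(w, w), Or.inl ⟨hw, rfl⟩⟩
      · exact ⟨(x, w'), Or.inr ⟨hx, rfl⟩⟩
    choose t ht using ht
    refine Subrelation.wf ?_ (InvImage.wf (fun w => ((breadth w, (t w).1), (t w).2)) key)
    intro u v huv
    obtain ⟨hu, hv, hlt⟩ := huv
    simp only [InvImage]
    rcases hlt.breadth_le.lt_or_eq with h | h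
    · exact Prod.Lex.left _ _ (Prod.Lex.left _ _ h)
    have h1 := ht u
    have h2 := ht v
    generalize t u = a at h1
    generalize t v = b at h2
    obtain ⟨x, u'⟩ := a
    obtain ⟨y, v'⟩ := b
    simp only [Prod.mk.injEq] at h1 h2
    rcases h1 with ⟨h1, rfl, rfl⟩ | ⟨h1, rfl⟩
    · rcases h2 with ⟨h2, rfl, rfl⟩ | ⟨h2, rfl⟩
      · rw [h]; exact Prod.Lex.left _ _ (Prod.Lex.right _ ⟨h1, h2, hu, hv, hlt⟩)
      · rw [h1] at h; exact absurd rfl (mul_ne_of_breadth_eq_one h.symm)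
    · rcases h2 with ⟨h2, rfl, rfl⟩ | ⟨h2, rfl⟩
      · rw [h2] at h; exact absurd rfl (mul_ne_of_breadth_eq_one h)
      · rw [dlexLt_letter_mul h1 h2] at hlt
        rw [h]
        simp only [size_mul] at hu hv
        rw [breadth_mul, breadth_mul, h1, h2] at h
        have := size_pos u'
        have := size_pos v'
        have := size_pos x
        have := size_pos y
        rcases hlt with hlt | ⟨-, hlt | ⟨rfl, hlt⟩⟩
        · omega
        · exact Prod.Lex.left _ _ (Prod.Lex.right _ ⟨h1, h2, by dsimp only; omega,
            by dsimp only; omega, hlt⟩)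
        · exact Prod.Lex.right _ ⟨by dsimp only; omega, by dsimp only; omega, hlt⟩

/-- No uniform bound is needed: a descending chain of words of equal size stays within the bound
given by its first member. -/
theorem dlexLt_size_wf [LinearOrder Z] [WellFoundedLT Z] :
    WellFounded fun u v : OpWord Z => size u = size v ∧ DlexLt u v := by
  refine ⟨fun w => ?_⟩
  have : ∀ n, ∀ w : OpWord Z, size w = n →
      Acc (fun u v : OpWord Z => size u = size v ∧ DlexLt u v) w := by
    intro n w
    refine (dlexLtBdd_wf n).induction (C := fun w => size w = n → Acc _ w) w fun w ih hw => ?_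
    exact ⟨_, fun y hy => ih y ⟨(hy.1.trans hw).le, hw.le, hy.2⟩ (hy.1.trans hw)⟩
  exact this _ w rfl

theorem pdLt_wf [LinearOrder Z] [WellFoundedLT Z] : WellFounded (PDLt (Z := Z)) := by
  have nat := Nat.lt_wfRel.wf
  have key := WellFounded.prod_lex nat <| WellFounded.prod_lex nat <| WellFounded.prod_lex nat <|
    WellFounded.prod_lex nat <| WellFounded.prod_lex nat (dlexLt_size_wf (Z := Z))
  refine Subrelation.wf ?_ (InvImage.wf (fun w => (degOp OpIdx.D w, degOp OpIdx.P w, degZ w,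
    degGD w, degGP w, w)) key)
  intro u v h
  simp only [InvImage, Prod.lex_def]
  rcases h with h | ⟨h1, h | ⟨h2, h | ⟨h3, h⟩⟩⟩
  · exact Or.inl h
  · exact Or.inr ⟨h1, Or.inl h⟩
  · exact Or.inr ⟨h1, Or.inr ⟨h2, Or.inl h⟩⟩
  · refine Or.inr ⟨h1, Or.inr ⟨h2, Or.inr ⟨h3, ?_⟩⟩⟩
    -- A tie in the first three degrees is exactly what brings the last comparison into the range of
    -- `dlexLt_size_wf`.
    have hs : size u = size v := by simp only [size, h1, h2, h3]
    rcases h with h | ⟨h4, h | ⟨h5, h⟩⟩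
    · exact Or.inl h
    · exact Or.inr ⟨h4, Or.inl h⟩
    · exact Or.inr ⟨h4, Or.inr ⟨h5, hs, h⟩⟩

theorem PDLt.trichotomous [LinearOrder Z] (u v : OpWord Z) : PDLt u v ∨ u = v ∨ PDLt v u := by
  have := DlexLt.trichotomous u v
  unfold PDLt
  rcases lt_trichotomy (degOp OpIdx.D u) (degOp OpIdx.D v) with h | h | h
  · simp [h]
  · rcases lt_trichotomy (degOp OpIdx.P u) (degOp OpIdx.P v) with h | h | h
    · simp [*]
    · rcases lt_trichotomy (degZ u) (degZ v) with h | h | h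
      · simp [*]
      · rcases lt_trichotomy (degGD u) (degGD v) with h | h | h
        · simp [*]
        · rcases lt_trichotomy (degGP u) (degGP v) with h | h | h
          · simp [*]
          · simp [*]
          · simp [*]
        · simp [*]
      · simp [*]
    · simp [*]
  · simp [h]

instance instIsWellOrderPDLt [LinearOrder Z] [WellFoundedLT Z] :
    IsWellOrder (OpWord Z) PDLt where
  wf := pdLt_wf
  trichotomous a b h1 h2 := by
    rcases PDLt.trichotomous a b with h | h | h
    · exact absurd h h1
    · exact h
    · exact absurd h h2

/-- An outermost bracket has no letter of Z to its right and leaves none outside, so it changes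
neither the GD-degree nor the GP-degree. -/
theorem PDLt.op [LT Z] {u v : OpWord Z} (h : PDLt u v) (ω : OpIdx) :
    PDLt (op ω u) (op ω v) := by
  simp only [PDLt, degOp, degZ, degGD, degGP, dlexLt_op] at h ⊢
  simpa only [add_lt_add_iff_left, add_right_inj] using h

/-- The cross terms in `degGD_mul` and `degGP_mul` depend on the other factor only through its
P-degree and Z-degree. These are already tied when the GD- and GP-degrees are consulted, which
explains the sequence of the comparisons. -/
theorem PDLt.mul_left [LT Z] {u v : OpWord Z} (h : PDLt u v) (a : OpWord Z) :
    PDLt (a * u) (a * v) := by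
  simp only [PDLt, degOp_mul, degZ_mul, degGD_mul, degGP_mul] at h ⊢
  rcases h with h | ⟨h1, h | ⟨h2, h | ⟨h3, h⟩⟩⟩
  · omega
  · omega
  · omega
  · rw [h1, h2, h3]
    have := @DlexLt.mul_left Z _ u v
    grind

theorem PDLt.mul_right [LT Z] {u v : OpWord Z} (h : PDLt u v) (b : OpWord Z) :
    PDLt (u * b) (v * b) := by
  simp only [PDLt, degOp_mul, degZ_mul, degGD_mul, degGP_mul] at h ⊢
  rcases h with h | ⟨h1, h | ⟨h2, h | ⟨h3, h⟩⟩⟩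
  · omega
  · omega
  · omega
  · rw [h1, h2, h3]
    have := @DlexLt.mul_right Z _ u v
    grind

end Order

/-! ### Contexts -/

/-- The maps `u ↦ q|_u` on bracketed words. -/
inductive IsCtx : (OpWord Z → OpWord Z) → Prop
  | id : IsCtx fun u => u
  | op (ω : OpIdx) {f : OpWord Z → OpWord Z} : IsCtx f → IsCtx fun u => op ω (f u)
  | mul_left (a : OpWord Z) {f : OpWord Z → OpWord Z} : IsCtx f → IsCtx fun u => a * f u
  | mul_right (b : OpWord Z) {f : OpWord Z → OpWord Z} : IsCtx f → IsCtx fun u => f u * b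

theorem IsCtx.comp {f g : OpWord Z → OpWord Z} (hf : IsCtx f) (hg : IsCtx g) :
    IsCtx fun u => f (g u) := by
  induction hf with
  | id => exact hg
  | op ω _ ih => exact .op ω ih
  | mul_left a _ ih => exact .mul_left a ih
  | mul_right b _ ih => exact .mul_right b ih

theorem IsCtx.lt [LT Z] {f : OpWord Z → OpWord Z} (hf : IsCtx f) {u v : OpWord Z}
    (h : PDLt u v) : PDLt (f u) (f v) := by
  induction hf with
  | id => exact h
  | op ω _ ih => exact ih.op ω
  | mul_left a _ ih => exact ih.mul_left a
  | mul_right b _ ih => exact ih.mul_right b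

/-- The embedding of `𝔖(Z)` into `𝔖(Z ∪ {⋆})`. -/
def toStar : OpWord Z → OpWord (Option Z)
  | of z => of (some z)
  | op ω v => op ω (toStar v)
  | consOf z w => consOf (some z) (toStar w)
  | consOp ω v w => consOp ω (toStar v) (toStar w)

theorem countStar_toStar (w : OpWord Z) : countStar (toStar w) = 0 := by
  induction w <;> simp [toStar, countStar, *]

theorem subst_toStar (u w : OpWord Z) : subst u (toStar w) = w := by
  induction w <;> simp [toStar, subst, of_mul, op_mul, *]

theorem countStar_mul (a b : OpWord (Option Z)) :
    countStar (a * b) = countStar a + countStar b := by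
  induction a with
  | of z => rfl
  | op ω v _ => rfl
  | consOf z w ih => simp only [consOf_mul, countStar, ih]; omega
  | consOp ω v w _ ih => simp only [consOp_mul, countStar, ih]; omega

theorem subst_mul (u : OpWord Z) (a b : OpWord (Option Z)) :
    subst u (a * b) = subst u a * subst u b := by
  induction a with
  | of z => rfl
  | op ω v _ => rfl
  | consOf z w ih => simp only [consOf_mul, subst, ih, mul_assoc]
  | consOp ω v w _ ih => simp only [consOp_mul, subst, ih, mul_assoc]

theorem exists_toStar (q : OpWord (Option Z)) (h : countStar q = 0) : ∃ w, q = toStar w := by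
  induction q with
  | of z =>
    cases z with
    | none => simp [countStar] at h
    | some z => exact ⟨of z, rfl⟩
  | op ω v ih => obtain ⟨w, rfl⟩ := ih h; exact ⟨op ω w, rfl⟩
  | consOf z w ih =>
    cases z with
    | none => simp [countStar] at h
    | some z =>
      obtain ⟨w, rfl⟩ := ih (by simpa [countStar] using h)
      exact ⟨consOf z w, rfl⟩
  | consOp ω v w ih1 ih2 =>
    simp only [countStar, Nat.add_eq_zero_iff] at h
    obtain ⟨v, rfl⟩ := ih1 h.1
    obtain ⟨w, rfl⟩ := ih2 h.2
    exact ⟨consOp ω v w, rfl⟩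

/-- Since the star occurs once, of any two parts of `q` one is star-free and stays constant under
substitution. -/
theorem isCtx_subst (q : OpWord (Option Z)) (h : countStar q = 1) :
    IsCtx fun u => subst u q := by
  induction q with
  | of z =>
    cases z with
    | none => exact .id
    | some z => simp [countStar] at h
  | op ω v ih => exact .op ω (ih h)
  | consOf z w ih =>
    cases z with
    | none =>
      obtain ⟨w, rfl⟩ := exists_toStar w (by simpa [countStar] using h)
      simp only [subst, subst_toStar]
      exact .mul_right w .id
    | some z => exact .mul_left (of z) (ih (by simpa [countStar] using h))
  | consOp ω v w ih1 ih2 =>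
    simp only [countStar] at h
    simp only [subst]
    rcases Nat.add_eq_one_iff.1 h with ⟨h1, h2⟩ | ⟨h1, h2⟩
    · obtain ⟨v, rfl⟩ := exists_toStar v h1
      simp only [subst_toStar]
      exact .mul_left (op ω v) (ih2 h2)
    · obtain ⟨w, rfl⟩ := exists_toStar w h2
      simp only [subst_toStar]
      exact .mul_right w (.op ω (ih1 h1))

/-- This allows all later arguments about contexts to proceed by induction on how the map is built,
without mention of the star. -/
theorem isCtx_iff {f : OpWord Z → OpWord Z} : IsCtx f ↔ ∃ q : StarWord Z, q.plug = f := by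
  constructor
  · intro hf
    induction hf with
    | id => exact ⟨⟨.of none, rfl⟩, rfl⟩
    | op ω _ ih => obtain ⟨q, rfl⟩ := ih; exact ⟨⟨.op ω q.1, q.2⟩, rfl⟩
    | mul_left a _ ih =>
      obtain ⟨q, rfl⟩ := ih
      refine ⟨⟨toStar a * q.1, by rw [countStar_mul, countStar_toStar, q.2]⟩, ?_⟩
      funext u
      simp only [StarWord.plug, subst_mul, subst_toStar]
    | mul_right b _ ih =>
      obtain ⟨q, rfl⟩ := ih
      refine ⟨⟨q.1 * toStar b, by rw [countStar_mul, countStar_toStar, q.2]⟩, ?_⟩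
      funext u
      simp only [StarWord.plug, subst_mul, subst_toStar]
  · rintro ⟨q, rfl⟩
    exact isCtx_subst q.1 q.2

theorem isMonomialOrder_pdLt [LinearOrder Z] [WellFoundedLT Z] :
    IsMonomialOrder (StarWord.plug (Z := Z)) PDLt :=
  ⟨inferInstance, fun q _ _ h => (isCtx_iff.2 ⟨q, rfl⟩).lt h⟩

end OpWord

/-- `MonoidAlgebra.mapDomain f` as a linear map. -/
noncomputable def mapLin (k : Type*) {S T : Type*} [Field k] (f : S → T) :
    MonoidAlgebra k S →ₗ[k] MonoidAlgebra k T where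
  toFun := MonoidAlgebra.mapDomain f
  map_add' x y := MonoidAlgebra.mapDomain_add _ x y
  map_smul' r x := MonoidAlgebra.mapDomain_smul _ r x

/-! ### Linear extension of maps on monomials, and leading terms. -/

section LinearAlgebra

variable {k S T : Type*} [Field k]

theorem mapLin_apply (f : S → T) (x : MonoidAlgebra k S) :
    mapLin k f x = MonoidAlgebra.mapDomain f x := rfl

theorem mapLin_single (f : S → T) (u : S) (c : k) :
    mapLin k f (MonoidAlgebra.single u c) = MonoidAlgebra.single (f u) c :=
  MonoidAlgebra.mapDomain_single

theorem single_eq_smul (u : S) (c : k) :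
    (MonoidAlgebra.single u c : MonoidAlgebra k S) = c • MonoidAlgebra.single u 1 := by
  rw [MonoidAlgebra.smul_single, smul_eq_mul, mul_one]

theorem linearMap_ext_single {M : Type*} [AddCommMonoid M] [Module k M]
    {f g : MonoidAlgebra k S →ₗ[k] M}
    (h : ∀ u, f (MonoidAlgebra.single u 1) = g (MonoidAlgebra.single u 1)) (x) : f x = g x := by
  induction x using MonoidAlgebra.induction_linear with
  | zero => simp
  | add x y hx hy => rw [map_add, map_add, hx, hy]
  | single u c => rw [single_eq_smul, map_smul, map_smul, h]

theorem mapLin_id (x : MonoidAlgebra k S) : mapLin k (fun u => u) x = x :=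
  linearMap_ext_single (g := LinearMap.id) (fun _ => mapLin_single _ _ _) x

theorem mapLin_comp {R : Type*} (f : T → R) (g : S → T) (x : MonoidAlgebra k S) :
    mapLin k f (mapLin k g x) = mapLin k (fun u => f (g u)) x :=
  linearMap_ext_single (f := mapLin k f ∘ₗ mapLin k g)
    (fun _ => by simp only [LinearMap.comp_apply, mapLin_single]) x

theorem mapLin_mul_left [Semigroup T] (a : T) (f : S → T) (x : MonoidAlgebra k S) :
    mapLin k (fun u => a * f u) x = MonoidAlgebra.single a 1 * mapLin k f x :=
  linearMap_ext_single (g := LinearMap.mulLeft k (MonoidAlgebra.single a (1 : k)) ∘ₗ mapLin k f)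
    (fun _ => by
      simp only [LinearMap.comp_apply, mapLin_single, LinearMap.mulLeft_apply,
        MonoidAlgebra.single_mul_single, mul_one]) x

theorem mapLin_mul_right [Semigroup T] (b : T) (f : S → T) (x : MonoidAlgebra k S) :
    mapLin k (fun u => f u * b) x = mapLin k f x * MonoidAlgebra.single b 1 :=
  linearMap_ext_single (g := LinearMap.mulRight k (MonoidAlgebra.single b (1 : k)) ∘ₗ mapLin k f)
    (fun _ => by
      simp only [LinearMap.comp_apply, mapLin_single, LinearMap.mulRight_apply,
        MonoidAlgebra.single_mul_single, mul_one]) x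

theorem IsLeading.unique {lt : S → S → Prop} [Std.Asymm lt] {x : MonoidAlgebra k S} {m m' : S}
    (h : IsLeading lt x m) (h' : IsLeading lt x m') : m = m' := by
  rcases h.2 m' h'.1 with h1 | h1
  · exact h1.symm
  · rcases h'.2 m h.1 with h2 | h2
    · exact h2
    · exact absurd h2 (asymm_of lt h1)

theorem exists_isLeading {lt : S → S → Prop} [IsWellOrder S lt] {x : MonoidAlgebra k S}
    (hx : x ≠ 0) : ∃ m, IsLeading lt x m := by
  classical
  have h : ∀ s : Finset S, s.Nonempty → ∃ m ∈ s, ∀ m' ∈ s, m' = m ∨ lt m' m := by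
    intro s hs
    induction hs using Finset.Nonempty.cons_induction with
    | singleton a => exact ⟨a, by simp, by simp⟩
    | cons a s ha hs ih =>
      obtain ⟨m, hm, ih⟩ := ih
      rcases trichotomous_of lt a m with h | rfl | h
      · refine ⟨m, by simp [hm], fun m' hm' => ?_⟩
        rcases Finset.mem_cons.1 hm' with rfl | hm'
        · exact Or.inr h
        · exact ih m' hm'
      · exact absurd hm ha
      · refine ⟨a, by simp, fun m' hm' => ?_⟩
        rcases Finset.mem_cons.1 hm' with rfl | hm'
        · exact Or.inl rfl
        · rcases ih m' hm' with rfl | h'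
          · exact Or.inr h
          · exact Or.inr (_root_.trans h' h)
  have hs : x.coeff.support.Nonempty := by
    rw [Finsupp.support_nonempty_iff]
    exact fun h => hx (MonoidAlgebra.coeff_eq_zero.1 h)
  obtain ⟨m, hm, hmax⟩ := h _ hs
  exact ⟨m, Finsupp.mem_support_iff.1 hm, fun m' hm' => hmax m' (Finsupp.mem_support_iff.2 hm')⟩

/-- The combinations of monomials below `p`. -/
def lowerSpan (k : Type*) {S : Type*} [Field k] (lt : S → S → Prop) (p : S) :
    Submodule k (MonoidAlgebra k S) where
  carrier := {x | ∀ u, x.coeff u ≠ 0 → lt u p}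
  zero_mem' := by simp
  add_mem' := by
    intro x y hx hy u hu
    by_cases h : x.coeff u = 0
    · exact hy u (by simpa [h] using hu)
    · exact hx u h
  smul_mem' := by
    intro c x hx u hu
    exact hx u (by rintro h; simp [h] at hu)

theorem single_mem_lowerSpan {lt : S → S → Prop} {p u : S} (h : lt u p) :
    MonoidAlgebra.single u (1 : k) ∈ lowerSpan k lt p := by
  classical
  intro v hv
  rw [MonoidAlgebra.coeff_single, Finsupp.single_apply] at hv
  by_cases huv : u = v
  · exact huv ▸ h
  · simp [huv] at hv

/-- The standard way to use a tail of lower terms: a linear statement about it is checked on single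
monomials below `p`. -/
theorem map_mem_of_mem_lowerSpan {lt : S → S → Prop} {p : S} {x : MonoidAlgebra k S}
    (hx : x ∈ lowerSpan k lt p) {M : Type*} [AddCommMonoid M] [Module k M]
    (L : MonoidAlgebra k S →ₗ[k] M) (N : Submodule k M)
    (h : ∀ u, lt u p → L (MonoidAlgebra.single u 1) ∈ N) : L x ∈ N := by
  rw [← MonoidAlgebra.sum_coeff_single x, Finsupp.sum, map_sum]
  refine N.sum_mem fun u hu => ?_
  rw [single_eq_smul, map_smul]
  exact N.smul_mem _ (h u (hx u (Finsupp.mem_support_iff.1 hu)))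

theorem isLeading_iff_sub_mem {lt : S → S → Prop} [Std.Irrefl lt] {x : MonoidAlgebra k S} {m : S} :
    IsLeading lt x m ↔
      x.coeff m ≠ 0 ∧ x - MonoidAlgebra.single m (x.coeff m) ∈ lowerSpan k lt m := by
  classical
  refine and_congr_right fun h0 => forall_congr' fun u => ?_
  simp only [MonoidAlgebra.coeff_sub, Finsupp.sub_apply, MonoidAlgebra.coeff_single,
      Finsupp.single_apply]
  by_cases h : m = u
  · subst h; simp
  · simp [h, Ne.symm h]

theorem isLeading_of_sub_mem {lt : S → S → Prop} [Std.Irrefl lt] {x : MonoidAlgebra k S} {m : S}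
    {c : k} (hc : c ≠ 0) (h : x - MonoidAlgebra.single m c ∈ lowerSpan k lt m) :
    IsLeading lt x m ∧ x.coeff m = c := by
  classical
  have h0 : x.coeff m = c := by
    by_contra h0
    refine irrefl_of lt m (h m ?_)
    simpa [MonoidAlgebra.coeff_single, Finsupp.single_apply, sub_eq_zero] using h0
  refine ⟨isLeading_iff_sub_mem.2 ⟨h0 ▸ hc, ?_⟩, h0⟩
  rwa [h0]

theorem monicAt_sub_mem {lt : S → S → Prop} [Std.Irrefl lt] {x : MonoidAlgebra k S} {m : S}
    (h : IsLeading lt x m) : monicAt x m - MonoidAlgebra.single m 1 ∈ lowerSpan k lt m := by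
  have h' := (lowerSpan k lt m).smul_mem (x.coeff m)⁻¹ (isLeading_iff_sub_mem.1 h).2
  rwa [smul_sub, MonoidAlgebra.smul_single, smul_eq_mul, inv_mul_cancel₀ h.1] at h'

theorem smul_monicAt {x : MonoidAlgebra k S} {m : S} (h : x.coeff m ≠ 0) :
    x.coeff m • monicAt x m = x := by
  rw [monicAt, smul_smul, mul_inv_cancel₀ h, one_smul]

end LinearAlgebra

/-! ### Positions of subwords and elements trivial modulo (G, p). -/

namespace OpWord

variable {k Z : Type*} [Field k]

theorem mapLin_op (ω : OpIdx) (f : OpWord Z → OpWord Z) (x : MonoidAlgebra k (OpWord Z)) :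
    mapLin k (fun u => op ω (f u)) x = wordOp k Z ω (mapLin k f x) :=
  (mapLin_comp (op ω) f x).symm

/-- Left multiplication by a word or by the empty word. -/
def IsLeftMul (l : OpWord Z → OpWord Z) : Prop := (l = fun u => u) ∨ ∃ a, l = fun u => a * u

/-- Right multiplication by a word or by the empty word. -/
def IsRightMul (r : OpWord Z → OpWord Z) : Prop := (r = fun u => u) ∨ ∃ b, r = fun u => u * b

theorem IsRightMul.isCtx {r : OpWord Z → OpWord Z} (h : IsRightMul r) : IsCtx r := by
  rcases h with rfl | ⟨b, rfl⟩
  exacts [.id, .mul_right b .id]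

theorem IsLeftMul.map_mul {l : OpWord Z → OpWord Z} (h : IsLeftMul l) (u v : OpWord Z) :
    l (u * v) = l u * v := by
  rcases h with rfl | ⟨a, rfl⟩
  exacts [rfl, (mul_assoc a u v).symm]

theorem IsRightMul.map_mul {r : OpWord Z → OpWord Z} (h : IsRightMul r) (u v : OpWord Z) :
    r (u * v) = u * r v := by
  rcases h with rfl | ⟨b, rfl⟩
  exacts [rfl, mul_assoc u v b]

theorem IsLeftMul.cons {l : OpWord Z → OpWord Z} (h : IsLeftMul l) (a : OpWord Z) :
    IsLeftMul fun u => a * l u := by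
  rcases h with rfl | ⟨b, rfl⟩
  exacts [Or.inr ⟨a, rfl⟩, Or.inr ⟨a * b, by simp only [mul_assoc]⟩]

theorem IsRightMul.cons {r : OpWord Z → OpWord Z} (h : IsRightMul r) (a : OpWord Z) :
    IsRightMul fun u => r u * a := by
  rcases h with rfl | ⟨b, rfl⟩
  exacts [Or.inr ⟨a, rfl⟩, Or.inr ⟨b * a, by simp only [mul_assoc]⟩]

/-- The position of a subword of a product: in the left factor, in the right factor, or across
the border. -/
theorem IsCtx.split {f : OpWord Z → OpWord Z} (hf : IsCtx f) {m a b : OpWord Z}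
    (h : f m = a * b) :
    (∃ g, IsCtx g ∧ g m = a ∧ f = fun u => g u * b) ∨
    (∃ g, IsCtx g ∧ g m = b ∧ f = fun u => a * g u) ∨
    ∃ a' b' l r, IsLeftMul l ∧ IsRightMul r ∧ m = a' * b' ∧ a = l a' ∧ b = r b' ∧
      f = fun u => l (r u) := by
  induction hf generalizing a b with
  | id =>
    exact Or.inr (Or.inr ⟨a, b, fun u => u, fun u => u, Or.inl rfl, Or.inl rfl, h, rfl, rfl, rfl⟩)
  | op ω hf ih => exact absurd h.symm (mul_ne_of_breadth_eq_one rfl)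
  | @mul_left c f hf ih =>
    -- The cut between `a` and `b` is at the end of `c`, inside `c`, or inside `f m`; only the last
    -- case needs the induction hypothesis.
    rcases mul_eq_mul_cases h with ⟨rfl, h'⟩ | ⟨x, rfl, h'⟩ | ⟨x, rfl, h'⟩
    · exact Or.inr (Or.inl ⟨f, hf, h', rfl⟩)
    · exact Or.inr (Or.inl ⟨fun u => x * f u, .mul_left x hf, h'.symm, by simp only [mul_assoc]⟩)
    · rcases ih h' with ⟨g, hg, rfl, rfl⟩ | ⟨g, hg, rfl, rfl⟩ |
        ⟨a', b', l, r, hl, hr, rfl, rfl, rfl, rfl⟩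
      · exact Or.inl ⟨fun u => c * g u, .mul_left c hg, rfl, by simp only [mul_assoc]⟩
      · exact Or.inr (Or.inl ⟨g, hg, rfl, by simp only [mul_assoc]⟩)
      · exact Or.inr (Or.inr ⟨a', b', fun u => c * l u, r, hl.cons c, hr, rfl, rfl, rfl, rfl⟩)
  | @mul_right c f hf ih =>
    rcases mul_eq_mul_cases h with ⟨h', rfl⟩ | ⟨x, h', rfl⟩ | ⟨x, rfl, rfl⟩
    · exact Or.inl ⟨f, hf, h', rfl⟩
    · rcases ih h' with ⟨g, hg, rfl, rfl⟩ | ⟨g, hg, rfl, rfl⟩ |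
        ⟨a', b', l, r, hl, hr, rfl, rfl, rfl, rfl⟩
      · exact Or.inl ⟨g, hg, rfl, by simp only [mul_assoc]⟩
      · exact Or.inr (Or.inl ⟨fun u => g u * c, .mul_right c hg, rfl, by simp only [mul_assoc]⟩)
      · exact Or.inr (Or.inr ⟨a', b', l, fun u => r u * c, hl, hr.cons c, rfl, rfl, rfl,
          by simp only [hl.map_mul]⟩)
    · exact Or.inl ⟨fun u => f u * x, .mul_right x hf, rfl, by simp only [mul_assoc]⟩

/-- A single letter cannot be cut, so an occurrence straddling the border after a first letter
starts at that letter. -/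
theorem IsLeftMul.eq_id {l : OpWord Z → OpWord Z} (hl : IsLeftMul l) {x a : OpWord Z}
    (hx : breadth x = 1) (h : x = l a) : (l = fun u => u) := by
  rcases hl with rfl | ⟨b, rfl⟩
  · rfl
  · exact absurd h.symm (mul_ne_of_breadth_eq_one hx)

section Trivial

variable [LT Z] (G : Set (MonoidAlgebra k (OpWord Z)))

/-- The space of elements that are trivial modulo `(G, p)`. -/
noncomputable def triv (p : OpWord Z) : Submodule k (MonoidAlgebra k (OpWord Z)) :=
  Submodule.span k {h | ∃ s ∈ G, ∃ m, IsLeading PDLt s m ∧ ∃ f, IsCtx f ∧ PDLt (f m) p ∧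
    h = mapLin k f s}

theorem trivialMod_iff {p : OpWord Z} {x : MonoidAlgebra k (OpWord Z)} :
    TrivialMod (StarWord.plug (Z := Z)) PDLt G p x ↔ x ∈ triv G p := by
  unfold TrivialMod triv
  congr! 3
  ext h
  constructor
  · rintro ⟨s, hs, m, hm, q, hq, rfl⟩
    exact ⟨s, hs, m, hm, q.plug, isCtx_iff.2 ⟨q, rfl⟩, hq, rfl⟩
  · rintro ⟨s, hs, m, hm, f, hf, hq, rfl⟩
    obtain ⟨q, rfl⟩ := isCtx_iff.1 hf
    exact ⟨s, hs, m, hm, q, hq, rfl⟩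

variable {G}

theorem mapLin_mem_triv {p : OpWord Z} {s : MonoidAlgebra k (OpWord Z)} (hs : s ∈ G) {m : OpWord Z}
    (hm : IsLeading PDLt s m) {f : OpWord Z → OpWord Z} (hf : IsCtx f) (h : PDLt (f m) p) :
    mapLin k f s ∈ triv G p :=
  Submodule.subset_span ⟨s, hs, m, hm, f, hf, h, rfl⟩

theorem mapLin_monicAt_mem_triv {p : OpWord Z} {s : MonoidAlgebra k (OpWord Z)} (hs : s ∈ G)
    {m : OpWord Z} (hm : IsLeading PDLt s m) {f : OpWord Z → OpWord Z} (hf : IsCtx f)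
    (h : PDLt (f m) p) : mapLin k f (monicAt s m) ∈ triv G p := by
  rw [monicAt, map_smul]
  exact Submodule.smul_mem _ _ (mapLin_mem_triv hs hm hf h)

theorem IsCtx.mapLin_triv {f : OpWord Z → OpWord Z} (hf : IsCtx f) {p : OpWord Z}
    {x : MonoidAlgebra k (OpWord Z)} (hx : x ∈ triv G p) : mapLin k f x ∈ triv G (f p) := by
  have : triv G p ≤ (triv G (f p)).comap (mapLin k f) := by
    refine Submodule.span_le.2 ?_
    rintro _ ⟨s, hs, m, hm, g, hg, h, rfl⟩
    simp only [Submodule.comap_coe, Set.mem_preimage, SetLike.mem_coe, mapLin_comp]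
    exact mapLin_mem_triv hs hm (hf.comp hg) (hf.lt h)
  exact this hx

end Trivial

section Diamond

variable [LinearOrder Z] [WellFoundedLT Z] {G : Set (MonoidAlgebra k (OpWord Z))}

theorem IsCtx.sub_mem_lowerSpan {f : OpWord Z → OpWord Z} (hf : IsCtx f)
    {s : MonoidAlgebra k (OpWord Z)} {m : OpWord Z} (hm : IsLeading PDLt s m) :
    mapLin k f (monicAt s m) - MonoidAlgebra.single (f m) 1 ∈ lowerSpan k PDLt (f m) := by
  rw [← mapLin_single, ← map_sub]
  refine map_mem_of_mem_lowerSpan (monicAt_sub_mem hm) _ _ fun u hu => ?_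
  rw [mapLin_single]
  exact single_mem_lowerSpan (hf.lt hu)

/-- Reductions at disjoint places commute: both can be continued to the product of the two tails. No
composition is involved. -/
theorem disjoint_mem_triv {f g : OpWord Z → OpWord Z} (hf : IsCtx f) (hg : IsCtx g)
    {s t : MonoidAlgebra k (OpWord Z)} (hs : s ∈ G) (ht : t ∈ G) {m n : OpWord Z}
    (hm : IsLeading PDLt s m) (hn : IsLeading PDLt t n) :
    mapLin k (fun u => f u * g n) (monicAt s m) - mapLin k (fun u => f m * g u) (monicAt t n) ∈
      triv G (f m * g n) := by
  rw [mapLin_mul_left, mapLin_mul_right]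
  have h1 := hf.sub_mem_lowerSpan hm
  have h2 := hg.sub_mem_lowerSpan hn
  set X := mapLin k f (monicAt s m) with hX
  set Y := mapLin k g (monicAt t n) with hY
  -- Adding and subtracting `X * Y` pairs each relation with the lower terms of the other one.
  have e : X * MonoidAlgebra.single (g n) 1 - MonoidAlgebra.single (f m) 1 * Y =
      (X - MonoidAlgebra.single (f m) 1) * Y - X * (Y - MonoidAlgebra.single (g n) 1) := by
    noncomm_ring
  rw [e]
  refine Submodule.sub_mem _ ?_ ?_
  · refine map_mem_of_mem_lowerSpan h1 (LinearMap.mulRight k Y) _ fun u hu => ?_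
    rw [LinearMap.mulRight_apply, hY, ← mapLin_mul_left]
    exact mapLin_monicAt_mem_triv ht hn (.mul_left u hg) (hu.mul_right _)
  · refine map_mem_of_mem_lowerSpan h2 (LinearMap.mulLeft k X) _ fun u hu => ?_
    rw [LinearMap.mulLeft_apply, hX, ← mapLin_mul_right]
    exact mapLin_monicAt_mem_triv hs hm (.mul_right u hf) (hu.mul_left _)

end Diamond

/-- The span of all `q|_s` with `s ∈ G`. -/
noncomputable def ctxSpan (G : Set (MonoidAlgebra k (OpWord Z))) :
    Submodule k (MonoidAlgebra k (OpWord Z)) :=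
  Submodule.span k {h | ∃ s ∈ G, ∃ f, IsCtx f ∧ h = mapLin k f s}

section Compositions

variable [LT Z] (G : Set (MonoidAlgebra k (OpWord Z)))

/-- The triviality of intersection compositions. -/
def IntersectionTrivial : Prop :=
  ∀ s ∈ G, ∀ t ∈ G, ∀ a x b, IsLeading PDLt s (a * x) → IsLeading PDLt t (x * b) →
    monicAt s (a * x) * MonoidAlgebra.single b 1 -
      MonoidAlgebra.single a 1 * monicAt t (x * b) ∈ triv G (a * (x * b))

/-- The triviality of inclusion compositions. -/
def InclusionTrivial : Prop :=
  ∀ s ∈ G, ∀ t ∈ G, ∀ f n, IsCtx f → IsLeading PDLt s (f n) → IsLeading PDLt t n →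
    monicAt s (f n) - mapLin k f (monicAt t n) ∈ triv G (f n)

variable {G}

/-- The length inequalities say that the two leading monomials really overlap, so the word is `a * x
* b` with a common part `x`; all three parts are nonempty since every word is. -/
theorem isOperatedGSBasis_iff :
    IsOperatedGSBasis G ↔ IntersectionTrivial G ∧ InclusionTrivial G := by
  constructor
  · intro h
    refine ⟨fun s hs t ht a x b hm hn => ?_, fun s hs t ht f n hf hm hn => ?_⟩
    · refine (trivialMod_iff G).1 (h.intersection s hs t ht _ _ hm hn _ _ _
        (mul_assoc a x b).symm rfl ?_ ?_)
      all_goals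
        simp only [breadth_mul]
        have := breadth_pos a
        have := breadth_pos b
        have := breadth_pos x
        omega
    · obtain ⟨q, rfl⟩ := isCtx_iff.1 hf
      exact (trivialMod_iff G).1 (h.inclusion s hs t ht _ _ hm hn q rfl)
  · rintro ⟨h1, h2⟩
    refine ⟨fun s hs t ht m n hm hn p u v hu hv hlt hlt' => ?_,
      fun s hs t ht m n hm hn q hq => ?_⟩
    · subst hu
      rw [breadth_mul] at hlt hlt'
      have hl := congrArg breadth hv
      simp only [breadth_mul] at hl
      rcases mul_eq_mul_cases hv with ⟨rfl, rfl⟩ | ⟨x, rfl, rfl⟩ | ⟨x, rfl, rfl⟩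
      · omega
      · refine (trivialMod_iff G).2 ?_
        rw [mul_assoc]
        exact h1 s hs t ht v x u hm hn
      · simp only [breadth_mul] at hlt'
        have := breadth_pos x
        omega
    · subst hq
      exact (trivialMod_iff G).2 (h2 s hs t ht _ n (isCtx_iff.2 ⟨q, rfl⟩) hm hn)

theorem mem_Irr_iff {w : OpWord Z} :
    w ∈ Irr (StarWord.plug (Z := Z)) PDLt G ↔
      ¬ ∃ s ∈ G, ∃ m, IsLeading PDLt s m ∧ ∃ f, IsCtx f ∧ w = f m := by
  refine not_congr ⟨?_, ?_⟩
  · rintro ⟨s, hs, m, hm, q, rfl⟩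
    exact ⟨s, hs, m, hm, q.plug, isCtx_iff.2 ⟨q, rfl⟩, rfl⟩
  · rintro ⟨s, hs, m, hm, f, hf, rfl⟩
    obtain ⟨q, rfl⟩ := isCtx_iff.1 hf
    exact ⟨s, hs, m, hm, q, rfl⟩

end Compositions

/-! ### The composition-diamond lemma and the basis of irreducible words. -/

section Diamond

variable [LinearOrder Z] [WellFoundedLT Z] {G : Set (MonoidAlgebra k (OpWord Z))}

/-- Here `n` is a prefix of `x * w` reaching into `w`, while the occurrence of `m` lies in `w`.
Relative to the end of `n`, that occurrence is inside `n` (inclusion), beyond it (disjoint), or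
across it (intersection). -/
theorem agree_of_straddle (h1 : IntersectionTrivial G) (h2 : InclusionTrivial G) {x w : OpWord Z}
    {s t : MonoidAlgebra k (OpWord Z)} (hs : s ∈ G) (ht : t ∈ G) {m n : OpWord Z}
    (hm : IsLeading PDLt s m) (hn : IsLeading PDLt t n) {g r : OpWord Z → OpWord Z}
    (hg : IsCtx g) (hr : IsRightMul r) (hgm : g m = w) {b : OpWord Z} (hn' : n = x * b)
    (hb : w = r b) :
    mapLin k (fun u => x * g u) (monicAt s m) - mapLin k r (monicAt t n) ∈ triv G (x * w) := by
  subst hn' hgm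
  rw [← neg_sub]
  refine Submodule.neg_mem _ ?_
  rcases hr with rfl | ⟨c, rfl⟩
  · dsimp only at hb
    subst hb
    rw [mapLin_id]
    exact h2 t ht s hs (fun u => x * g u) m (.mul_left x hg) hn hm
  · have hb' : g m = b * c := hb
    clear hb
    rcases hg.split hb' with ⟨g, hg', rfl, rfl⟩ | ⟨g, hg', rfl, rfl⟩ |
      ⟨a', b', l, r, hl, hr, rfl, rfl, rfl, rfl⟩
    · have := (IsCtx.mul_right c IsCtx.id).mapLin_triv
        (h2 t ht s hs (fun u => x * g u) m (.mul_left x hg') hn hm)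
      rw [map_sub, mapLin_comp] at this
      simpa only [mul_assoc] using this
    · have := disjoint_mem_triv IsCtx.id hg' ht hs hn hm
      simpa only [mul_assoc] using this
    · have key : ∀ a, x * l a' = a * a' → (fun u => x * l u) = (fun u => a * u) →
          monicAt t (x * l a') * MonoidAlgebra.single b' 1 -
            mapLin k (fun u => x * l u) (monicAt s (a' * b')) ∈ triv G (x * l a' * b') := by
        intro a h h'
        rw [h] at hn ⊢
        have := h1 t ht s hs a a' b' hn hm
        rwa [h', mapLin_mul_left, mapLin_id, mul_assoc]
      have key' : monicAt t (x * l a') * MonoidAlgebra.single b' 1 -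
            mapLin k (fun u => x * l u) (monicAt s (a' * b')) ∈ triv G (x * l a' * b') := by
        rcases hl with rfl | ⟨a, rfl⟩
        · exact key x rfl rfl
        · exact key (x * a) (mul_assoc _ _ _).symm (by simp only [mul_assoc])
      have := hr.isCtx.mapLin_triv key'
      have e : mapLin k r (monicAt t (x * l a') * MonoidAlgebra.single b' 1) =
          mapLin k (fun u => u * r b') (monicAt t (x * l a')) := by
        conv_lhs => rw [← mapLin_id (monicAt t (x * l a')), ← mapLin_mul_right, mapLin_comp]
        simp only [hr.map_mul]
      rw [map_sub, mapLin_comp, e, hr.map_mul] at this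
      have e2 : (fun u => r (x * l u)) = fun u => x * l (r u) := by
        funext u
        rcases hl with rfl | ⟨a, rfl⟩
        · exact hr.map_mul _ _
        · simp only [hr.map_mul]
      rw [e2] at this
      dsimp only
      rw [hr.map_mul, hl.map_mul]
      simpa only [mul_assoc] using this

/-- Any two reductions of a word agree modulo trivial elements. -/
theorem sub_mem_triv (h1 : IntersectionTrivial G) (h2 : InclusionTrivial G) {w : OpWord Z}
    {s t : MonoidAlgebra k (OpWord Z)} (hs : s ∈ G) (ht : t ∈ G) {m n : OpWord Z}
    (hm : IsLeading PDLt s m) (hn : IsLeading PDLt t n) {f g : OpWord Z → OpWord Z}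
    (hf : IsCtx f) (hg : IsCtx g) (hfw : f m = w) (hgw : g n = w) :
    mapLin k f (monicAt s m) - mapLin k g (monicAt t n) ∈ triv G w := by
  -- Nested occurrences: an inclusion composition placed in the outer context `r`.
  have hincl : ∀ {s t : MonoidAlgebra k (OpWord Z)}, s ∈ G → t ∈ G → ∀ {m n : OpWord Z},
      IsLeading PDLt s m → IsLeading PDLt t n → ∀ {f r : OpWord Z → OpWord Z}, IsCtx f → IsCtx r →
      f n = m → mapLin k r (monicAt s m) - mapLin k (fun u => r (f u)) (monicAt t n) ∈
        triv G (r m) := by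
    intro s t hs ht m n hm hn f r hf hr h
    subst h
    have := hr.mapLin_triv (h2 s hs t ht f n hf hm hn)
    rwa [map_sub, mapLin_comp] at this
  have hincl' : ∀ {s t : MonoidAlgebra k (OpWord Z)}, s ∈ G → t ∈ G → ∀ {m n : OpWord Z},
      IsLeading PDLt s m → IsLeading PDLt t n → ∀ {f r : OpWord Z → OpWord Z}, IsCtx f → IsCtx r →
      f n = m → mapLin k (fun u => r (f u)) (monicAt t n) - mapLin k r (monicAt s m) ∈
        triv G (r m) := by
    intro s t hs ht m n hm hn f r hf hr h
    rw [← neg_sub]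
    exact Submodule.neg_mem _ (hincl hs ht hm hn hf hr h)
  induction w using letter_induction generalizing s t m n f g with
  | of z =>
    have hne : ∀ a b, a * b ≠ of z := fun _ _ => mul_ne_of_breadth_eq_one rfl
    cases hf with
    | id =>
      dsimp only at hfw
      subst hfw
      exact hincl (r := fun u => u) hs ht hm hn hg .id hgw
    | op => cases hfw
    | mul_left a hf => dsimp only at hfw; exact absurd hfw (hne _ _)
    | mul_right a hf => dsimp only at hfw; exact absurd hfw (hne _ _)
  | op ω v ih =>
    have hne : ∀ a b, a * b ≠ op ω v := fun _ _ => mul_ne_of_breadth_eq_one rfl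
    cases hf with
    | id =>
      dsimp only at hfw
      subst hfw
      exact hincl (r := fun u => u) hs ht hm hn hg .id hgw
    | @op ω f hf =>
      cases hg with
      | id =>
        dsimp only at hgw
        subst hgw
        exact hincl' (r := fun u => u) ht hs hn hm (.op ω hf) .id hfw
      | @op ω' g hg =>
        injection hfw with e1 e2
        injection hgw with e3 e4
        subst e1 e3
        have := (IsCtx.op ω' IsCtx.id).mapLin_triv (ih hs ht hm hn hf hg e2 e4)
        rwa [map_sub, mapLin_comp, mapLin_comp] at this
      | mul_left a hg => dsimp only at hgw; exact absurd hgw (hne _ _)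
      | mul_right a hg => dsimp only at hgw; exact absurd hgw (hne _ _)
    | mul_left a hf => dsimp only at hfw; exact absurd hfw (hne _ _)
    | mul_right a hf => dsimp only at hfw; exact absurd hfw (hne _ _)
  | mul x w hx ihx ihw =>
    -- Each occurrence lies in the first letter `x`, in the rest `w`, or straddles the border. Two
    -- in the same factor are settled by induction, two in different factors are disjoint.
    rcases hf.split hfw with ⟨f', hf', hfx, rfl⟩ | ⟨f', hf', hfw', rfl⟩ |
        ⟨a, b, l, r, hl, hr, hm', h, hb, rfl⟩
    · rcases hg.split hgw with ⟨g', hg', hgx, rfl⟩ | ⟨g', hg', hgw', rfl⟩ |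
        ⟨a, b, l, r, hl, hr, hn', h, hb, rfl⟩
      · have := (IsCtx.mul_right w IsCtx.id).mapLin_triv (ihx hs ht hm hn hf' hg' hfx hgx)
        rwa [map_sub, mapLin_comp, mapLin_comp] at this
      · have := disjoint_mem_triv hf' hg' hs ht hm hn
        rwa [hfx, hgw'] at this
      · obtain rfl := hl.eq_id hx h
        dsimp only at h ⊢
        subst h
        subst hb
        subst hn'
        have := hincl' (f := fun u => f' u * b) ht hs hn hm (.mul_right b hf') hr.isCtx
          (congrArg (· * b) hfx)
        simpa only [hr.map_mul] using this
    · rcases hg.split hgw with ⟨g', hg', hgx, rfl⟩ | ⟨g', hg', hgw', rfl⟩ |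
        ⟨a, b, l, r, hl, hr, hn', h, hb, rfl⟩
      · rw [← neg_sub]
        have := disjoint_mem_triv hg' hf' ht hs hn hm
        rw [hfw', hgx] at this
        exact Submodule.neg_mem _ this
      · have := (IsCtx.mul_left x IsCtx.id).mapLin_triv (ihw hs ht hm hn hf' hg' hfw' hgw')
        rwa [map_sub, mapLin_comp, mapLin_comp] at this
      · obtain rfl := hl.eq_id hx h
        dsimp only at h ⊢
        subst h
        exact agree_of_straddle h1 h2 hs ht hm hn hf' hr hfw' hn' hb
    · obtain rfl := hl.eq_id hx h
      dsimp only at h ⊢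
      subst h
      rcases hg.split hgw with ⟨g', hg', hgx, rfl⟩ | ⟨g', hg', hgw', rfl⟩ |
        ⟨a, b', l, r', hl, hr', hn', h, hb', rfl⟩
      · subst hb
        subst hm'
        have := hincl (f := fun u => g' u * b) hs ht hm hn (.mul_right b hg') hr.isCtx
          (congrArg (· * b) hgx)
        simpa only [hr.map_mul] using this
      · rw [← neg_sub]
        exact Submodule.neg_mem _ (agree_of_straddle h1 h2 ht hs hn hm hg' hr hgw' hm' hb)
      · obtain rfl := hl.eq_id hx h
        dsimp only at h ⊢
        subst h
        -- Both occurrences are now prefixes of `x * w`, so one of them is a prefix of the other and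
        -- they are nested.
        have hw : x * w = r m := by rw [hm', hr.map_mul, hb]
        have hw' : x * w = r' n := by rw [hn', hr'.map_mul, hb']
        rcases hr' with rfl | ⟨c', rfl⟩
        · dsimp only at hw' ⊢
          rw [hw']
          exact hincl' (r := fun u => u) ht hs hn hm hr.isCtx .id (hw.symm.trans hw')
        rcases hr with rfl | ⟨c, rfl⟩
        · dsimp only at hw ⊢
          rw [hw]
          exact hincl (r := fun u => u) hs ht hm hn (.mul_right c' .id) .id (hw'.symm.trans hw)
        · dsimp only at hw hw' ⊢
          rcases mul_eq_mul_cases (hw.symm.trans hw') with ⟨e, rfl⟩ | ⟨y, e, rfl⟩ | ⟨y, e, rfl⟩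
          · rw [hw]
            exact hincl (f := fun u => u) (r := fun u => u * c) hs ht hm hn .id (.mul_right c .id)
              e.symm
          · have := hincl (f := fun u => u * y) (r := fun u => u * c) hs ht hm hn
              (.mul_right y .id) (.mul_right c .id) e.symm
            rw [hw]
            simpa only [mul_assoc] using this
          · have := hincl' (f := fun u => u * y) (r := fun u => u * c') ht hs hn hm
              (.mul_right y .id) (.mul_right c' .id) e.symm
            rw [hw']
            simpa only [mul_assoc] using this

/-- The span of all `q|_s` with `s ∈ G` and `q|_s̄ ≤ p`. -/
noncomputable def leSpan (G : Set (MonoidAlgebra k (OpWord Z))) (p : OpWord Z) :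
    Submodule k (MonoidAlgebra k (OpWord Z)) :=
  Submodule.span k {h | ∃ s ∈ G, ∃ m, IsLeading PDLt s m ∧ ∃ f, IsCtx f ∧
    (f m = p ∨ PDLt (f m) p) ∧ h = mapLin k f s}

theorem leSpan_mono {p p' : OpWord Z} (h : PDLt p p') : leSpan G p ≤ leSpan G p' := by
  refine Submodule.span_mono ?_
  rintro _ ⟨s, hs, m, hm, f, hf, hp, rfl⟩
  refine ⟨s, hs, m, hm, f, hf, Or.inr ?_, rfl⟩
  rcases hp with rfl | hp
  · exact h
  · exact _root_.trans hp h

/-- A combination has finitely many terms, hence a largest word among their q|_s̄. The predicate `Q`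
records that this word is still below a given bound, as the descent requires. -/
theorem exists_mem_leSpan {Q : OpWord Z → Prop} {x : MonoidAlgebra k (OpWord Z)}
    (hx : x ∈ Submodule.span k {h | ∃ s ∈ G, ∃ m, IsLeading PDLt s m ∧ ∃ f, IsCtx f ∧
      Q (f m) ∧ h = mapLin k f s}) :
    x = 0 ∨ ∃ p, Q p ∧ x ∈ leSpan G p := by
  induction hx using Submodule.span_induction with
  | mem x hx =>
    obtain ⟨s, hs, m, hm, f, hf, hp, rfl⟩ := hx
    exact Or.inr ⟨f m, hp, Submodule.subset_span ⟨s, hs, m, hm, f, hf, Or.inl rfl, rfl⟩⟩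
  | zero => exact Or.inl rfl
  | add x y _ _ ihx ihy =>
    rcases ihx with rfl | ⟨p, hp, hx⟩
    · simpa using ihy
    rcases ihy with rfl | ⟨p', hp', hy⟩
    · exact Or.inr ⟨p, hp, by simpa using hx⟩
    rcases trichotomous_of PDLt p p' with h | rfl | h
    · exact Or.inr ⟨p', hp', Submodule.add_mem _ (leSpan_mono h hx) hy⟩
    · exact Or.inr ⟨p, hp, Submodule.add_mem _ hx hy⟩
    · exact Or.inr ⟨p, hp, Submodule.add_mem _ hx (leSpan_mono h hy)⟩
  | smul c x _ ih =>
    rcases ih with rfl | ⟨p, hp, hx⟩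
    · exact Or.inl (smul_zero c)
    · exact Or.inr ⟨p, hp, Submodule.smul_mem _ c hx⟩

theorem exists_mem_leSpan_of_mem_ctxSpan {x : MonoidAlgebra k (OpWord Z)} (hx : x ∈ ctxSpan G) :
    x = 0 ∨ ∃ p, x ∈ leSpan G p := by
  have h : ctxSpan G ≤ Submodule.span k {h | ∃ s ∈ G, ∃ m, IsLeading PDLt s m ∧ ∃ f, IsCtx f ∧
      True ∧ h = mapLin k f s} := by
    refine Submodule.span_le.2 ?_
    rintro _ ⟨s, hs, f, hf, rfl⟩
    by_cases h0 : s = 0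
    · rw [h0, map_zero]; exact Submodule.zero_mem _
    · obtain ⟨m, hm⟩ := exists_isLeading (lt := PDLt) h0
      exact Submodule.subset_span ⟨s, hs, m, hm, f, hf, trivial, rfl⟩
  rcases exists_mem_leSpan (Q := fun _ => True) (h hx) with h | ⟨p, -, hp⟩
  · exact Or.inl h
  · exact Or.inr ⟨p, hp⟩

theorem triv_le_lowerSpan (p : OpWord Z) : triv G p ≤ lowerSpan k PDLt p := by
  refine Submodule.span_le.2 ?_
  rintro _ ⟨s, hs, m, hm, f, hf, hp, rfl⟩
  rw [← smul_monicAt hm.1, map_smul]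
  refine Submodule.smul_mem _ _ ?_
  have h := hf.sub_mem_lowerSpan hm
  rw [← sub_add_cancel (mapLin k f (monicAt s m)) (MonoidAlgebra.single (f m) 1)]
  refine Submodule.add_mem _ (fun u hu => _root_.trans (h u hu) hp) (single_mem_lowerSpan hp)

/-- All generators reaching the top word `p` agree up to scalars modulo terms below `p`, by
`sub_mem_triv`. They collapse to one multiple `c` of a single generator: either `c = 0` and the
bound drops, or `p` survives as leading monomial. -/
theorem mem_leSpan_cases (h1 : IntersectionTrivial G) (h2 : InclusionTrivial G) {p : OpWord Z}
    {x : MonoidAlgebra k (OpWord Z)} (hx : x ∈ leSpan G p) :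
    x ∈ triv G p ∨ (IsLeading PDLt x p ∧ ∃ s ∈ G, ∃ m, IsLeading PDLt s m ∧ ∃ f, IsCtx f ∧
      p = f m) := by
  by_cases hp : ∃ s ∈ G, ∃ m, IsLeading PDLt s m ∧ ∃ f, IsCtx f ∧ p = f m
  · have hp' := hp
    obtain ⟨s, hs, m, hm, f, hf, rfl⟩ := hp
    have h : ∃ c : k, x - c • mapLin k f (monicAt s m) ∈ triv G (f m) := by
      induction hx using Submodule.span_induction with
      | mem x hx =>
        obtain ⟨t, ht, n, hn, g, hg, hgn, rfl⟩ := hx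
        rcases hgn with hgn | hgn
        · refine ⟨t.coeff n, ?_⟩
          conv => enter [2, 1]; rw [← smul_monicAt hn.1, map_smul]
          rw [← smul_sub]
          exact Submodule.smul_mem _ _ (sub_mem_triv h1 h2 ht hs hn hm hg hf hgn rfl)
        · exact ⟨0, by simpa using mapLin_mem_triv ht hn hg hgn⟩
      | zero => exact ⟨0, by simp⟩
      | add x y _ _ ihx ihy =>
        obtain ⟨c, hc⟩ := ihx
        obtain ⟨d, hd⟩ := ihy
        refine ⟨c + d, ?_⟩
        have := Submodule.add_mem _ hc hd
        rwa [add_smul, add_sub_add_comm]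
      | smul a x _ ih =>
        obtain ⟨c, hc⟩ := ih
        refine ⟨a * c, ?_⟩
        have := Submodule.smul_mem _ a hc
        rwa [smul_sub, smul_smul] at this
    obtain ⟨c, hc⟩ := h
    by_cases h0 : c = 0
    · exact Or.inl (by simpa [h0] using hc)
    · refine Or.inr ⟨(isLeading_of_sub_mem h0 ?_).1, hp'⟩
      have h3 := (lowerSpan k PDLt (f m)).smul_mem c (hf.sub_mem_lowerSpan hm)
      have := Submodule.add_mem _ (triv_le_lowerSpan _ hc) h3
      rwa [smul_sub, sub_add_sub_cancel, ← single_eq_smul] at this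
  · left
    refine Submodule.span_mono ?_ hx
    rintro _ ⟨t, ht, n, hn, g, hg, rfl | hgn, rfl⟩
    · exact absurd ⟨t, ht, n, hn, g, hg, rfl⟩ hp
    · exact ⟨t, ht, n, hn, g, hg, hgn, rfl⟩

/-- The composition-diamond lemma: leading monomials of elements of the ideal are reducible. -/
theorem exists_eq_of_isLeading (h1 : IntersectionTrivial G) (h2 : InclusionTrivial G)
    {x : MonoidAlgebra k (OpWord Z)} (hx : x ∈ ctxSpan G) {w : OpWord Z}
    (hw : IsLeading PDLt x w) : ∃ s ∈ G, ∃ m, IsLeading PDLt s m ∧ ∃ f, IsCtx f ∧ w = f m := by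
  have key : ∀ p, ∀ x ∈ leSpan G p, IsLeading PDLt x w →
      ∃ s ∈ G, ∃ m, IsLeading PDLt s m ∧ ∃ f, IsCtx f ∧ w = f m := by
    intro p
    -- Descent on the bound `p`: as long as the top terms cancel, the same element lies in the span
    -- for a smaller bound.
    refine pdLt_wf.induction (C := fun p => ∀ x ∈ leSpan G p, IsLeading PDLt x w →
      ∃ s ∈ G, ∃ m, IsLeading PDLt s m ∧ ∃ f, IsCtx f ∧ w = f m) p fun p ih x hx hw => ?_
    rcases mem_leSpan_cases h1 h2 hx with h | ⟨h, h'⟩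
    · rcases exists_mem_leSpan (Q := fun u => PDLt u p) h with rfl | ⟨p', hp', hx'⟩
      · exact absurd (by simp) hw.1
      · exact ih p' hp' x hx' hw
    · rwa [← h.unique hw]
  rcases exists_mem_leSpan_of_mem_ctxSpan hx with rfl | ⟨p, hp⟩
  · exact absurd (by simp) hw.1
  · exact key p x hp hw

/-- Only termination matters here: modulo `J` a reducible word equals a combination of smaller
words, and the order is well founded. -/
theorem span_irr_eq_top {J : AlgIdeal k (MonoidAlgebra k (OpWord Z))}
    (hJ : ctxSpan G ≤ J.toSubmodule) :
    ⊤ ≤ Submodule.span k (Set.range fun w : Irr (StarWord.plug (Z := Z)) PDLt G =>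
      J.mkₗ (mon k (w : OpWord Z))) := by
  set N := Submodule.span k (Set.range fun w : Irr (StarWord.plug (Z := Z)) PDLt G =>
      J.mkₗ (mon k (w : OpWord Z)))
  have key : ∀ w : OpWord Z, J.mkₗ (MonoidAlgebra.single w 1) ∈ N := by
    intro w
    refine pdLt_wf.induction (C := fun w : OpWord Z => J.mkₗ (MonoidAlgebra.single w 1) ∈ N) w
      fun w ih => ?_
    by_cases hw : w ∈ Irr (StarWord.plug (Z := Z)) PDLt G
    · exact Submodule.subset_span ⟨⟨w, hw⟩, rfl⟩
    · rw [mem_Irr_iff, not_not] at hw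
      obtain ⟨s, hs, m, hm, f, hf, rfl⟩ := hw
      have h := map_mem_of_mem_lowerSpan (hf.sub_mem_lowerSpan hm) J.mkₗ N ih
      have h0 : J.mkₗ (mapLin k f (monicAt s m)) = 0 := by
        rw [← map_zero J.mkₗ, AlgIdeal.mkₗ_eq_iff, sub_zero, monicAt, map_smul]
        exact Submodule.smul_mem _ _ (hJ (Submodule.subset_span ⟨s, hs, f, hf, rfl⟩))
      rw [map_sub, h0, zero_sub] at h
      exact (Submodule.neg_mem_iff _).1 h
  rintro y -
  obtain ⟨x, rfl⟩ := J.mkₗ_surjective y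
  induction x using MonoidAlgebra.induction_linear with
  | zero => rw [map_zero]; exact N.zero_mem
  | add x y hx hy => rw [map_add]; exact N.add_mem hx hy
  | single u c => rw [single_eq_smul, map_smul]; exact N.smul_mem _ (key u)

/-- A nonzero combination of irreducible words in the ideal would have a leading monomial that is
irreducible by choice and reducible by `exists_eq_of_isLeading`. -/
theorem linearIndependent_irr (h1 : IntersectionTrivial G) (h2 : InclusionTrivial G)
    {J : AlgIdeal k (MonoidAlgebra k (OpWord Z))} (hJ : J.toSubmodule ≤ ctxSpan G) :
    LinearIndependent k fun w : Irr (StarWord.plug (Z := Z)) PDLt G =>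
      J.mkₗ (mon k (w : OpWord Z)) := by
  classical
  rw [linearIndependent_iff']
  intro s c hc i hi
  set x : MonoidAlgebra k (OpWord Z) := ∑ i ∈ s, c i • mon k (i : OpWord Z) with hx
  have hcoeff : ∀ u, x.coeff u = ∑ i ∈ s, if (i : OpWord Z) = u then c i else 0 := by
    intro u
    rw [hx, MonoidAlgebra.coeff_sum, Finsupp.finsetSum_apply]
    refine Finset.sum_congr rfl fun i _ => ?_
    simp [mon, Finsupp.single_apply]
  have hmem : x ∈ ctxSpan G := by
    refine hJ ?_
    rw [← sub_zero x, ← AlgIdeal.mkₗ_eq_iff, map_zero, hx, map_sum]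
    simpa only [map_smul] using hc
  have h0 : x = 0 := by
    by_contra h0
    obtain ⟨w, hw⟩ := exists_isLeading (lt := PDLt) h0
    have hred := exists_eq_of_isLeading h1 h2 hmem hw
    refine hw.1 ?_
    rw [hcoeff]
    refine Finset.sum_eq_zero fun j _ => if_neg ?_
    rintro rfl
    exact mem_Irr_iff.1 j.2 hred
  have := hcoeff i
  rw [h0] at this
  simp only [MonoidAlgebra.coeff_zero, Finsupp.coe_zero, Pi.zero_apply, Subtype.coe_inj,
    Finset.sum_ite_eq', hi, if_true] at this
  exact this.symm

/-- The images of the irreducible words form a basis of the quotient. -/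
theorem exists_basis_irr (h1 : IntersectionTrivial G) (h2 : InclusionTrivial G)
    {J : AlgIdeal k (MonoidAlgebra k (OpWord Z))} (hJ : J.toSubmodule = ctxSpan G) :
    ∃ b : Module.Basis (Irr (StarWord.plug (Z := Z)) PDLt G : Set (OpWord Z)) k J.Quotient,
      ∀ w, b w = J.quotMk (mon k (w : OpWord Z)) :=
  ⟨Module.Basis.mk (linearIndependent_irr h1 h2 hJ.le) (span_irr_eq_top hJ.ge),
    fun w => Module.Basis.mk_apply _ _ w⟩

end Diamond

/-! ### The operated ideal generated by a set -/

/-- Contexts are generated by brackets and one-sided products, precisely the operations under which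
an operated ideal is closed. -/
theorem opSpan_toSubmodule (G : Set (MonoidAlgebra k (OpWord Z))) :
    (AlgIdeal.opSpan (wordOp k Z) G).toSubmodule = ctxSpan G := by
  have hmap : ∀ (L : MonoidAlgebra k (OpWord Z) →ₗ[k] MonoidAlgebra k (OpWord Z)),
      (∀ s ∈ G, ∀ f, IsCtx f → L (mapLin k f s) ∈ ctxSpan G) → ∀ x ∈ ctxSpan G,
        L x ∈ ctxSpan G := by
    intro L h x hx
    have : ctxSpan G ≤ (ctxSpan G).comap L := by
      refine Submodule.span_le.2 ?_
      rintro _ ⟨s, hs, f, hf, rfl⟩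
      exact h s hs f hf
    exact this hx
  apply le_antisymm
  · refine sInf_le ⟨⟨ctxSpan G, ?_, ?_⟩, rfl, ?_, ?_⟩
    · intro a x hx
      induction a using MonoidAlgebra.induction_linear with
      | zero => rw [zero_mul]; exact Submodule.zero_mem _
      | add a b ha hb => rw [add_mul]; exact Submodule.add_mem _ ha hb
      | single u c =>
        rw [single_eq_smul, smul_mul_assoc]
        refine Submodule.smul_mem _ _ (hmap (LinearMap.mulLeft k _) (fun s hs f hf => ?_) x hx)
        rw [LinearMap.mulLeft_apply, ← mapLin_mul_left]
        exact Submodule.subset_span ⟨s, hs, _, .mul_left u hf, rfl⟩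
    · intro x a hx
      induction a using MonoidAlgebra.induction_linear with
      | zero => rw [mul_zero]; exact Submodule.zero_mem _
      | add a b ha hb => rw [mul_add]; exact Submodule.add_mem _ ha hb
      | single u c =>
        rw [single_eq_smul, mul_smul_comm]
        refine Submodule.smul_mem _ _ (hmap (LinearMap.mulRight k _) (fun s hs f hf => ?_) x hx)
        rw [LinearMap.mulRight_apply, ← mapLin_mul_right]
        exact Submodule.subset_span ⟨s, hs, _, .mul_right u hf, rfl⟩
    · intro s hs
      exact Submodule.subset_span ⟨s, hs, _, .id, (mapLin_id s).symm⟩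
    · intro ω x hx
      refine hmap _ (fun s hs f hf => ?_) x hx
      rw [← mapLin_op]
      exact Submodule.subset_span ⟨s, hs, _, .op ω hf, rfl⟩
  · refine le_sInf ?_
    rintro _ ⟨I, rfl, hs, hT⟩
    refine Submodule.span_le.2 ?_
    rintro _ ⟨s, hsG, f, hf, rfl⟩
    induction hf with
    | id => rw [mapLin_id]; exact hs hsG
    | op ω hf ih => rw [mapLin_op]; exact hT ω _ ih
    | mul_left a hf ih => rw [mapLin_mul_left]; exact I.mul_mem_left _ _ ih
    | mul_right b hf ih => rw [mapLin_mul_right]; exact I.mul_mem_right _ _ ih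

end OpWord

namespace OpWord

variable {k Z : Type*} [Field k]

theorem mapLin_mon (f : OpWord Z → OpWord Z) (u : OpWord Z) :
    mapLin k f (mon k u) = mon k (f u) := mapLin_single _ _ _

theorem wordOp_mon (ω : OpIdx) (u : OpWord Z) : wordOp k Z ω (mon k u) = mon k (op ω u) :=
  mapLin_single _ _ _

theorem mon_mul_mon (u v : OpWord Z) : mon k u * mon k v = mon k (u * v) := by
  simp only [mon, MonoidAlgebra.single_mul_single, mul_one]

/-! ### Leading monomials of the relations -/

section Order

variable [LT Z] (u v : OpWord Z)

/-- The first four measures tie. The GP-degree decides: the bracket around `u` no longer misses the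
letters of `v`. -/
theorem pdLt_phi1_left : PDLt (op .P (u * op .P v)) (op .P u * op .P v) := by
  have := degZ_pos v
  simp only [PDLt, degOp, degZ, degGD, degGP, degOp_mul, degZ_mul, degGD_mul, degGP_mul,
    reduceCtorEq, if_true, if_false]
  grind

theorem pdLt_phi1_right : PDLt (op .P (op .P u * v)) (op .P u * op .P v) := by
  have := degZ_pos u
  simp only [PDLt, degOp, degZ, degGD, degGP, degOp_mul, degZ_mul, degGD_mul, degGP_mul,
    reduceCtorEq, if_true, if_false]
  grind

theorem pdLt_phi1_mul : PDLt (op .P (u * v)) (op .P u * op .P v) := by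
  simp only [PDLt, degOp, degOp_mul, reduceCtorEq, if_true, if_false]
  omega

theorem pdLt_phi2_left : PDLt (op .D u * v) (op .D u * op .D v) := by
  simp only [PDLt, degOp, degOp_mul, if_true]
  omega

theorem pdLt_phi2_right : PDLt (u * op .D v) (op .D u * op .D v) := by
  simp only [PDLt, degOp, degOp_mul, if_true]
  omega

theorem pdLt_phi2_mul : PDLt (op .D (u * v)) (op .D u * op .D v) := by
  simp only [PDLt, degOp, degOp_mul, if_true]
  omega

theorem pdLt_phi3 : PDLt u (op .D (op .P u)) := by
  simp only [PDLt, degOp, reduceCtorEq, if_true, if_false]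
  omega

/-- All five numeric measures tie, since the bracket of D ends at the right end in both words; the
breadth, 1 against 2, decides. -/
theorem pdLt_phi4_op : PDLt (op .D (op .P u * v)) (op .P u * op .D v) := by
  have h : DlexLt (op .D (op .P u * v)) (op .P u * op .D v) :=
    .of_breadth_lt (by simp [breadth_mul, breadth])
  simp only [PDLt, degOp, degZ, degGD, degGP, degOp_mul, degZ_mul, degGD_mul, degGP_mul, h,
    reduceCtorEq, if_true, if_false]
  grind

theorem pdLt_phi4_mul : PDLt (u * v) (op .P u * op .D v) := by
  simp only [PDLt, degOp, degOp_mul, reduceCtorEq, if_true, if_false]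
  omega

theorem pdLt_phi4_right : PDLt (u * op .D v) (op .P u * op .D v) := by
  simp only [PDLt, degOp, degOp_mul, reduceCtorEq, if_true, if_false]
  omega

/-- The GD-degree decides: moving the right bracket of D to the end removes the letters of `v` from
its right. -/
theorem pdLt_phi5_op : PDLt (op .D (u * op .P v)) (op .D u * op .P v) := by
  have := degZ_pos v
  simp only [PDLt, degOp, degZ, degGD, degGP, degOp_mul, degZ_mul, degGD_mul, degGP_mul,
    reduceCtorEq, if_true, if_false]
  grind

theorem pdLt_phi5_mul : PDLt (u * v) (op .D u * op .P v) := by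
  simp only [PDLt, degOp, degOp_mul, reduceCtorEq, if_true, if_false]
  omega

theorem pdLt_phi5_left : PDLt (op .D u * v) (op .D u * op .P v) := by
  simp only [PDLt, degOp, degOp_mul, reduceCtorEq, if_true, if_false]
  omega

end Order

/-- The linear combinations of the maps `q` that satisfy `q|_u < K u` for all `u`. -/
noncomputable def lowerMaps (k : Type*) {Z : Type*} [Field k] [LT Z] (K : OpWord Z → OpWord Z) :
    Submodule k (MonoidAlgebra k (OpWord Z) →ₗ[k] MonoidAlgebra k (OpWord Z)) :=
  Submodule.span k {L | ∃ f, IsCtx f ∧ (∀ u, PDLt (f u) (K u)) ∧ L = mapLin k f}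

theorem mapLin_mem_lowerMaps [LT Z] {K f : OpWord Z → OpWord Z} (hf : IsCtx f)
    (h : ∀ u, PDLt (f u) (K u)) : mapLin k f ∈ lowerMaps k K :=
  Submodule.subset_span ⟨f, hf, h, rfl⟩

section Rules

variable [LT Z] {G : Set (MonoidAlgebra k (OpWord Z))} {K : OpWord Z → OpWord Z}
  {R : MonoidAlgebra k (OpWord Z) →ₗ[k] MonoidAlgebra k (OpWord Z)}

theorem lowerMaps_mon_mem (hR : R ∈ lowerMaps k K) (u : OpWord Z) :
    R (mon k u) ∈ lowerSpan k PDLt (K u) := by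
  induction hR using Submodule.span_induction with
  | mem L hL =>
    obtain ⟨f, -, h, rfl⟩ := hL
    rw [mapLin_mon]
    exact single_mem_lowerSpan (h u)
  | zero => exact Submodule.zero_mem _
  | add L L' _ _ h h' => exact Submodule.add_mem _ h h'
  | smul c L _ h => exact Submodule.smul_mem _ c h

theorem lowerMaps_mapLin_mem (hR : R ∈ lowerMaps k K) {s : MonoidAlgebra k (OpWord Z)} (hs : s ∈ G)
    {m : OpWord Z} (hm : IsLeading PDLt s m) {f : OpWord Z → OpWord Z} (hf : IsCtx f) :
    R (mapLin k f (monicAt s m)) ∈ triv G (K (f m)) := by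
  induction hR using Submodule.span_induction with
  | mem L hL =>
    obtain ⟨g, hg, h, rfl⟩ := hL
    rw [mapLin_comp]
    exact mapLin_monicAt_mem_triv hs hm (hg.comp hf) (h _)
  | zero => exact Submodule.zero_mem _
  | add L L' _ _ h h' => exact Submodule.add_mem _ h h'
  | smul c L _ h => exact Submodule.smul_mem _ c h

theorem monicAt_of_coeff_eq_one {S : Type*} {x : MonoidAlgebra k S} {m : S} (h : x.coeff m = 1) :
    monicAt x m = x := by
  rw [monicAt, h, inv_one, one_smul]

end Rules

section WellOrder

variable [LinearOrder Z] [WellFoundedLT Z] {G : Set (MonoidAlgebra k (OpWord Z))}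
  {K : OpWord Z → OpWord Z} {R : MonoidAlgebra k (OpWord Z) →ₗ[k] MonoidAlgebra k (OpWord Z)}

/-- The leading monomial of `K u - R u`, where `R` consists of lower terms. -/
theorem isLeading_rule (hR : R ∈ lowerMaps k K) (u : OpWord Z) {x : MonoidAlgebra k (OpWord Z)}
    (hx : x = mon k (K u) - R (mon k u)) : IsLeading PDLt x (K u) ∧ monicAt x (K u) = x := by
  have h := isLeading_of_sub_mem (lt := PDLt) (x := x) (m := K u) (c := 1) one_ne_zero (by
    rw [hx, mon, sub_sub_cancel_left]
    exact Submodule.neg_mem _ (lowerMaps_mon_mem hR u))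
  exact ⟨h.1, monicAt_of_coeff_eq_one h.2⟩

/-- Inclusion compositions inside an argument of a relation are trivial. -/
theorem inclusion_rule (hK : IsCtx K) (hR : R ∈ lowerMaps k K)
    {x : OpWord Z → MonoidAlgebra k (OpWord Z)} (hx : ∀ u, x u = mon k (K u) - R (mon k u))
    (hG : ∀ u, x u ∈ G) {t : MonoidAlgebra k (OpWord Z)} (ht : t ∈ G) {n : OpWord Z}
    (hn : IsLeading PDLt t n) {f : OpWord Z → OpWord Z} (hf : IsCtx f) :
    x (f n) - mapLin k (fun u => K (f u)) (monicAt t n) ∈ triv G (K (f n)) := by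
  rw [← mapLin_comp]
  have h1 := lowerMaps_mapLin_mem hR ht hn hf
  have h2 := hf.sub_mem_lowerSpan hn
  set y := mapLin k f (monicAt t n)
  -- `mapLin k K - R` is the linear extension of `x`, so on the lower terms of `y` it yields
  -- relations `x u` with `u` below `f n`.
  have h3 : (mapLin k K - R) (y - MonoidAlgebra.single (f n) 1) ∈ triv G (K (f n)) := by
    refine map_mem_of_mem_lowerSpan h2 _ _ fun u hu => ?_
    have e : (mapLin k K - R) (MonoidAlgebra.single u 1) = x u := by
      rw [LinearMap.sub_apply, hx]
      exact congrArg (· - _) (mapLin_mon K u)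
    rw [e, ← mapLin_id (x u)]
    exact mapLin_mem_triv (hG u) (isLeading_rule hR u (hx u)).1 .id (hK.lt hu)
  -- Applying the rule and then `t` inside its lower terms, or `t` first and then the rule to each
  -- word of the tail, gives the same result.
  have e : x (f n) - mapLin k K y = -(mapLin k K - R) (y - MonoidAlgebra.single (f n) 1) - R y := by
    rw [hx, ← mon, map_sub, LinearMap.sub_apply, LinearMap.sub_apply, mapLin_mon]
    abel
  rw [e]
  exact Submodule.sub_mem _ (Submodule.neg_mem _ h3) h1

end WellOrder

/-! ### The relations -/

section Relations

variable (lam : k) (u v : OpWord Z)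

theorem phi1_mon : phi1 lam (wordOp k Z) (mon k u) (mon k v) = mon k (op .P u * op .P v) -
    mon k (op .P (u * op .P v)) - mon k (op .P (op .P u * v)) - lam • mon k (op .P (u * v)) := by
  simp only [phi1, wordOp_mon, mon_mul_mon]

theorem phi2_mon : phi2 lam (wordOp k Z) (mon k u) (mon k v) = mon k (op .D u * op .D v) +
    lam⁻¹ • mon k (op .D u * v) + lam⁻¹ • mon k (u * op .D v) - lam⁻¹ • mon k (op .D (u * v)) := by
  simp only [phi2, wordOp_mon, mon_mul_mon]

theorem phi3_mon : phi3 (wordOp k Z) (mon k u) = mon k (op .D (op .P u)) - mon k u := by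
  simp only [phi3, wordOp_mon]

theorem phi4_mon : phi4 lam (wordOp k Z) (mon k u) (mon k v) = mon k (op .P u * op .D v) -
    mon k (op .D (op .P u * v)) + mon k (u * v) + lam • mon k (u * op .D v) := by
  simp only [phi4, wordOp_mon, mon_mul_mon]

theorem phi5_mon : phi5 lam (wordOp k Z) (mon k u) (mon k v) = mon k (op .D u * op .P v) -
    mon k (op .D (u * op .P v)) + mon k (u * v) + lam • mon k (op .D u * v) := by
  simp only [phi5, wordOp_mon, mon_mul_mon]

variable {lam} {G : Set (MonoidAlgebra k (OpWord Z))}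

theorem phi1_mem (hG : SdRB lam Z ⊆ G) : phi1 lam (wordOp k Z) (mon k u) (mon k v) ∈ G :=
  hG ⟨u, v, Or.inl rfl⟩

theorem phi2_mem (hG : SdRB lam Z ⊆ G) : phi2 lam (wordOp k Z) (mon k u) (mon k v) ∈ G :=
  hG ⟨u, v, Or.inr (Or.inl rfl)⟩

theorem phi3_mem (hG : SdRB lam Z ⊆ G) : phi3 (wordOp k Z) (mon k u) ∈ G :=
  hG ⟨u, u, Or.inr (Or.inr (Or.inl rfl))⟩

theorem phi4_mem (hG : SdRB lam Z ⊆ G) : phi4 lam (wordOp k Z) (mon k u) (mon k v) ∈ G :=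
  hG ⟨u, v, Or.inr (Or.inr (Or.inr (Or.inl rfl)))⟩

theorem phi5_mem (hG : SdRB lam Z ⊆ G) : phi5 lam (wordOp k Z) (mon k u) (mon k v) ∈ G :=
  hG ⟨u, v, Or.inr (Or.inr (Or.inr (Or.inr rfl)))⟩

end Relations

section Rules

variable [LT Z] (lam : k) (u v : OpWord Z)

/-- For `inclusion_rule` the relation must be read as a rule linear in one argument with the other
fixed; hence a left and a right version of each two-argument relation. -/
theorem phi1_rule_left : ∃ R ∈ lowerMaps k fun u => op .P u * op .P v, ∀ u,
    phi1 lam (wordOp k Z) (mon k u) (mon k v) = mon k (op .P u * op .P v) - R (mon k u) := by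
  refine ⟨mapLin k (fun u => op .P (u * op .P v)) + mapLin k (fun u => op .P (op .P u * v)) +
    lam • mapLin k (fun u => op .P (u * v)), ?_, fun u => ?_⟩
  · exact Submodule.add_mem _ (Submodule.add_mem _
      (mapLin_mem_lowerMaps (.op _ (.mul_right _ .id)) fun u => pdLt_phi1_left u v)
      (mapLin_mem_lowerMaps (.op _ (.mul_right _ (.op _ .id))) fun u => pdLt_phi1_right u v))
      (Submodule.smul_mem _ _
        (mapLin_mem_lowerMaps (.op _ (.mul_right _ .id)) fun u => pdLt_phi1_mul u v))
  · simp only [phi1_mon, LinearMap.add_apply, LinearMap.smul_apply, mapLin_mon]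
    module

theorem phi1_rule_right : ∃ R ∈ lowerMaps k fun v => op .P u * op .P v, ∀ v,
    phi1 lam (wordOp k Z) (mon k u) (mon k v) = mon k (op .P u * op .P v) - R (mon k v) := by
  refine ⟨mapLin k (fun v => op .P (u * op .P v)) + mapLin k (fun v => op .P (op .P u * v)) +
    lam • mapLin k (fun v => op .P (u * v)), ?_, fun v => ?_⟩
  · exact Submodule.add_mem _ (Submodule.add_mem _
      (mapLin_mem_lowerMaps (.op _ (.mul_left _ (.op _ .id))) fun v => pdLt_phi1_left u v)
      (mapLin_mem_lowerMaps (.op _ (.mul_left _ .id)) fun v => pdLt_phi1_right u v))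
      (Submodule.smul_mem _ _
        (mapLin_mem_lowerMaps (.op _ (.mul_left _ .id)) fun v => pdLt_phi1_mul u v))
  · simp only [phi1_mon, LinearMap.add_apply, LinearMap.smul_apply, mapLin_mon]
    module

theorem phi2_rule_left : ∃ R ∈ lowerMaps k fun u => op .D u * op .D v, ∀ u,
    phi2 lam (wordOp k Z) (mon k u) (mon k v) = mon k (op .D u * op .D v) - R (mon k u) := by
  refine ⟨lam⁻¹ • (mapLin k (fun u => op .D (u * v)) - mapLin k (fun u => op .D u * v) -
    mapLin k (fun u => u * op .D v)), ?_, fun u => ?_⟩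
  · exact Submodule.smul_mem _ _ (Submodule.sub_mem _ (Submodule.sub_mem _
      (mapLin_mem_lowerMaps (.op _ (.mul_right _ .id)) fun u => pdLt_phi2_mul u v)
      (mapLin_mem_lowerMaps (.mul_right _ (.op _ .id)) fun u => pdLt_phi2_left u v))
      (mapLin_mem_lowerMaps (.mul_right _ .id) fun u => pdLt_phi2_right u v))
  · simp only [phi2_mon, LinearMap.sub_apply, LinearMap.smul_apply, mapLin_mon]
    module

theorem phi2_rule_right : ∃ R ∈ lowerMaps k fun v => op .D u * op .D v, ∀ v,
    phi2 lam (wordOp k Z) (mon k u) (mon k v) = mon k (op .D u * op .D v) - R (mon k v) := by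
  refine ⟨lam⁻¹ • (mapLin k (fun v => op .D (u * v)) - mapLin k (fun v => op .D u * v) -
    mapLin k (fun v => u * op .D v)), ?_, fun v => ?_⟩
  · exact Submodule.smul_mem _ _ (Submodule.sub_mem _ (Submodule.sub_mem _
      (mapLin_mem_lowerMaps (.op _ (.mul_left _ .id)) fun v => pdLt_phi2_mul u v)
      (mapLin_mem_lowerMaps (.mul_left _ .id) fun v => pdLt_phi2_left u v))
      (mapLin_mem_lowerMaps (.mul_left _ (.op _ .id)) fun v => pdLt_phi2_right u v))
  · simp only [phi2_mon, LinearMap.sub_apply, LinearMap.smul_apply, mapLin_mon]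
    module

theorem phi3_rule : ∃ R ∈ lowerMaps k fun u : OpWord Z => op .D (op .P u), ∀ u,
    phi3 (wordOp k Z) (mon k u) = mon k (op .D (op .P u)) - R (mon k u) :=
  ⟨mapLin k fun u => u, mapLin_mem_lowerMaps .id fun u => pdLt_phi3 u, fun u => by
    rw [phi3_mon, mapLin_mon]⟩

theorem phi4_rule_left : ∃ R ∈ lowerMaps k fun u => op .P u * op .D v, ∀ u,
    phi4 lam (wordOp k Z) (mon k u) (mon k v) = mon k (op .P u * op .D v) - R (mon k u) := by
  refine ⟨mapLin k (fun u => op .D (op .P u * v)) - mapLin k (fun u => u * v) -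
    lam • mapLin k (fun u => u * op .D v), ?_, fun u => ?_⟩
  · exact Submodule.sub_mem _ (Submodule.sub_mem _
      (mapLin_mem_lowerMaps (.op _ (.mul_right _ (.op _ .id))) fun u => pdLt_phi4_op u v)
      (mapLin_mem_lowerMaps (.mul_right _ .id) fun u => pdLt_phi4_mul u v))
      (Submodule.smul_mem _ _
        (mapLin_mem_lowerMaps (.mul_right _ .id) fun u => pdLt_phi4_right u v))
  · simp only [phi4_mon, LinearMap.sub_apply, LinearMap.smul_apply, mapLin_mon]
    module

theorem phi4_rule_right : ∃ R ∈ lowerMaps k fun v => op .P u * op .D v, ∀ v,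
    phi4 lam (wordOp k Z) (mon k u) (mon k v) = mon k (op .P u * op .D v) - R (mon k v) := by
  refine ⟨mapLin k (fun v => op .D (op .P u * v)) - mapLin k (fun v => u * v) -
    lam • mapLin k (fun v => u * op .D v), ?_, fun v => ?_⟩
  · exact Submodule.sub_mem _ (Submodule.sub_mem _
      (mapLin_mem_lowerMaps (.op _ (.mul_left _ .id)) fun v => pdLt_phi4_op u v)
      (mapLin_mem_lowerMaps (.mul_left _ .id) fun v => pdLt_phi4_mul u v))
      (Submodule.smul_mem _ _
        (mapLin_mem_lowerMaps (.mul_left _ (.op _ .id)) fun v => pdLt_phi4_right u v))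
  · simp only [phi4_mon, LinearMap.sub_apply, LinearMap.smul_apply, mapLin_mon]
    module

theorem phi5_rule_left : ∃ R ∈ lowerMaps k fun u => op .D u * op .P v, ∀ u,
    phi5 lam (wordOp k Z) (mon k u) (mon k v) = mon k (op .D u * op .P v) - R (mon k u) := by
  refine ⟨mapLin k (fun u => op .D (u * op .P v)) - mapLin k (fun u => u * v) -
    lam • mapLin k (fun u => op .D u * v), ?_, fun u => ?_⟩
  · exact Submodule.sub_mem _ (Submodule.sub_mem _
      (mapLin_mem_lowerMaps (.op _ (.mul_right _ .id)) fun u => pdLt_phi5_op u v)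
      (mapLin_mem_lowerMaps (.mul_right _ .id) fun u => pdLt_phi5_mul u v))
      (Submodule.smul_mem _ _
        (mapLin_mem_lowerMaps (.mul_right _ (.op _ .id)) fun u => pdLt_phi5_left u v))
  · simp only [phi5_mon, LinearMap.sub_apply, LinearMap.smul_apply, mapLin_mon]
    module

theorem phi5_rule_right : ∃ R ∈ lowerMaps k fun v => op .D u * op .P v, ∀ v,
    phi5 lam (wordOp k Z) (mon k u) (mon k v) = mon k (op .D u * op .P v) - R (mon k v) := by
  refine ⟨mapLin k (fun v => op .D (u * op .P v)) - mapLin k (fun v => u * v) -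
    lam • mapLin k (fun v => op .D u * v), ?_, fun v => ?_⟩
  · exact Submodule.sub_mem _ (Submodule.sub_mem _
      (mapLin_mem_lowerMaps (.op _ (.mul_left _ (.op _ .id))) fun v => pdLt_phi5_op u v)
      (mapLin_mem_lowerMaps (.mul_left _ .id) fun v => pdLt_phi5_mul u v))
      (Submodule.smul_mem _ _
        (mapLin_mem_lowerMaps (.mul_left _ .id) fun v => pdLt_phi5_left u v))
  · simp only [phi5_mon, LinearMap.sub_apply, LinearMap.smul_apply, mapLin_mon]
    module

end Rules

section Leading

variable [LinearOrder Z] [WellFoundedLT Z] (lam : k) (u v : OpWord Z)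

theorem isLeading_phi1 : IsLeading PDLt (phi1 lam (wordOp k Z) (mon k u) (mon k v))
      (op .P u * op .P v) ∧ monicAt (phi1 lam (wordOp k Z) (mon k u) (mon k v))
      (op .P u * op .P v) = phi1 lam (wordOp k Z) (mon k u) (mon k v) := by
  obtain ⟨R, hR, h⟩ := phi1_rule_left lam v
  exact isLeading_rule hR u (h u)

theorem isLeading_phi2 : IsLeading PDLt (phi2 lam (wordOp k Z) (mon k u) (mon k v))
      (op .D u * op .D v) ∧ monicAt (phi2 lam (wordOp k Z) (mon k u) (mon k v))
      (op .D u * op .D v) = phi2 lam (wordOp k Z) (mon k u) (mon k v) := by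
  obtain ⟨R, hR, h⟩ := phi2_rule_left lam v
  exact isLeading_rule hR u (h u)

theorem isLeading_phi3 : IsLeading PDLt (phi3 (wordOp k Z) (mon k u))
      (op .D (op .P u)) ∧ monicAt (phi3 (wordOp k Z) (mon k u))
      (op .D (op .P u)) = phi3 (wordOp k Z) (mon k u) := by
  obtain ⟨R, hR, h⟩ := phi3_rule (k := k) (Z := Z)
  exact isLeading_rule hR u (h u)

theorem isLeading_phi4 : IsLeading PDLt (phi4 lam (wordOp k Z) (mon k u) (mon k v))
      (op .P u * op .D v) ∧ monicAt (phi4 lam (wordOp k Z) (mon k u) (mon k v))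
      (op .P u * op .D v) = phi4 lam (wordOp k Z) (mon k u) (mon k v) := by
  obtain ⟨R, hR, h⟩ := phi4_rule_left lam v
  exact isLeading_rule hR u (h u)

theorem isLeading_phi5 : IsLeading PDLt (phi5 lam (wordOp k Z) (mon k u) (mon k v))
      (op .D u * op .P v) ∧ monicAt (phi5 lam (wordOp k Z) (mon k u) (mon k v))
      (op .D u * op .P v) = phi5 lam (wordOp k Z) (mon k u) (mon k v) := by
  obtain ⟨R, hR, h⟩ := phi5_rule_left lam v
  exact isLeading_rule hR u (h u)

variable {lam} {G : Set (MonoidAlgebra k (OpWord Z))} {p : OpWord Z}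
  {f : OpWord Z → OpWord Z}

theorem phi1_mem_triv (hG : SdRB lam Z ⊆ G) (hf : IsCtx f) (h : PDLt (f (op .P u * op .P v)) p) :
    mapLin k f (phi1 lam (wordOp k Z) (mon k u) (mon k v)) ∈ triv G p :=
  mapLin_mem_triv (phi1_mem u v hG) (isLeading_phi1 lam u v).1 hf h

theorem phi2_mem_triv (hG : SdRB lam Z ⊆ G) (hf : IsCtx f) (h : PDLt (f (op .D u * op .D v)) p) :
    mapLin k f (phi2 lam (wordOp k Z) (mon k u) (mon k v)) ∈ triv G p :=
  mapLin_mem_triv (phi2_mem u v hG) (isLeading_phi2 lam u v).1 hf h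

theorem phi3_mem_triv (hG : SdRB lam Z ⊆ G) (hf : IsCtx f) (h : PDLt (f (op .D (op .P u))) p) :
    mapLin k f (phi3 (wordOp k Z) (mon k u)) ∈ triv G p :=
  mapLin_mem_triv (phi3_mem u hG) (isLeading_phi3 u).1 hf h

theorem phi4_mem_triv (hG : SdRB lam Z ⊆ G) (hf : IsCtx f) (h : PDLt (f (op .P u * op .D v)) p) :
    mapLin k f (phi4 lam (wordOp k Z) (mon k u) (mon k v)) ∈ triv G p :=
  mapLin_mem_triv (phi4_mem u v hG) (isLeading_phi4 lam u v).1 hf h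

theorem phi5_mem_triv (hG : SdRB lam Z ⊆ G) (hf : IsCtx f) (h : PDLt (f (op .D u * op .P v)) p) :
    mapLin k f (phi5 lam (wordOp k Z) (mon k u) (mon k v)) ∈ triv G p :=
  mapLin_mem_triv (phi5_mem u v hG) (isLeading_phi5 lam u v).1 hf h

end Leading

end OpWord

/-! ### The explicit compositions of φ₁, …, φ₅. -/

namespace OpWord

/-- In the compositions the letters themselves are never compared; the degrees and the breadth
suffice, so each comparison is arithmetic. -/
theorem pdLt_of_measures {Z : Type*} [LT Z] {u v : OpWord Z}
    (h : degOp .D u < degOp .D v ∨ (degOp .D u = degOp .D v ∧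
      (degOp .P u < degOp .P v ∨ (degOp .P u = degOp .P v ∧
      (degZ u < degZ v ∨ (degZ u = degZ v ∧
      (degGD u < degGD v ∨ (degGD u = degGD v ∧
      (degGP u < degGP v ∨ (degGP u = degGP v ∧ breadth u < breadth v)))))))))) : PDLt u v := by
  have := DlexLt.of_breadth_lt (u := u) (v := v)
  unfold PDLt
  tauto

section Compositions

set_option linter.unusedSimpArgs false

variable {k Z : Type*} [Field k] [LinearOrder Z] [WellFoundedLT Z] {lam : k} (u v w : OpWord Z)
  {G : Set (MonoidAlgebra k (OpWord Z))}

/-- φ₁ reads P(u)P(v) = P(u ⋆ v) with u ⋆ v = uP(v) + P(u)v + λuv, and the ambiguity resolves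
because ⋆ is associative modulo φ₁. -/
theorem intersection_PPP (hlam : lam ≠ 0) (hG : SdRB lam Z ⊆ G) :
    phi1 lam (wordOp k Z) (mon k u) (mon k v) * mon k (op .P w) -
      mon k (op .P u) * phi1 lam (wordOp k Z) (mon k v) (mon k w) ∈
      triv G (op .P u * (op .P v * op .P w)) := by
  -- The summands record the further rewriting of both sides to a common form; each has leading
  -- monomial below the overlap word. The other compositions follow the same pattern.
  have e : phi1 lam (wordOp k Z) (mon k u) (mon k v) * mon k (op .P w) -
      mon k (op .P u) * phi1 lam (wordOp k Z) (mon k v) (mon k w) =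
      -mapLin k (fun x => x)
        (phi1 lam (wordOp k Z) (mon k (u * op .P v)) (mon k w)) -
      mapLin k (fun x => x)
        (phi1 lam (wordOp k Z) (mon k (op .P u * v)) (mon k w)) -
      lam • mapLin k (fun x => x)
        (phi1 lam (wordOp k Z) (mon k (u * v)) (mon k w)) +
      mapLin k (fun x => x)
        (phi1 lam (wordOp k Z) (mon k u) (mon k (v * op .P w))) +
      mapLin k (fun x => x)
        (phi1 lam (wordOp k Z) (mon k u) (mon k (op .P v * w))) +
      lam • mapLin k (fun x => x)
        (phi1 lam (wordOp k Z) (mon k u) (mon k (v * w))) -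
      mapLin k (fun x => op .P (u * x))
        (phi1 lam (wordOp k Z) (mon k v) (mon k w)) +
      mapLin k (fun x => op .P (x * w))
        (phi1 lam (wordOp k Z) (mon k u) (mon k v)) := by
    simp only [phi1_mon, phi2_mon, phi3_mon, phi4_mon, phi5_mon, map_add, map_sub, map_smul,
      mapLin_mon, add_mul, sub_mul, mul_add, mul_sub, smul_mul_assoc, mul_smul_comm, mon_mul_mon,
      mul_assoc]
    match_scalars <;> field_simp <;> ring
  rw [e]
  refine Submodule.add_mem _ (Submodule.sub_mem _ (Submodule.add_mem _ (Submodule.add_mem _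
      (Submodule.add_mem _ (Submodule.sub_mem _ (Submodule.sub_mem _ (Submodule.neg_mem _
      (phi1_mem_triv (u * op .P v) w hG .id ?_))
    (phi1_mem_triv (op .P u * v) w hG .id ?_))
    (Submodule.smul_mem _ _ (phi1_mem_triv (u * v) w hG .id ?_)))
    (phi1_mem_triv u (v * op .P w) hG .id ?_))
    (phi1_mem_triv u (op .P v * w) hG .id ?_))
    (Submodule.smul_mem _ _ (phi1_mem_triv u (v * w) hG .id ?_)))
    (phi1_mem_triv v w hG (.op _ (.mul_left _ .id)) ?_))
    (phi1_mem_triv u v hG (.op _ (.mul_right _ .id)) ?_)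
  all_goals
    clear e hG hlam
    apply pdLt_of_measures
    simp only [breadth, degOp, degZ, degGD, degGP, breadth_mul, degOp_mul, degZ_mul, degGD_mul,
      degGP_mul, reduceCtorEq, if_true, if_false]
    have := degZ_pos u
    have := degZ_pos v
    have := degZ_pos w
    grind

/-- Reducing from the right produces D(P(u)P(v)w), where φ₁ inside D meets the terms obtained from
the left. -/
theorem intersection_PPD (hlam : lam ≠ 0) (hG : SdRB lam Z ⊆ G) :
    phi1 lam (wordOp k Z) (mon k u) (mon k v) * mon k (op .D w) -
      mon k (op .P u) * phi4 lam (wordOp k Z) (mon k v) (mon k w) ∈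
      triv G (op .P u * (op .P v * op .D w)) := by
  have e : phi1 lam (wordOp k Z) (mon k u) (mon k v) * mon k (op .D w) -
      mon k (op .P u) * phi4 lam (wordOp k Z) (mon k v) (mon k w) =
      -mapLin k (fun x => x)
        (phi4 lam (wordOp k Z) (mon k (u * op .P v)) (mon k w)) -
      mapLin k (fun x => x)
        (phi4 lam (wordOp k Z) (mon k (op .P u * v)) (mon k w)) -
      lam • mapLin k (fun x => x)
        (phi4 lam (wordOp k Z) (mon k (u * v)) (mon k w)) +
      mapLin k (fun x => x)
        (phi4 lam (wordOp k Z) (mon k u) (mon k (op .P v * w))) +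
      mapLin k (fun x => op .D (x * w))
        (phi1 lam (wordOp k Z) (mon k u) (mon k v)) +
      lam • mapLin k (fun x => u * x)
        (phi4 lam (wordOp k Z) (mon k v) (mon k w)) := by
    simp only [phi1_mon, phi2_mon, phi3_mon, phi4_mon, phi5_mon, map_add, map_sub, map_smul,
      mapLin_mon, add_mul, sub_mul, mul_add, mul_sub, smul_mul_assoc, mul_smul_comm, mon_mul_mon,
      mul_assoc]
    match_scalars <;> field_simp <;> ring
  rw [e]
  refine Submodule.add_mem _ (Submodule.add_mem _ (Submodule.add_mem _ (Submodule.sub_mem _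
      (Submodule.sub_mem _ (Submodule.neg_mem _ (phi4_mem_triv (u * op .P v) w hG .id ?_))
    (phi4_mem_triv (op .P u * v) w hG .id ?_))
    (Submodule.smul_mem _ _ (phi4_mem_triv (u * v) w hG .id ?_)))
    (phi4_mem_triv u (op .P v * w) hG .id ?_))
    (phi1_mem_triv u v hG (.op _ (.mul_right _ .id)) ?_))
    (Submodule.smul_mem _ _ (phi4_mem_triv v w hG (.mul_left _ .id) ?_))
  all_goals
    clear e hG hlam
    apply pdLt_of_measures
    simp only [breadth, degOp, degZ, degGD, degGP, breadth_mul, degOp_mul, degZ_mul, degGD_mul,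
      degGP_mul, reduceCtorEq, if_true, if_false]
    have := degZ_pos u
    have := degZ_pos v
    have := degZ_pos w
    grind

/-- Both reductions meet in D(P(u)vP(w)) up to terms of smaller degree. -/
theorem intersection_PDP (hlam : lam ≠ 0) (hG : SdRB lam Z ⊆ G) :
    phi4 lam (wordOp k Z) (mon k u) (mon k v) * mon k (op .P w) -
      mon k (op .P u) * phi5 lam (wordOp k Z) (mon k v) (mon k w) ∈
      triv G (op .P u * (op .D v * op .P w)) := by
  have e : phi4 lam (wordOp k Z) (mon k u) (mon k v) * mon k (op .P w) -
      mon k (op .P u) * phi5 lam (wordOp k Z) (mon k v) (mon k w) =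
      -mapLin k (fun x => x)
        (phi5 lam (wordOp k Z) (mon k (op .P u * v)) (mon k w)) +
      lam • mapLin k (fun x => u * x)
        (phi5 lam (wordOp k Z) (mon k v) (mon k w)) +
      mapLin k (fun x => x)
        (phi4 lam (wordOp k Z) (mon k u) (mon k (v * op .P w))) -
      lam • mapLin k (fun x => x * w)
        (phi4 lam (wordOp k Z) (mon k u) (mon k v)) := by
    simp only [phi1_mon, phi2_mon, phi3_mon, phi4_mon, phi5_mon, map_add, map_sub, map_smul,
      mapLin_mon, add_mul, sub_mul, mul_add, mul_sub, smul_mul_assoc, mul_smul_comm, mon_mul_mon,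
      mul_assoc]
    match_scalars <;> field_simp <;> ring
  rw [e]
  refine Submodule.sub_mem _ (Submodule.add_mem _ (Submodule.add_mem _ (Submodule.neg_mem _
      (phi5_mem_triv (op .P u * v) w hG .id ?_))
    (Submodule.smul_mem _ _ (phi5_mem_triv v w hG (.mul_left _ .id) ?_)))
    (phi4_mem_triv u (v * op .P w) hG .id ?_))
    (Submodule.smul_mem _ _ (phi4_mem_triv u v hG (.mul_right _ .id) ?_))
  all_goals
    clear e hG hlam
    apply pdLt_of_measures
    simp only [breadth, degOp, degZ, degGD, degGP, breadth_mul, degOp_mul, degZ_mul, degGD_mul,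
      degGP_mul, reduceCtorEq, if_true, if_false]
    have := degZ_pos u
    have := degZ_pos v
    have := degZ_pos w
    grind

theorem intersection_PDD (hlam : lam ≠ 0) (hG : SdRB lam Z ⊆ G) :
    phi4 lam (wordOp k Z) (mon k u) (mon k v) * mon k (op .D w) -
      mon k (op .P u) * phi2 lam (wordOp k Z) (mon k v) (mon k w) ∈
      triv G (op .P u * (op .D v * op .D w)) := by
  have e : phi4 lam (wordOp k Z) (mon k u) (mon k v) * mon k (op .D w) -
      mon k (op .P u) * phi2 lam (wordOp k Z) (mon k v) (mon k w) =
      -mapLin k (fun x => x)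
        (phi2 lam (wordOp k Z) (mon k (op .P u * v)) (mon k w)) +
      lam • mapLin k (fun x => u * x)
        (phi2 lam (wordOp k Z) (mon k v) (mon k w)) -
      lam⁻¹ • mapLin k (fun x => x * w)
        (phi4 lam (wordOp k Z) (mon k u) (mon k v)) +
      lam⁻¹ • mapLin k (fun x => x)
        (phi4 lam (wordOp k Z) (mon k u) (mon k (v * w))) := by
    simp only [phi1_mon, phi2_mon, phi3_mon, phi4_mon, phi5_mon, map_add, map_sub, map_smul,
      mapLin_mon, add_mul, sub_mul, mul_add, mul_sub, smul_mul_assoc, mul_smul_comm, mon_mul_mon,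
      mul_assoc]
    match_scalars <;> field_simp <;> ring
  rw [e]
  refine Submodule.add_mem _ (Submodule.sub_mem _ (Submodule.add_mem _ (Submodule.neg_mem _
      (phi2_mem_triv (op .P u * v) w hG .id ?_))
    (Submodule.smul_mem _ _ (phi2_mem_triv v w hG (.mul_left _ .id) ?_)))
    (Submodule.smul_mem _ _ (phi4_mem_triv u v hG (.mul_right _ .id) ?_)))
    (Submodule.smul_mem _ _ (phi4_mem_triv u (v * w) hG .id ?_))
  all_goals
    clear e hG hlam
    apply pdLt_of_measures
    simp only [breadth, degOp, degZ, degGD, degGP, breadth_mul, degOp_mul, degZ_mul, degGD_mul,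
      degGP_mul, reduceCtorEq, if_true, if_false]
    have := degZ_pos u
    have := degZ_pos v
    have := degZ_pos w
    grind

theorem intersection_DPP (hlam : lam ≠ 0) (hG : SdRB lam Z ⊆ G) :
    phi5 lam (wordOp k Z) (mon k u) (mon k v) * mon k (op .P w) -
      mon k (op .D u) * phi1 lam (wordOp k Z) (mon k v) (mon k w) ∈
      triv G (op .D u * (op .P v * op .P w)) := by
  have e : phi5 lam (wordOp k Z) (mon k u) (mon k v) * mon k (op .P w) -
      mon k (op .D u) * phi1 lam (wordOp k Z) (mon k v) (mon k w) =
      -mapLin k (fun x => x)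
        (phi5 lam (wordOp k Z) (mon k (u * op .P v)) (mon k w)) -
      mapLin k (fun x => op .D (u * x))
        (phi1 lam (wordOp k Z) (mon k v) (mon k w)) +
      mapLin k (fun x => x)
        (phi5 lam (wordOp k Z) (mon k u) (mon k (v * op .P w))) +
      mapLin k (fun x => x)
        (phi5 lam (wordOp k Z) (mon k u) (mon k (op .P v * w))) +
      lam • mapLin k (fun x => x)
        (phi5 lam (wordOp k Z) (mon k u) (mon k (v * w))) -
      lam • mapLin k (fun x => x * w)
        (phi5 lam (wordOp k Z) (mon k u) (mon k v)) := by
    simp only [phi1_mon, phi2_mon, phi3_mon, phi4_mon, phi5_mon, map_add, map_sub, map_smul,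
      mapLin_mon, add_mul, sub_mul, mul_add, mul_sub, smul_mul_assoc, mul_smul_comm, mon_mul_mon,
      mul_assoc]
    match_scalars <;> field_simp <;> ring
  rw [e]
  refine Submodule.sub_mem _ (Submodule.add_mem _ (Submodule.add_mem _ (Submodule.add_mem _
      (Submodule.sub_mem _ (Submodule.neg_mem _ (phi5_mem_triv (u * op .P v) w hG .id ?_))
    (phi1_mem_triv v w hG (.op _ (.mul_left _ .id)) ?_))
    (phi5_mem_triv u (v * op .P w) hG .id ?_))
    (phi5_mem_triv u (op .P v * w) hG .id ?_))
    (Submodule.smul_mem _ _ (phi5_mem_triv u (v * w) hG .id ?_)))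
    (Submodule.smul_mem _ _ (phi5_mem_triv u v hG (.mul_right _ .id) ?_))
  all_goals
    clear e hG hlam
    apply pdLt_of_measures
    simp only [breadth, degOp, degZ, degGD, degGP, breadth_mul, degOp_mul, degZ_mul, degGD_mul,
      degGP_mul, reduceCtorEq, if_true, if_false]
    have := degZ_pos u
    have := degZ_pos v
    have := degZ_pos w
    grind

theorem intersection_DPD (hlam : lam ≠ 0) (hG : SdRB lam Z ⊆ G) :
    phi5 lam (wordOp k Z) (mon k u) (mon k v) * mon k (op .D w) -
      mon k (op .D u) * phi4 lam (wordOp k Z) (mon k v) (mon k w) ∈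
      triv G (op .D u * (op .P v * op .D w)) := by
  have e : phi5 lam (wordOp k Z) (mon k u) (mon k v) * mon k (op .D w) -
      mon k (op .D u) * phi4 lam (wordOp k Z) (mon k v) (mon k w) =
      -mapLin k (fun x => x)
        (phi2 lam (wordOp k Z) (mon k (u * op .P v)) (mon k w)) +
      mapLin k (fun x => x)
        (phi2 lam (wordOp k Z) (mon k u) (mon k (op .P v * w))) +
      lam⁻¹ • mapLin k (fun x => u * x)
        (phi4 lam (wordOp k Z) (mon k v) (mon k w)) -
      lam⁻¹ • mapLin k (fun x => x * w)
        (phi5 lam (wordOp k Z) (mon k u) (mon k v)) := by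
    simp only [phi1_mon, phi2_mon, phi3_mon, phi4_mon, phi5_mon, map_add, map_sub, map_smul,
      mapLin_mon, add_mul, sub_mul, mul_add, mul_sub, smul_mul_assoc, mul_smul_comm, mon_mul_mon,
      mul_assoc]
    match_scalars <;> field_simp <;> ring
  rw [e]
  refine Submodule.sub_mem _ (Submodule.add_mem _ (Submodule.add_mem _ (Submodule.neg_mem _
      (phi2_mem_triv (u * op .P v) w hG .id ?_))
    (phi2_mem_triv u (op .P v * w) hG .id ?_))
    (Submodule.smul_mem _ _ (phi4_mem_triv v w hG (.mul_left _ .id) ?_)))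
    (Submodule.smul_mem _ _ (phi5_mem_triv u v hG (.mul_right _ .id) ?_))
  all_goals
    clear e hG hlam
    apply pdLt_of_measures
    simp only [breadth, degOp, degZ, degGD, degGP, breadth_mul, degOp_mul, degZ_mul, degGD_mul,
      degGP_mul, reduceCtorEq, if_true, if_false]
    have := degZ_pos u
    have := degZ_pos v
    have := degZ_pos w
    grind

theorem intersection_DDP (hlam : lam ≠ 0) (hG : SdRB lam Z ⊆ G) :
    phi2 lam (wordOp k Z) (mon k u) (mon k v) * mon k (op .P w) -
      mon k (op .D u) * phi5 lam (wordOp k Z) (mon k v) (mon k w) ∈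
      triv G (op .D u * (op .D v * op .P w)) := by
  have e : phi2 lam (wordOp k Z) (mon k u) (mon k v) * mon k (op .P w) -
      mon k (op .D u) * phi5 lam (wordOp k Z) (mon k v) (mon k w) =
      lam⁻¹ • mapLin k (fun x => u * x)
        (phi5 lam (wordOp k Z) (mon k v) (mon k w)) -
      lam⁻¹ • mapLin k (fun x => x)
        (phi5 lam (wordOp k Z) (mon k (u * v)) (mon k w)) +
      mapLin k (fun x => x)
        (phi2 lam (wordOp k Z) (mon k u) (mon k (v * op .P w))) -
      lam • mapLin k (fun x => x * w)
        (phi2 lam (wordOp k Z) (mon k u) (mon k v)) := by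
    simp only [phi1_mon, phi2_mon, phi3_mon, phi4_mon, phi5_mon, map_add, map_sub, map_smul,
      mapLin_mon, add_mul, sub_mul, mul_add, mul_sub, smul_mul_assoc, mul_smul_comm, mon_mul_mon,
      mul_assoc]
    match_scalars <;> field_simp <;> ring
  rw [e]
  refine Submodule.sub_mem _ (Submodule.add_mem _ (Submodule.sub_mem _ (Submodule.smul_mem _ _
      (phi5_mem_triv v w hG (.mul_left _ .id) ?_))
    (Submodule.smul_mem _ _ (phi5_mem_triv (u * v) w hG .id ?_)))
    (phi2_mem_triv u (v * op .P w) hG .id ?_))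
    (Submodule.smul_mem _ _ (phi2_mem_triv u v hG (.mul_right _ .id) ?_))
  all_goals
    clear e hG hlam
    apply pdLt_of_measures
    simp only [breadth, degOp, degZ, degGD, degGP, breadth_mul, degOp_mul, degZ_mul, degGD_mul,
      degGP_mul, reduceCtorEq, if_true, if_false]
    have := degZ_pos u
    have := degZ_pos v
    have := degZ_pos w
    grind

/-- Modulo φ₂ the map id + λD is multiplicative, so this ambiguity resolves by associativity of the
product. -/
theorem intersection_DDD (hlam : lam ≠ 0) (hG : SdRB lam Z ⊆ G) :
    phi2 lam (wordOp k Z) (mon k u) (mon k v) * mon k (op .D w) -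
      mon k (op .D u) * phi2 lam (wordOp k Z) (mon k v) (mon k w) ∈
      triv G (op .D u * (op .D v * op .D w)) := by
  have e : phi2 lam (wordOp k Z) (mon k u) (mon k v) * mon k (op .D w) -
      mon k (op .D u) * phi2 lam (wordOp k Z) (mon k v) (mon k w) =
      lam⁻¹ • mapLin k (fun x => u * x)
        (phi2 lam (wordOp k Z) (mon k v) (mon k w)) -
      lam⁻¹ • mapLin k (fun x => x)
        (phi2 lam (wordOp k Z) (mon k (u * v)) (mon k w)) -
      lam⁻¹ • mapLin k (fun x => x * w)
        (phi2 lam (wordOp k Z) (mon k u) (mon k v)) +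
      lam⁻¹ • mapLin k (fun x => x)
        (phi2 lam (wordOp k Z) (mon k u) (mon k (v * w))) := by
    simp only [phi1_mon, phi2_mon, phi3_mon, phi4_mon, phi5_mon, map_add, map_sub, map_smul,
      mapLin_mon, add_mul, sub_mul, mul_add, mul_sub, smul_mul_assoc, mul_smul_comm, mon_mul_mon,
      mul_assoc]
    match_scalars <;> field_simp <;> ring
  rw [e]
  refine Submodule.add_mem _ (Submodule.sub_mem _ (Submodule.sub_mem _ (Submodule.smul_mem _ _
      (phi2_mem_triv v w hG (.mul_left _ .id) ?_))
    (Submodule.smul_mem _ _ (phi2_mem_triv (u * v) w hG .id ?_)))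
    (Submodule.smul_mem _ _ (phi2_mem_triv u v hG (.mul_right _ .id) ?_)))
    (Submodule.smul_mem _ _ (phi2_mem_triv u (v * w) hG .id ?_))
  all_goals
    clear e hG hlam
    apply pdLt_of_measures
    simp only [breadth, degOp, degZ, degGD, degGP, breadth_mul, degOp_mul, degZ_mul, degGD_mul,
      degGP_mul, reduceCtorEq, if_true, if_false]
    have := degZ_pos u
    have := degZ_pos v
    have := degZ_pos w
    grind

/-- This composition shows why φ₄ belongs to the basis: up to φ₃ it equals λ⁻¹φ₄. The mirror image
produces φ₅. -/
theorem inclusion_phi2_phi3 (hlam : lam ≠ 0) (hG : SdRB lam Z ⊆ G) :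
    phi2 lam (wordOp k Z) (mon k (op .P u)) (mon k v) -
      mapLin k (fun x => x * op .D v) (phi3 (wordOp k Z) (mon k u)) ∈
      triv G (op .D (op .P u) * op .D v) := by
  have e : phi2 lam (wordOp k Z) (mon k (op .P u)) (mon k v) -
      mapLin k (fun x => x * op .D v) (phi3 (wordOp k Z) (mon k u)) =
      lam⁻¹ • mapLin k (fun x => x * v)
        (phi3 (wordOp k Z) (mon k u)) +
      lam⁻¹ • mapLin k (fun x => x)
        (phi4 lam (wordOp k Z) (mon k u) (mon k v)) := by
    simp only [phi1_mon, phi2_mon, phi3_mon, phi4_mon, phi5_mon, map_add, map_sub, map_smul,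
      mapLin_mon, add_mul, sub_mul, mul_add, mul_sub, smul_mul_assoc, mul_smul_comm, mon_mul_mon,
      mul_assoc]
    match_scalars <;> field_simp <;> ring
  rw [e]
  refine Submodule.add_mem _ (Submodule.smul_mem _ _ (phi3_mem_triv u hG (.mul_right _ .id) ?_))
    (Submodule.smul_mem _ _ (phi4_mem_triv u v hG .id ?_))
  all_goals
    clear e hG hlam
    apply pdLt_of_measures
    simp only [breadth, degOp, degZ, degGD, degGP, breadth_mul, degOp_mul, degZ_mul, degGD_mul,
      degGP_mul, reduceCtorEq, if_true, if_false]
    have := degZ_pos u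
    have := degZ_pos v
    grind

theorem inclusion_phi2_phi3' (hlam : lam ≠ 0) (hG : SdRB lam Z ⊆ G) :
    phi2 lam (wordOp k Z) (mon k u) (mon k (op .P v)) -
      mapLin k (fun x => op .D u * x) (phi3 (wordOp k Z) (mon k v)) ∈
      triv G (op .D u * op .D (op .P v)) := by
  have e : phi2 lam (wordOp k Z) (mon k u) (mon k (op .P v)) -
      mapLin k (fun x => op .D u * x) (phi3 (wordOp k Z) (mon k v)) =
      lam⁻¹ • mapLin k (fun x => x)
        (phi5 lam (wordOp k Z) (mon k u) (mon k v)) +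
      lam⁻¹ • mapLin k (fun x => u * x)
        (phi3 (wordOp k Z) (mon k v)) := by
    simp only [phi1_mon, phi2_mon, phi3_mon, phi4_mon, phi5_mon, map_add, map_sub, map_smul,
      mapLin_mon, add_mul, sub_mul, mul_add, mul_sub, smul_mul_assoc, mul_smul_comm, mon_mul_mon,
      mul_assoc]
    match_scalars <;> field_simp <;> ring
  rw [e]
  refine Submodule.add_mem _ (Submodule.smul_mem _ _ (phi5_mem_triv u v hG .id ?_))
    (Submodule.smul_mem _ _ (phi3_mem_triv v hG (.mul_left _ .id) ?_))
  all_goals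
    clear e hG hlam
    apply pdLt_of_measures
    simp only [breadth, degOp, degZ, degGD, degGP, breadth_mul, degOp_mul, degZ_mul, degGD_mul,
      degGP_mul, reduceCtorEq, if_true, if_false]
    have := degZ_pos u
    have := degZ_pos v
    grind

/-- φ₅ leads to D(P(u)P(v)); expanding by φ₁ inside D and cancelling D against P returns uP(v), the
result of φ₃. -/
theorem inclusion_phi5_phi3 (hlam : lam ≠ 0) (hG : SdRB lam Z ⊆ G) :
    phi5 lam (wordOp k Z) (mon k (op .P u)) (mon k v) -
      mapLin k (fun x => x * op .P v) (phi3 (wordOp k Z) (mon k u)) ∈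
      triv G (op .D (op .P u) * op .P v) := by
  have e : phi5 lam (wordOp k Z) (mon k (op .P u)) (mon k v) -
      mapLin k (fun x => x * op .P v) (phi3 (wordOp k Z) (mon k u)) =
      -mapLin k (fun x => op .D x)
        (phi1 lam (wordOp k Z) (mon k u) (mon k v)) -
      mapLin k (fun x => x)
        (phi3 (wordOp k Z) (mon k (u * op .P v))) -
      mapLin k (fun x => x)
        (phi3 (wordOp k Z) (mon k (op .P u * v))) -
      lam • mapLin k (fun x => x)
        (phi3 (wordOp k Z) (mon k (u * v))) +
      lam • mapLin k (fun x => x * v)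
        (phi3 (wordOp k Z) (mon k u)) := by
    simp only [phi1_mon, phi2_mon, phi3_mon, phi4_mon, phi5_mon, map_add, map_sub, map_smul,
      mapLin_mon, add_mul, sub_mul, mul_add, mul_sub, smul_mul_assoc, mul_smul_comm, mon_mul_mon,
      mul_assoc]
    match_scalars <;> field_simp <;> ring
  rw [e]
  refine Submodule.add_mem _ (Submodule.sub_mem _ (Submodule.sub_mem _ (Submodule.sub_mem _
      (Submodule.neg_mem _ (phi1_mem_triv u v hG (.op _ .id) ?_))
    (phi3_mem_triv (u * op .P v) hG .id ?_))
    (phi3_mem_triv (op .P u * v) hG .id ?_))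
    (Submodule.smul_mem _ _ (phi3_mem_triv (u * v) hG .id ?_)))
    (Submodule.smul_mem _ _ (phi3_mem_triv u hG (.mul_right _ .id) ?_))
  all_goals
    clear e hG hlam
    apply pdLt_of_measures
    simp only [breadth, degOp, degZ, degGD, degGP, breadth_mul, degOp_mul, degZ_mul, degGD_mul,
      degGP_mul, reduceCtorEq, if_true, if_false]
    have := degZ_pos u
    have := degZ_pos v
    grind

theorem inclusion_phi4_phi3 (hlam : lam ≠ 0) (hG : SdRB lam Z ⊆ G) :
    phi4 lam (wordOp k Z) (mon k u) (mon k (op .P v)) -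
      mapLin k (fun x => op .P u * x) (phi3 (wordOp k Z) (mon k v)) ∈
      triv G (op .P u * op .D (op .P v)) := by
  have e : phi4 lam (wordOp k Z) (mon k u) (mon k (op .P v)) -
      mapLin k (fun x => op .P u * x) (phi3 (wordOp k Z) (mon k v)) =
      -mapLin k (fun x => op .D x)
        (phi1 lam (wordOp k Z) (mon k u) (mon k v)) -
      mapLin k (fun x => x)
        (phi3 (wordOp k Z) (mon k (u * op .P v))) -
      mapLin k (fun x => x)
        (phi3 (wordOp k Z) (mon k (op .P u * v))) -
      lam • mapLin k (fun x => x)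
        (phi3 (wordOp k Z) (mon k (u * v))) +
      lam • mapLin k (fun x => u * x)
        (phi3 (wordOp k Z) (mon k v)) := by
    simp only [phi1_mon, phi2_mon, phi3_mon, phi4_mon, phi5_mon, map_add, map_sub, map_smul,
      mapLin_mon, add_mul, sub_mul, mul_add, mul_sub, smul_mul_assoc, mul_smul_comm, mon_mul_mon,
      mul_assoc]
    match_scalars <;> field_simp <;> ring
  rw [e]
  refine Submodule.add_mem _ (Submodule.sub_mem _ (Submodule.sub_mem _ (Submodule.sub_mem _
      (Submodule.neg_mem _ (phi1_mem_triv u v hG (.op _ .id) ?_))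
    (phi3_mem_triv (u * op .P v) hG .id ?_))
    (phi3_mem_triv (op .P u * v) hG .id ?_))
    (Submodule.smul_mem _ _ (phi3_mem_triv (u * v) hG .id ?_)))
    (Submodule.smul_mem _ _ (phi3_mem_triv v hG (.mul_left _ .id) ?_))
  all_goals
    clear e hG hlam
    apply pdLt_of_measures
    simp only [breadth, degOp, degZ, degGD, degGP, breadth_mul, degOp_mul, degZ_mul, degGD_mul,
      degGP_mul, reduceCtorEq, if_true, if_false]
    have := degZ_pos u
    have := degZ_pos v
    grind

end Compositions

end OpWord

namespace OpWord

variable {Z : Type*}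

/-! ### The embedding of the free semigroup -/

theorem incl_of (z : Z) : incl Z (FreeSemigroup.of z) = of z := FreeSemigroup.lift_of _ _

theorem incl_mul (x y : FreeSemigroup Z) : incl Z (x * y) = incl Z x * incl Z y := map_mul _ _ _

theorem incl_singleton (z : Z) : incl Z ⟨z, []⟩ = of z := incl_of z

theorem incl_cons (z y : Z) (l : List Z) : incl Z ⟨z, y :: l⟩ = of z * incl Z ⟨y, l⟩ := by
  rw [← incl_of, ← incl_mul]
  rfl

theorem breadth_incl (x : FreeSemigroup Z) : breadth (incl Z x) = x.length := by
  induction x using FreeSemigroup.recOnMul with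
  | ih1 z => rfl
  | ih2 z y _ ih => rw [incl_mul, breadth_mul, FreeSemigroup.length_mul, ih]; rfl

theorem degOp_incl (τ : OpIdx) (x : FreeSemigroup Z) : degOp τ (incl Z x) = 0 := by
  induction x using FreeSemigroup.recOnMul with
  | ih1 z => rfl
  | ih2 z y _ ih => rw [incl_mul, degOp_mul, ih]; rfl

theorem degZ_incl (x : FreeSemigroup Z) : degZ (incl Z x) = x.length := by
  induction x using FreeSemigroup.recOnMul with
  | ih1 z => rfl
  | ih2 z y _ ih => rw [incl_mul, degZ_mul, FreeSemigroup.length_mul, ih]; rfl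

theorem degGD_incl (x : FreeSemigroup Z) : degGD (incl Z x) = 0 := by
  induction x using FreeSemigroup.recOnMul with
  | ih1 z => rfl
  | ih2 z y _ ih => rw [incl_mul, degGD_mul, ih, incl_of]; simp [degOp, degGD]

theorem degGP_incl (x : FreeSemigroup Z) : degGP (incl Z x) = 0 := by
  induction x using FreeSemigroup.recOnMul with
  | ih1 z => rfl
  | ih2 z y _ ih => rw [incl_mul, degGP_mul, ih, incl_of, degOp_incl]; simp [degOp, degGP]

theorem incl_ne_of_degOp {x : FreeSemigroup Z} {w : OpWord Z} (τ : OpIdx) (h : degOp τ w ≠ 0) :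
    incl Z x ≠ w := by
  rintro rfl
  exact h (degOp_incl τ x)

theorem incl_ne_op (x : FreeSemigroup Z) (ω : OpIdx) (v : OpWord Z) : incl Z x ≠ op ω v :=
  incl_ne_of_degOp ω (by simp [degOp])

theorem incl_ne_op_mul (x : FreeSemigroup Z) (ω : OpIdx) (u v : OpWord Z) :
    incl Z x ≠ op ω u * v :=
  incl_ne_of_degOp ω (by simp [degOp_mul, degOp])

theorem exists_incl (w : OpWord Z) (h : ∀ τ, degOp τ w = 0) : ∃ x, incl Z x = w := by
  induction w using letter_induction with
  | of z => exact ⟨_, incl_of z⟩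
  | op ω v => simpa [degOp] using h ω
  | mul x w _ ihx ihw =>
    simp only [degOp_mul, Nat.add_eq_zero_iff] at h
    obtain ⟨x, rfl⟩ := ihx fun τ => (h τ).1
    obtain ⟨w, rfl⟩ := ihw fun τ => (h τ).2
    exact ⟨x * w, incl_mul _ _⟩

theorem dlexLt_incl [LinearOrder Z] (l l' : List Z) (x y : Z) :
    DlexLt (incl Z ⟨x, l⟩) (incl Z ⟨y, l'⟩) ↔ List.Shortlex (· < ·) (x :: l) (y :: l') := by
  induction l generalizing x y l' with
  | nil =>
    cases l' with
    | nil =>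
      rw [incl_singleton, incl_singleton, List.shortlex_singleton_iff]
      rfl
    | cons z l' =>
      rw [incl_singleton, incl_cons]
      refine iff_of_true ?_ (.of_length_lt (by simp))
      exact .of_breadth_lt (by rw [breadth_mul]; have := breadth_pos (incl Z ⟨z, l'⟩); exact
        Nat.lt_add_of_pos_right this)
  | cons a l ih =>
    cases l' with
    | nil =>
      rw [incl_singleton, incl_cons]
      refine iff_of_false (fun h => ?_) fun h => ?_
      · have := h.breadth_le
        rw [breadth_mul] at this
        have h1 := breadth_pos (incl Z ⟨a, l⟩)
        simp only [breadth] at this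
        omega
      · simp [List.shortlex_def] at h
    | cons b l' =>
      rw [incl_cons, incl_cons, dlexLt_letter_mul rfl rfl, ih, breadth_incl, breadth_incl]
      simp only [List.shortlex_def, FreeSemigroup.length, List.length_cons, List.cons_lex_cons_iff,
        DlexLt, of.injEq]
      grind

/-- Without brackets every bracket measure vanishes and the Z-degree is the length, so the
comparison reduces to length and then letters. -/
theorem pdLt_incl [LinearOrder Z] (x y : FreeSemigroup Z) :
    PDLt (incl Z x) (incl Z y) ↔ dlexLt x y := by
  obtain ⟨x, l⟩ := x
  obtain ⟨y, l'⟩ := y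
  have h : dlexLt (⟨x, l⟩ : FreeSemigroup Z) ⟨y, l'⟩ ↔
    List.Shortlex (· < ·) (x :: l) (y :: l') := Iff.rfl
  rw [h]
  simp only [PDLt, degOp_incl, degZ_incl, degGD_incl, degGP_incl, dlexLt_incl, lt_self_iff_false,
    false_or, true_and, List.shortlex_def, FreeSemigroup.length, List.length_cons]
  grind

theorem incl_injective : Function.Injective (incl Z) := by
  rintro ⟨x, l⟩ ⟨y, l'⟩ h
  induction l generalizing x y l' with
  | nil =>
    cases l' with
    | nil => rw [incl_singleton, incl_singleton, of.injEq] at h; rw [h]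
    | cons b l' =>
      rw [incl_singleton, incl_cons] at h
      exact absurd h.symm (mul_ne_of_breadth_eq_one rfl)
  | cons a l ih =>
    cases l' with
    | nil =>
      rw [incl_singleton, incl_cons] at h
      exact absurd h (mul_ne_of_breadth_eq_one rfl)
    | cons b l' =>
      rw [incl_cons, incl_cons, of_mul, of_mul, consOf.injEq] at h
      have := ih _ _ _ h.2
      rw [FreeSemigroup.mk.injEq] at this
      rw [h.1, this.1, this.2]

/-- A context whose value is a word without brackets is a context of the free semigroup. -/
theorem IsCtx.exists_assocPlug {f : OpWord Z → OpWord Z} (hf : IsCtx f) {n : OpWord Z}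
    {x : FreeSemigroup Z} (h : f n = incl Z x) :
    (∃ y, n = incl Z y) ∧ ∃ c, ∀ u, f (incl Z u) = incl Z (assocPlug c u) := by
  have hdeg : ∀ τ, degOp τ (f n) = 0 := fun τ => by rw [h, degOp_incl]
  clear h
  induction hf with
  | id =>
    obtain ⟨y, rfl⟩ := exists_incl n hdeg
    exact ⟨⟨y, rfl⟩, (none, none), fun u => rfl⟩
  | op ω hf ih => exact absurd (hdeg ω) (by simp [degOp])
  | mul_left a hf ih =>
    simp only [degOp_mul, Nat.add_eq_zero_iff] at hdeg
    obtain ⟨a, rfl⟩ := exists_incl a fun τ => (hdeg τ).1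
    obtain ⟨hn, ⟨c, d⟩, hc⟩ := ih fun τ => (hdeg τ).2
    refine ⟨hn, (some (c.elim a (a * ·)), d), fun u => ?_⟩
    dsimp only
    rw [hc, ← incl_mul]
    cases c <;> cases d <;> simp [assocPlug, mul_assoc]
  | mul_right b hf ih =>
    simp only [degOp_mul, Nat.add_eq_zero_iff] at hdeg
    obtain ⟨b, rfl⟩ := exists_incl b fun τ => (hdeg τ).2
    obtain ⟨hn, ⟨c, d⟩, hc⟩ := ih fun τ => (hdeg τ).1
    refine ⟨hn, (c, some (d.elim b (· * b))), fun u => ?_⟩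
    dsimp only
    rw [hc, ← incl_mul]
    cases c <;> cases d <;> simp [assocPlug, mul_assoc]

theorem exists_isCtx_assocPlug (c : Option (FreeSemigroup Z) × Option (FreeSemigroup Z)) :
    ∃ f, IsCtx f ∧ ∀ u, f (incl Z u) = incl Z (assocPlug c u) := by
  obtain ⟨a, b⟩ := c
  cases a with
  | none =>
    cases b with
    | none => exact ⟨_, .id, fun u => rfl⟩
    | some b => exact ⟨_, .mul_right (incl Z b) .id, fun u => (incl_mul _ _).symm⟩
  | some a =>
    cases b with
    | none => exact ⟨_, .mul_left (incl Z a) .id, fun u => (incl_mul _ _).symm⟩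
    | some b =>
      refine ⟨_, .mul_left (incl Z a) (.mul_right (incl Z b) .id), fun u => ?_⟩
      simp only [assocPlug, Option.elim, incl_mul]

/-! ### Transport of leading monomials and trivial elements from the free semigroup. -/

section Transport

variable {k : Type*} [Field k]

theorem inclAlg_eq (s : MonoidAlgebra k (FreeSemigroup Z)) : inclAlg s = mapLin k (incl Z) s := rfl

theorem coeff_inclAlg (s : MonoidAlgebra k (FreeSemigroup Z)) (x : FreeSemigroup Z) :
    (inclAlg s).coeff (incl Z x) = s.coeff x :=
  Finsupp.mapDomain_apply incl_injective _ _

theorem exists_of_coeff_inclAlg_ne_zero {s : MonoidAlgebra k (FreeSemigroup Z)} {w : OpWord Z}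
    (h : (inclAlg s).coeff w ≠ 0) : ∃ x, w = incl Z x := by
  by_contra hw
  refine h (Finsupp.mapDomain_of_notMem_range _ _ ?_)
  rintro ⟨x, rfl⟩
  exact hw ⟨x, rfl⟩

theorem isLeading_inclAlg [LinearOrder Z] {s : MonoidAlgebra k (FreeSemigroup Z)} {w : OpWord Z} :
    IsLeading PDLt (inclAlg s) w ↔ ∃ m, w = incl Z m ∧ IsLeading dlexLt s m := by
  constructor
  · intro h
    obtain ⟨m, rfl⟩ := exists_of_coeff_inclAlg_ne_zero h.1
    refine ⟨m, rfl, by rw [← coeff_inclAlg]; exact h.1, fun m' hm' => ?_⟩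
    rw [← coeff_inclAlg] at hm'
    rcases h.2 _ hm' with h' | h'
    · exact Or.inl (incl_injective h')
    · exact Or.inr ((pdLt_incl _ _).1 h')
  · rintro ⟨m, rfl, h⟩
    refine ⟨by rw [coeff_inclAlg]; exact h.1, fun w hw => ?_⟩
    obtain ⟨m', rfl⟩ := exists_of_coeff_inclAlg_ne_zero hw
    rw [coeff_inclAlg] at hw
    rcases h.2 _ hw with rfl | h'
    · exact Or.inl rfl
    · exact Or.inr ((pdLt_incl _ _).2 h')

theorem monicAt_inclAlg (s : MonoidAlgebra k (FreeSemigroup Z)) (m : FreeSemigroup Z) :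
    monicAt (inclAlg s) (incl Z m) = inclAlg (monicAt s m) := by
  rw [monicAt, coeff_inclAlg, monicAt, inclAlg_eq, inclAlg_eq, map_smul]

theorem inclAlg_mul (s t : MonoidAlgebra k (FreeSemigroup Z)) :
    inclAlg (s * t) = inclAlg s * inclAlg t := MonoidAlgebra.mapDomain_mul _ _ _

theorem triv_mono [LT Z] {G H : Set (MonoidAlgebra k (OpWord Z))} (h : G ⊆ H) (p : OpWord Z) :
    triv G p ≤ triv H p := by
  refine Submodule.span_mono ?_
  rintro x ⟨s, hs, hx⟩
  exact ⟨s, h hs, hx⟩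

theorem inclAlg_mem_triv [LinearOrder Z] {G : Set (MonoidAlgebra k (FreeSemigroup Z))}
    {H : Set (MonoidAlgebra k (OpWord Z))} (hH : inclAlg '' G ⊆ H) {p : FreeSemigroup Z}
    {x : MonoidAlgebra k (FreeSemigroup Z)} (hx : TrivialMod assocPlug dlexLt G p x) :
    inclAlg x ∈ triv H (incl Z p) := by
  refine triv_mono hH _ ?_
  have : Submodule.span k {h : MonoidAlgebra k (FreeSemigroup Z) | ∃ s ∈ G, ∃ m,
      IsLeading dlexLt s m ∧ ∃ q, dlexLt (assocPlug q m) p ∧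
        h = MonoidAlgebra.mapDomain (assocPlug q) s} ≤
      (triv (inclAlg '' G) (incl Z p)).comap (mapLin k (incl Z)) := by
    refine Submodule.span_le.2 ?_
    rintro _ ⟨s, hs, m, hm, c, hc, rfl⟩
    obtain ⟨f, hf, hfc⟩ := exists_isCtx_assocPlug c
    have e : mapLin k (incl Z) (mapLin k (assocPlug c) s) = mapLin k f (inclAlg s) := by
      rw [inclAlg_eq, mapLin_comp, mapLin_comp]
      simp only [hfc]
    simp only [Submodule.comap_coe, Set.mem_preimage, SetLike.mem_coe]
    rw [← mapLin_apply, e]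
    exact mapLin_mem_triv (Set.mem_image_of_mem _ hs) (isLeading_inclAlg.2 ⟨m, rfl, hm⟩) hf
      (by rw [hfc]; exact (pdLt_incl _ _).2 hc)
  exact this hx

end Transport

/-! ### The Gröbner–Shirshov basis -/

theorem mul_eq_mul_of_breadth_eq_one {a b x y : OpWord Z} (hx : breadth x = 1) (hy : breadth y = 1)
    (h : a * b = x * y) : a = x ∧ b = y := by
  rcases mul_eq_mul_cases h with h | ⟨c, -, h⟩ | ⟨c, h, -⟩
  · exact h
  · exact absurd h.symm (mul_ne_of_breadth_eq_one hy)
  · exact absurd h.symm (mul_ne_of_breadth_eq_one hx)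

theorem eq_op_of_isCtx {f : OpWord Z → OpWord Z} (hf : IsCtx f) {n u : OpWord Z} {ω : OpIdx}
    (h : f n = op ω u) : (f = fun x => x) ∨ ∃ g, IsCtx g ∧ g n = u ∧ f = fun x => op ω (g x) := by
  cases hf with
  | id => exact Or.inl rfl
  | @op ω' g hg =>
    injection h with h1 h2
    subst h1
    exact Or.inr ⟨g, hg, h2, rfl⟩
  | mul_left a hf => exact absurd h (mul_ne_of_breadth_eq_one (x := op ω u) rfl)
  | mul_right a hf => exact absurd h (mul_ne_of_breadth_eq_one (x := op ω u) rfl)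

/-- A word of two letters has no proper factor across the border, so an occurrence is the whole word
or lies in one letter. -/
theorem eq_op_mul_op_of_isCtx {f : OpWord Z → OpWord Z} (hf : IsCtx f) {n u v : OpWord Z}
    {ω ω' : OpIdx} (h : f n = op ω u * op ω' v) :
    (f = fun x => x) ∨ (∃ g, IsCtx g ∧ g n = op ω u ∧ f = fun x => g x * op ω' v) ∨
      ∃ g, IsCtx g ∧ g n = op ω' v ∧ f = fun x => op ω u * g x := by
  rcases hf.split h with h | h | ⟨a, b, l, r, hl, hr, -, h1, h2, rfl⟩
  · exact Or.inr (Or.inl h)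
  · exact Or.inr (Or.inr h)
  · obtain rfl := hl.eq_id rfl h1
    left
    rcases hr with rfl | ⟨c, rfl⟩
    · rfl
    · exact absurd h2.symm (mul_ne_of_breadth_eq_one rfl)

section Relations

variable {k : Type*} [Field k] (lam : k)

/-- The relation with leading monomial `⌊u⌋_ω ⌊v⌋_ω'`. -/
noncomputable def relation (ω ω' : OpIdx) (u v : OpWord Z) : MonoidAlgebra k (OpWord Z) :=
  match ω, ω' with
  | .P, .P => phi1 lam (wordOp k Z) (mon k u) (mon k v)
  | .D, .D => phi2 lam (wordOp k Z) (mon k u) (mon k v)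
  | .P, .D => phi4 lam (wordOp k Z) (mon k u) (mon k v)
  | .D, .P => phi5 lam (wordOp k Z) (mon k u) (mon k v)

theorem mem_SdRB_iff {s : MonoidAlgebra k (OpWord Z)} :
    s ∈ SdRB lam Z ↔ (∃ ω ω' u v, s = relation lam ω ω' u v) ∨
      ∃ u, s = phi3 (wordOp k Z) (mon k u) := by
  constructor
  · rintro ⟨u, v, h | h | h | h | h⟩
    · exact Or.inl ⟨.P, .P, u, v, h⟩
    · exact Or.inl ⟨.D, .D, u, v, h⟩
    · exact Or.inr ⟨u, h⟩
    · exact Or.inl ⟨.P, .D, u, v, h⟩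
    · exact Or.inl ⟨.D, .P, u, v, h⟩
  · rintro (⟨ω, ω', u, v, rfl⟩ | ⟨u, rfl⟩)
    · cases ω <;> cases ω'
      exacts [⟨u, v, Or.inr (Or.inl rfl)⟩, ⟨u, v, Or.inr (Or.inr (Or.inr (Or.inr rfl)))⟩,
        ⟨u, v, Or.inr (Or.inr (Or.inr (Or.inl rfl)))⟩, ⟨u, v, Or.inl rfl⟩]
    · exact ⟨u, u, Or.inr (Or.inr (Or.inl rfl))⟩

theorem relation_mem (ω ω' : OpIdx) (u v : OpWord Z) : relation lam ω ω' u v ∈ SdRB lam Z :=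
  (mem_SdRB_iff lam).2 (Or.inl ⟨ω, ω', u, v, rfl⟩)

theorem relation_rule_left [LT Z] (ω ω' : OpIdx) (v : OpWord Z) :
    ∃ R ∈ lowerMaps k fun u => op ω u * op ω' v, ∀ u,
      relation lam ω ω' u v = mon k (op ω u * op ω' v) - R (mon k u) := by
  cases ω <;> cases ω'
  exacts [phi2_rule_left lam v, phi5_rule_left lam v, phi4_rule_left lam v, phi1_rule_left lam v]

theorem relation_rule_right [LT Z] (ω ω' : OpIdx) (u : OpWord Z) :
    ∃ R ∈ lowerMaps k fun v => op ω u * op ω' v, ∀ v,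
      relation lam ω ω' u v = mon k (op ω u * op ω' v) - R (mon k v) := by
  cases ω <;> cases ω'
  exacts [phi2_rule_right lam u, phi5_rule_right lam u, phi4_rule_right lam u,
    phi1_rule_right lam u]

variable [LinearOrder Z] [WellFoundedLT Z]

theorem isLeading_relation (ω ω' : OpIdx) (u v : OpWord Z) :
    IsLeading PDLt (relation lam ω ω' u v) (op ω u * op ω' v) ∧
      monicAt (relation lam ω ω' u v) (op ω u * op ω' v) = relation lam ω ω' u v := by
  obtain ⟨R, hR, h⟩ := relation_rule_left lam ω ω' v
  exact isLeading_rule hR u (h u)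

variable {lam} {G : Set (MonoidAlgebra k (FreeSemigroup Z))}

/-- The leading monomials of the elements of `S_dRB(Z) ∪ G`. -/
theorem isLeading_cases {t : MonoidAlgebra k (OpWord Z)} (ht : t ∈ SdRB lam Z ∪ inclAlg '' G)
    {n : OpWord Z} (hn : IsLeading PDLt t n) :
    (∃ ω ω' u v, t = relation lam ω ω' u v ∧ n = op ω u * op ω' v) ∨
    (∃ u, t = phi3 (wordOp k Z) (mon k u) ∧ n = op .D (op .P u)) ∨
    ∃ s ∈ G, ∃ m, t = inclAlg s ∧ n = incl Z m ∧ IsLeading dlexLt s m := by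
  rcases ht with ht | ⟨s, hs, rfl⟩
  · rcases (mem_SdRB_iff lam).1 ht with ⟨ω, ω', u, v, rfl⟩ | ⟨u, rfl⟩
    · exact Or.inl ⟨ω, ω', u, v, rfl, hn.unique (isLeading_relation lam ω ω' u v).1⟩
    · exact Or.inr (Or.inl ⟨u, rfl, hn.unique (isLeading_phi3 u).1⟩)
  · obtain ⟨m, rfl, hm⟩ := isLeading_inclAlg.1 hn
    exact Or.inr (Or.inr ⟨s, hs, m, rfl, rfl, hm⟩)

/-- D(P(u)) is a single letter and cannot overlap properly. Two-bracket monomials overlap in one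
bracket, and a bracket-free monomial shares no bracket with them. What remains is three brackets in
a row, or an overlap within G. -/
theorem intersectionTrivial (hlam : lam ≠ 0) (hG : IsAssocGSBasis G) :
    IntersectionTrivial (SdRB lam Z ∪ inclAlg '' G) := by
  have hsub : SdRB lam Z ⊆ SdRB lam Z ∪ inclAlg '' G := Set.subset_union_left
  intro s hs t ht a x b hm hn
  have hax : ∀ {y : OpWord Z}, breadth y = 1 → a * x ≠ y := mul_ne_of_breadth_eq_one
  have hxb : ∀ {y : OpWord Z}, breadth y = 1 → x * b ≠ y := mul_ne_of_breadth_eq_one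
  rcases isLeading_cases hs hm with ⟨ω, ω', u, v, rfl, hm'⟩ | ⟨u, rfl, hm'⟩ |
    ⟨s', hs', m, rfl, hm', hlead⟩
  · obtain ⟨rfl, rfl⟩ := mul_eq_mul_of_breadth_eq_one rfl rfl hm'
    rcases isLeading_cases ht hn with ⟨ω₁, ω'', v', w, rfl, hn'⟩ | ⟨v', rfl, hn'⟩ |
      ⟨t', ht', n, rfl, hn', hlead'⟩
    · obtain ⟨h, rfl⟩ := mul_eq_mul_of_breadth_eq_one rfl rfl hn'
      injection h with h1 h2
      subst h1
      subst h2
      rw [(isLeading_relation lam _ _ _ _).2, (isLeading_relation lam _ _ _ _).2]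
      cases ω <;> cases ω' <;> cases ω''
      exacts [intersection_DDD u v w hlam hsub, intersection_DDP u v w hlam hsub,
        intersection_DPD u v w hlam hsub, intersection_DPP u v w hlam hsub,
        intersection_PDD u v w hlam hsub, intersection_PDP u v w hlam hsub,
        intersection_PPD u v w hlam hsub, intersection_PPP u v w hlam hsub]
    · exact absurd hn' (hxb rfl)
    · exact absurd hn'.symm (incl_ne_op_mul _ _ _ _)
  · exact absurd hm' (hax rfl)
  · have hdeg : ∀ τ, degOp τ a = 0 ∧ degOp τ x = 0 := by
      intro τ
      have := congrArg (degOp τ) hm'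
      rw [degOp_mul, degOp_incl] at this
      omega
    obtain ⟨x, rfl⟩ := exists_incl x fun τ => (hdeg τ).2
    obtain ⟨a, rfl⟩ := exists_incl a fun τ => (hdeg τ).1
    rcases isLeading_cases ht hn with ⟨ω₁, ω'', v', w, rfl, hn'⟩ | ⟨v', rfl, hn'⟩ |
      ⟨t', ht', n, rfl, hn', hlead'⟩
    · exact absurd (mul_eq_mul_of_breadth_eq_one rfl rfl hn').1 (incl_ne_op _ _ _)
    · exact absurd hn' (hxb rfl)
    · obtain ⟨b, rfl⟩ := exists_incl b fun τ => by
        have := congrArg (degOp τ) hn'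
        rw [degOp_mul, degOp_incl, degOp_incl] at this
        omega
      rw [← incl_mul] at hm' hn'
      obtain rfl := incl_injective hm'
      obtain rfl := incl_injective hn'
      have h := hG.intersection s' hs' t' ht' _ _ hlead hlead' (a * (x * b)) b a
        (mul_assoc a x b).symm rfl (by
          simp only [FreeSemigroup.length_mul]
          simp only [FreeSemigroup.length]
          omega) (by
          simp only [FreeSemigroup.length_mul]
          simp only [FreeSemigroup.length]
          omega)
      have h' := inclAlg_mem_triv (Set.subset_union_right (s := SdRB lam Z)) h
      rw [inclAlg_eq, map_sub, ← inclAlg_eq, ← inclAlg_eq, inclAlg_mul, inclAlg_mul,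
        ← monicAt_inclAlg, ← monicAt_inclAlg, inclAlg_eq (MonoidAlgebra.single b 1),
        inclAlg_eq (MonoidAlgebra.single a 1),
        mapLin_single, mapLin_single] at h'
      rw [← incl_mul, ← incl_mul, ← incl_mul]
      exact h'

/-- Within S_dRB the leading monomial determines the relation, so coincident monomials give zero. An
inner monomial strictly inside a bracket falls under `inclusion_rule`, and one equal to a bracket
letter must be D(P(u')). Bracket-free words contain only monomials of G. -/
theorem inclusionTrivial (hlam : lam ≠ 0) (hG : IsAssocGSBasis G) :
    InclusionTrivial (SdRB lam Z ∪ inclAlg '' G) := by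
  have hsub : SdRB lam Z ⊆ SdRB lam Z ∪ inclAlg '' G := Set.subset_union_left
  intro s hs t ht f n hf hm hn
  rcases isLeading_cases hs hm with ⟨ω, ω', u, v, rfl, hm'⟩ | ⟨u, rfl, hm'⟩ |
    ⟨s', hs', m, rfl, hm', hlead⟩
  · have hmon := (isLeading_relation lam ω ω' u v).2
    rw [← hm'] at hmon
    rw [hmon]
    rcases eq_op_mul_op_of_isCtx hf hm' with rfl | ⟨g, hg, hgn, rfl⟩ | ⟨g, hg, hgn, rfl⟩
    · dsimp only at hm' hmon ⊢
      rcases isLeading_cases ht hn with ⟨ω₁, ω₂, u', v', rfl, hn'⟩ | ⟨u', rfl, hn'⟩ |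
        ⟨t', ht', n, rfl, hn', hlead'⟩
      · obtain ⟨h1, h2⟩ := mul_eq_mul_of_breadth_eq_one rfl rfl (hm'.symm.trans hn')
        injection h1 with h1 h3
        injection h2 with h2 h4
        subst h1 h2 h3 h4
        rw [hmon, mapLin_id, sub_self]
        exact Submodule.zero_mem _
      · exact absurd (hm'.symm.trans hn') (mul_ne_of_breadth_eq_one rfl)
      · exact absurd (hn'.symm.trans hm') (incl_ne_op_mul _ _ _ _)
    · rcases eq_op_of_isCtx hg hgn with rfl | ⟨g', hg', rfl, rfl⟩
      · dsimp only at hgn hm' ⊢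
        subst hgn
        rcases isLeading_cases ht hn with ⟨ω₁, ω₂, u', v', rfl, hn'⟩ | ⟨u', rfl, hn'⟩ |
          ⟨t', ht', n, rfl, hn', hlead'⟩
        · exact absurd hn'.symm (mul_ne_of_breadth_eq_one rfl)
        · injection hn' with h1 h2
          subst h1
          subst h2
          rw [(isLeading_phi3 u').2]
          cases ω'
          exacts [inclusion_phi2_phi3 u' v hlam hsub, inclusion_phi5_phi3 u' v hlam hsub]
        · exact absurd hn'.symm (incl_ne_op _ _ _)
      · obtain ⟨R, hR, h⟩ := relation_rule_left lam ω ω' v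
        exact inclusion_rule (.mul_right _ (.op _ .id)) hR h
          (fun u => hsub (relation_mem lam ω ω' u v)) ht hn hg'
    · rcases eq_op_of_isCtx hg hgn with rfl | ⟨g', hg', rfl, rfl⟩
      · dsimp only at hgn hm' ⊢
        subst hgn
        rcases isLeading_cases ht hn with ⟨ω₁, ω₂, u', v', rfl, hn'⟩ | ⟨u', rfl, hn'⟩ |
          ⟨t', ht', n, rfl, hn', hlead'⟩
        · exact absurd hn'.symm (mul_ne_of_breadth_eq_one rfl)
        · injection hn' with h1 h2
          subst h1
          subst h2
          rw [(isLeading_phi3 u').2]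
          cases ω
          exacts [inclusion_phi2_phi3' u u' hlam hsub, inclusion_phi4_phi3 u u' hlam hsub]
        · exact absurd hn'.symm (incl_ne_op _ _ _)
      · obtain ⟨R, hR, h⟩ := relation_rule_right lam ω ω' u
        exact inclusion_rule (.mul_left _ (.op _ .id)) hR h
          (fun v => hsub (relation_mem lam ω ω' u v)) ht hn hg'
  · have hmon := (isLeading_phi3 (k := k) u).2
    rw [← hm'] at hmon
    rw [hmon]
    have hid : n = op .D (op .P u) → t = phi3 (wordOp k Z) (mon k u) := by
      intro h
      rcases isLeading_cases ht hn with ⟨ω₁, ω₂, u', v', rfl, hn'⟩ | ⟨u', rfl, hn'⟩ |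
          ⟨t', ht', n, rfl, hn', hlead'⟩
      · exact absurd (hn'.symm.trans h) (mul_ne_of_breadth_eq_one rfl)
      · have := h.symm.trans hn'
        simp only [op.injEq, true_and] at this
        rw [this]
      · exact absurd (hn'.symm.trans h) (incl_ne_op _ _ _)
    rcases eq_op_of_isCtx hf hm' with rfl | ⟨g, hg, hgn, rfl⟩
    · dsimp only at hm' hmon ⊢
      rw [hid hm', hmon, mapLin_id, sub_self]
      exact Submodule.zero_mem _
    · rcases eq_op_of_isCtx hg hgn with rfl | ⟨g', hg', rfl, rfl⟩
      · dsimp only at hgn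
        -- Here `n` would be the single letter P(u), which is not a leading monomial of any kind.
        rcases isLeading_cases ht hn with ⟨ω₁, ω₂, u', v', rfl, hn'⟩ | ⟨u', rfl, hn'⟩ |
          ⟨t', ht', n, rfl, hn', hlead'⟩
        · exact absurd (hn'.symm.trans hgn) (mul_ne_of_breadth_eq_one rfl)
        · cases hn'.symm.trans hgn
        · exact absurd (hn'.symm.trans hgn) (incl_ne_op _ _ _)
      · obtain ⟨R, hR, h⟩ := phi3_rule (k := k) (Z := Z)
        exact inclusion_rule (.op _ (.op _ .id)) hR h (fun u => phi3_mem u hsub) ht hn hg'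
  · obtain ⟨⟨y, rfl⟩, c, hc⟩ := hf.exists_assocPlug hm'
    rcases isLeading_cases ht hn with ⟨ω₁, ω₂, u', v', rfl, hn'⟩ | ⟨u', rfl, hn'⟩ |
          ⟨t', ht', n, rfl, hn', hlead'⟩
    · exact absurd hn' (incl_ne_op_mul _ _ _ _)
    · exact absurd hn' (incl_ne_op _ _ _)
    · obtain rfl := incl_injective hn'
      rw [hc] at hm'
      obtain rfl := incl_injective hm'
      have h := hG.inclusion s' hs' t' ht' _ _ hlead hlead' c rfl
      have h' := inclAlg_mem_triv (Set.subset_union_right (s := SdRB lam Z)) h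
      rw [← mapLin_apply, inclAlg_eq, map_sub, mapLin_comp, ← inclAlg_eq,
        ← monicAt_inclAlg] at h'
      simp only [← hc] at h'
      rw [← mapLin_comp, ← inclAlg_eq, ← monicAt_inclAlg] at h'
      exact h'

theorem irr_eq : Irr (StarWord.plug (Z := Z)) PDLt (SdRB lam Z ∪ inclAlg '' G) =
    {w : OpWord Z | ∃ q : StarWord Z,
      (∃ s ∈ G, ∃ m : FreeSemigroup Z, IsLeading dlexLt s m ∧ w = q.plug (incl Z m)) ∨
      ∃ u v : OpWord Z,
        w = q.plug (op .P u * op .P v) ∨ w = q.plug (op .D u * op .D v) ∨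
        w = q.plug (op .D (op .P u)) ∨ w = q.plug (op .P u * op .D v) ∨
        w = q.plug (op .D u * op .P v)}ᶜ := by
  rw [Irr]
  congr 1
  ext w
  constructor
  · rintro ⟨t, ht, n, hn, q, rfl⟩
    refine ⟨q, ?_⟩
    rcases isLeading_cases ht hn with ⟨ω, ω', u, v, rfl, rfl⟩ | ⟨u, rfl, rfl⟩ |
          ⟨s, hs, m, rfl, rfl, hlead⟩
    · refine Or.inr ⟨u, v, ?_⟩
      cases ω <;> cases ω' <;> simp
    · exact Or.inr ⟨u, u, by simp⟩
    · exact Or.inl ⟨s, hs, m, hlead, rfl⟩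
  · have hrel : ∀ (q : StarWord Z) ω ω' u v, ∃ s ∈ SdRB lam Z ∪ inclAlg '' G, ∃ m,
        IsLeading PDLt s m ∧ ∃ q' : StarWord Z, q.plug (op ω u * op ω' v) = q'.plug m :=
      fun q ω ω' u v => ⟨_, Or.inl (relation_mem lam ω ω' u v), _,
        (isLeading_relation lam ω ω' u v).1, q, rfl⟩
    rintro ⟨q, ⟨s, hs, m, hm, rfl⟩ | ⟨u, v, rfl | rfl | rfl | rfl | rfl⟩⟩
    · exact ⟨_, Or.inr ⟨s, hs, rfl⟩, _, isLeading_inclAlg.2 ⟨m, rfl, hm⟩, q, rfl⟩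
    · exact hrel q _ _ u v
    · exact hrel q _ _ u v
    · exact ⟨_, Or.inl ((mem_SdRB_iff lam).2 (Or.inr ⟨u, rfl⟩)), _, (isLeading_phi3 u).1, q, rfl⟩
    · exact hrel q _ _ u v
    · exact hrel q _ _ u v

end Relations

end OpWord

/-! ### Generated ideals and the passage from `G` to `I`. -/

theorem AlgIdeal.ext_toSubmodule {k R : Type*} [Field k] [NonUnitalRing R] [Module k R]
    {I J : AlgIdeal k R} (h : I.toSubmodule = J.toSubmodule) : I = J := by
  cases I
  cases J
  congr

theorem AlgIdeal.subset_span {k R : Type*} [Field k] [NonUnitalRing R] [Module k R] (s : Set R) :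
    s ⊆ (AlgIdeal.span k s).toSubmodule := by
  intro x hx
  refine Submodule.mem_sInf.2 ?_
  rintro J ⟨I, rfl, hs⟩
  exact hs hx

theorem AlgIdeal.span_toSubmodule_le {k R : Type*} [Field k] [NonUnitalRing R] [Module k R]
    {s : Set R} {I : AlgIdeal k R} (h : s ⊆ I.toSubmodule) :
    (AlgIdeal.span k s).toSubmodule ≤ I.toSubmodule :=
  sInf_le ⟨I, rfl, h⟩

theorem AlgIdeal.subset_opSpan {k R : Type*} [Field k] [NonUnitalRing R] [Module k R]
    (T : OpIdx → R →ₗ[k] R) (s : Set R) : s ⊆ (AlgIdeal.opSpan T s).toSubmodule := by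
  intro x hx
  refine Submodule.mem_sInf.2 ?_
  rintro J ⟨I, rfl, hs, -⟩
  exact hs hx

theorem AlgIdeal.opSpan_toSubmodule_le {k R : Type*} [Field k] [NonUnitalRing R] [Module k R]
    {T : OpIdx → R →ₗ[k] R} {s : Set R} {I : AlgIdeal k R} (h : s ⊆ I.toSubmodule)
    (hT : ∀ ω, ∀ x ∈ I.toSubmodule, T ω x ∈ I.toSubmodule) :
    (AlgIdeal.opSpan T s).toSubmodule ≤ I.toSubmodule :=
  sInf_le ⟨I, rfl, h, hT⟩

namespace OpWord

variable {k Z : Type*} [Field k]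

/-- The preimage of an operated ideal under the inclusion is an ordinary ideal; as it contains `G`,
it contains the ideal generated by `G`. -/
theorem inclAlg_mem_opSpan {lam : k} {G : Set (MonoidAlgebra k (FreeSemigroup Z))}
    {x : MonoidAlgebra k (FreeSemigroup Z)} (hx : x ∈ (AlgIdeal.span k G).toSubmodule) :
    inclAlg x ∈ (AlgIdeal.opSpan (wordOp k Z) (SdRB lam Z ∪ inclAlg '' G)).toSubmodule := by
  set J := AlgIdeal.opSpan (wordOp k Z) (SdRB lam Z ∪ inclAlg '' G) with hJ
  let K : AlgIdeal k (MonoidAlgebra k (FreeSemigroup Z)) :=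
    { toSubmodule := J.toSubmodule.comap (mapLin k (incl Z))
      mul_mem_left := fun a x hx => by
        rw [Submodule.mem_comap, ← inclAlg_eq, inclAlg_mul]
        exact J.mul_mem_left _ _ hx
      mul_mem_right := fun x a hx => by
        rw [Submodule.mem_comap, ← inclAlg_eq, inclAlg_mul]
        exact J.mul_mem_right _ _ hx }
  have h : (AlgIdeal.span k G).toSubmodule ≤ K.toSubmodule := AlgIdeal.span_toSubmodule_le
    fun s hs => AlgIdeal.subset_opSpan _ _ (Or.inr ⟨s, hs, rfl⟩)
  exact h hx

theorem opSpan_eq_dRBIdeal (lam : k) {G : Set (MonoidAlgebra k (FreeSemigroup Z))}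
    {I : AlgIdeal k (MonoidAlgebra k (FreeSemigroup Z))} (hI : AlgIdeal.span k G = I) :
    AlgIdeal.opSpan (wordOp k Z) (SdRB lam Z ∪ inclAlg '' G) = dRBIdeal lam I := by
  subst hI
  refine AlgIdeal.ext_toSubmodule (le_antisymm ?_ ?_)
  · refine AlgIdeal.opSpan_toSubmodule_le ?_ (AlgIdeal.op_mem_opSpan _ _)
    exact (Set.union_subset_union_right _ (Set.image_mono (AlgIdeal.subset_span G))).trans
      (AlgIdeal.subset_opSpan _ _)
  · refine AlgIdeal.opSpan_toSubmodule_le ?_ (AlgIdeal.op_mem_opSpan _ _)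
    rintro x (hx | ⟨x, hx, rfl⟩)
    · exact AlgIdeal.subset_opSpan _ _ (Or.inl hx)
    · exact inclAlg_mem_opSpan hx

/-! ### The universal property. -/

section Free

variable (lam : k) (I : AlgIdeal k (MonoidAlgebra k (FreeSemigroup Z)))

theorem inclAlg_mem_dRBIdeal {x : MonoidAlgebra k (FreeSemigroup Z)} (hx : x ∈ I.toSubmodule) :
    inclAlg x ∈ (dRBIdeal lam I).toSubmodule :=
  AlgIdeal.subset_opSpan _ _ (Or.inr ⟨x, hx, rfl⟩)

/-- The homomorphism `k 𝒮(Z) / I → k 𝔖(Z) / ⟨S_dRB(Z) ∪ I⟩` induced by the inclusion. -/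
noncomputable def quotientIncl : I.Quotient →ₙₐ[k] (dRBIdeal lam I).Quotient :=
  let L : I.Quotient →ₗ[k] (dRBIdeal lam I).Quotient :=
    Submodule.mapQ I.toSubmodule (dRBIdeal lam I).toSubmodule (mapLin k (incl Z))
      fun _ hx => inclAlg_mem_dRBIdeal lam I hx
  { toFun := L
    map_smul' := fun r x => map_smul L r x
    map_zero' := map_zero L
    map_add' := fun x y => map_add L x y
    map_mul' := fun x y => by
      obtain ⟨x, rfl⟩ := I.mkₗ_surjective x
      obtain ⟨y, rfl⟩ := I.mkₗ_surjective y
      exact congrArg (dRBIdeal lam I).mkₗ (inclAlg_mul x y) }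

theorem quotientIncl_quotMk (x : MonoidAlgebra k (FreeSemigroup Z)) :
    quotientIncl lam I (I.quotMk x) = (dRBIdeal lam I).quotMk (inclAlg x) := rfl

theorem dRBOp_mkₗ (ω : OpIdx) (x : MonoidAlgebra k (OpWord Z)) :
    dRBOp lam I ω ((dRBIdeal lam I).mkₗ x) = (dRBIdeal lam I).mkₗ (wordOp k Z ω x) := rfl

/-- S_dRB imposes the relations on monomials only; bilinearity extends them to all elements of the
quotient. -/
theorem eq_zero_of_bilinear {M : Type*} [AddCommGroup M] [Module k M]
    {J : AlgIdeal k (MonoidAlgebra k (OpWord Z))} (B : J.Quotient →ₗ[k] J.Quotient →ₗ[k] M)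
    (h : ∀ u v, B (J.mkₗ (mon k u)) (J.mkₗ (mon k v)) = 0) (x y : J.Quotient) : B x y = 0 := by
  obtain ⟨x, rfl⟩ := J.mkₗ_surjective x
  obtain ⟨y, rfl⟩ := J.mkₗ_surjective y
  refine linearMap_ext_single (f := B.flip (J.mkₗ y) ∘ₗ J.mkₗ) (g := 0) (fun u => ?_) x
  exact linearMap_ext_single (f := B (J.mkₗ (mon k u)) ∘ₗ J.mkₗ) (g := 0) (fun v => h u v) y

theorem mkₗ_eq_zero_of_mem_SdRB {s : MonoidAlgebra k (OpWord Z)} (hs : s ∈ SdRB lam Z) :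
    (dRBIdeal lam I).mkₗ s = 0 := by
  rw [← map_zero (dRBIdeal lam I).mkₗ, AlgIdeal.mkₗ_eq_iff, sub_zero]
  exact AlgIdeal.subset_opSpan _ _ (Or.inl hs)

theorem isDiffRotaBaxter_dRBOp {lam : k} (hlam : lam ≠ 0) :
    IsDiffRotaBaxter lam (dRBOp lam I) := by
  set J := dRBIdeal lam I
  set T := dRBOp lam I
  let μ := LinearMap.mul k J.Quotient
  have h0 := fun s hs => mkₗ_eq_zero_of_mem_SdRB lam I (s := s) hs
  refine (isDiffRotaBaxter_iff hlam _).2 ⟨?_, ?_, ?_, ?_, ?_⟩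
  -- Each map below is some φᵢ written as a bilinear map. On classes of monomials it is
  -- definitionally the class of the corresponding element of S_dRB, because product and operators
  -- are computed on representatives.
  · exact eq_zero_of_bilinear
      (μ.compl₁₂ (T .P) (T .P) - (μ.compl₂ (T .P)).compr₂ (T .P) - (μ ∘ₗ T .P).compr₂ (T .P)
        - lam • μ.compr₂ (T .P)) fun u v => h0 _ ⟨u, v, Or.inl rfl⟩
  · exact eq_zero_of_bilinear
      (μ.compl₁₂ (T .D) (T .D) + lam⁻¹ • (μ ∘ₗ T .D) + lam⁻¹ • μ.compl₂ (T .D)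
        - lam⁻¹ • μ.compr₂ (T .D)) fun u v => h0 _ ⟨u, v, Or.inr (Or.inl rfl)⟩
  · intro x
    obtain ⟨x, rfl⟩ := J.mkₗ_surjective x
    exact linearMap_ext_single (f := (T .D ∘ₗ T .P - LinearMap.id) ∘ₗ J.mkₗ) (g := 0)
      (fun u => h0 _ ⟨u, u, Or.inr (Or.inr (Or.inl rfl))⟩) x
  · exact eq_zero_of_bilinear
      (μ.compl₁₂ (T .P) (T .D) - (μ ∘ₗ T .P).compr₂ (T .D) + μ + lam • μ.compl₂ (T .D))
      fun u v => h0 _ ⟨u, v, Or.inr (Or.inr (Or.inr (Or.inl rfl)))⟩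
  · exact eq_zero_of_bilinear
      (μ.compl₁₂ (T .D) (T .P) - (μ.compl₂ (T .P)).compr₂ (T .D) + μ + lam • (μ ∘ₗ T .D))
      fun u v => h0 _ ⟨u, v, Or.inr (Or.inr (Or.inr (Or.inr rfl)))⟩

section Eval

variable {R : Type*} [NonUnitalRing R] [Module k R]

/-- The value of a bracketed word in an operated algebra. -/
def eval (U : OpIdx → R →ₗ[k] R) (f : Z → R) : OpWord Z → R
  | of z => f z
  | op ω v => U ω (eval U f v)
  | consOf z w => f z * eval U f w
  | consOp ω v w => U ω (eval U f v) * eval U f w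

theorem eval_mul (U : OpIdx → R →ₗ[k] R) (f : Z → R) (x y : OpWord Z) :
    eval U f (x * y) = eval U f x * eval U f y := by
  induction x with
  | of z => rfl
  | op ω v => rfl
  | consOf z w ih => rw [consOf_mul, eval, eval, ih, mul_assoc]
  | consOp ω v w _ ih => rw [consOp_mul, eval, eval, ih, mul_assoc]

/-- A homomorphism of nonunital algebras as a linear map. -/
def toLin {A : Type*} [NonUnitalRing A] [Module k A] (f : A →ₙₐ[k] R) : A →ₗ[k] R where
  toFun := f
  map_add' := map_add f
  map_smul' := map_smul f

/-- Homomorphisms of operated algebras on the quotient are determined by their values on `Z`. -/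
theorem hom_ext_of_wordOp {U : OpIdx → R →ₗ[k] R} {E F : (dRBIdeal lam I).Quotient →ₙₐ[k] R}
    (hE : ∀ ω b, E (dRBOp lam I ω b) = U ω (E b)) (hF : ∀ ω b, F (dRBOp lam I ω b) = U ω (F b))
    (h : ∀ a, E (quotientIncl lam I a) = F (quotientIncl lam I a)) : E = F := by
  ext x
  obtain ⟨x, rfl⟩ := (dRBIdeal lam I).mkₗ_surjective x
  refine linearMap_ext_single (f := toLin E ∘ₗ (dRBIdeal lam I).mkₗ)
    (g := toLin F ∘ₗ (dRBIdeal lam I).mkₗ) (fun u => ?_) x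
  change E ((dRBIdeal lam I).mkₗ (mon k u)) = F ((dRBIdeal lam I).mkₗ (mon k u))
  induction u using letter_induction with
  | of z =>
    have := h (I.quotMk (MonoidAlgebra.single (FreeSemigroup.of z) 1))
    rwa [quotientIncl_quotMk, inclAlg_eq, mapLin_single, incl_of] at this
  | op ω v ih => rw [← wordOp_mon, ← dRBOp_mkₗ, hE, hF, ih]
  | mul x w _ ihx ihw => rw [← mon_mul_mon, AlgIdeal.mkₗ_mul, map_mul, map_mul, ihx, ihw]

variable [IsScalarTower k R R] [SMulCommClass k R R]

/-- The homomorphism from `k 𝔖(Z)` to an operated algebra that extends a map on `Z`. -/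
noncomputable def evalHom (U : OpIdx → R →ₗ[k] R) (f : Z → R) :
    MonoidAlgebra k (OpWord Z) →ₙₐ[k] R :=
  MonoidAlgebra.liftMagma k ⟨eval U f, eval_mul U f⟩

theorem evalHom_mon (U : OpIdx → R →ₗ[k] R) (f : Z → R) (u : OpWord Z) :
    evalHom U f (mon k u) = eval U f u := by
  simp [evalHom, mon, MonoidAlgebra.liftMagma]

theorem evalHom_wordOp (U : OpIdx → R →ₗ[k] R) (f : Z → R) (ω : OpIdx)
    (x : MonoidAlgebra k (OpWord Z)) :
    evalHom U f (wordOp k Z ω x) = U ω (evalHom U f x) := by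
  refine linearMap_ext_single (f := toLin (evalHom U f) ∘ₗ wordOp k Z ω)
    (g := U ω ∘ₗ toLin (evalHom U f)) (fun u => ?_) x
  change evalHom U f (wordOp k Z ω (mon k u)) = U ω (evalHom U f (mon k u))
  rw [wordOp_mon, evalHom_mon, evalHom_mon, eval]

theorem evalHom_inclAlg (U : OpIdx → R →ₗ[k] R) (f : I.Quotient →ₙₐ[k] R)
    (x : MonoidAlgebra k (FreeSemigroup Z)) :
    evalHom U (fun z => f (I.quotMk (MonoidAlgebra.single (FreeSemigroup.of z) 1))) (inclAlg x) =
      f (I.quotMk x) := by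
  refine linearMap_ext_single
    (f := toLin (evalHom U fun z => f (I.quotMk (MonoidAlgebra.single (FreeSemigroup.of z) 1))) ∘ₗ
      mapLin k (incl Z)) (g := toLin f ∘ₗ I.mkₗ) (fun u => ?_) x
  rw [LinearMap.comp_apply, mapLin_single]
  change evalHom _ _ (mon k _) = f (I.quotMk _)
  rw [evalHom_mon]
  induction u using FreeSemigroup.recOnMul with
  | ih1 z => rfl
  | ih2 z y ih1 ih2 =>
    rw [incl_mul, eval_mul, ih1, ih2, ← map_mul, ← map_mul, MonoidAlgebra.single_mul_single,
      mul_one]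

theorem map_phi {lam : k} (U : OpIdx → R →ₗ[k] R) (h : IsDiffRotaBaxter lam U) (hlam : lam ≠ 0)
    (E : MonoidAlgebra k (OpWord Z) →ₙₐ[k] R) (hE : ∀ ω x, E (wordOp k Z ω x) = U ω (E x))
    {s : MonoidAlgebra k (OpWord Z)} (hs : s ∈ SdRB lam Z) : E s = 0 := by
  obtain ⟨h1, h2, h3, h4, h5⟩ := (isDiffRotaBaxter_iff hlam U).1 h
  obtain ⟨u, v, rfl | rfl | rfl | rfl | rfl⟩ := hs
  · rw [← h1 (E (mon k u)) (E (mon k v))]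
    simp only [phi1, map_sub, map_mul, map_smul, hE]
  · rw [← h2 (E (mon k u)) (E (mon k v))]
    simp only [phi2, map_sub, map_add, map_mul, map_smul, hE]
  · rw [← h3 (E (mon k u))]
    simp only [phi3, map_sub, hE]
  · rw [← h4 (E (mon k u)) (E (mon k v))]
    simp only [phi4, map_sub, map_add, map_mul, map_smul, hE]
  · rw [← h5 (E (mon k u)) (E (mon k v))]
    simp only [phi5, map_sub, map_add, map_mul, map_smul, hE]

/-- Evaluation of words through the values of `f` on Z commutes with the operators, so its kernel is
an operated ideal. It contains S_dRB since the target satisfies the five identities, and the image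
of `I` since `f` is defined modulo `I`. -/
theorem exists_lift {lam : k} (hlam : lam ≠ 0) {U : OpIdx → R →ₗ[k] R}
    (hU : IsDiffRotaBaxter lam U) (f : I.Quotient →ₙₐ[k] R) :
    ∃ F : (dRBIdeal lam I).Quotient →ₙₐ[k] R, (∀ ω b, F (dRBOp lam I ω b) = U ω (F b)) ∧
      ∀ a, F (quotientIncl lam I a) = f a := by
  let E := evalHom (k := k) U
    fun z => f (I.quotMk (MonoidAlgebra.single (FreeSemigroup.of z) 1))
  have hE : ∀ ω x, E (wordOp k Z ω x) = U ω (E x) := evalHom_wordOp U _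
  let K : AlgIdeal k (MonoidAlgebra k (OpWord Z)) :=
    { toSubmodule := LinearMap.ker (toLin E)
      mul_mem_left := fun a x (hx : E x = 0) => by
        change E (a * x) = 0
        rw [map_mul, hx, mul_zero]
      mul_mem_right := fun x a (hx : E x = 0) => by
        change E (x * a) = 0
        rw [map_mul, hx, zero_mul] }
  have hK : (dRBIdeal lam I).toSubmodule ≤ K.toSubmodule := by
    refine AlgIdeal.opSpan_toSubmodule_le ?_ fun ω x (hx : E x = 0) => ?_
    · rintro _ (hs | ⟨x, hx, rfl⟩)
      · exact map_phi U hU hlam E hE hs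
      · have h0 : I.quotMk x = 0 := (Submodule.Quotient.mk_eq_zero _).2 hx
        change E (inclAlg x) = 0
        rw [evalHom_inclAlg, h0, map_zero]
    · change E (wordOp k Z ω x) = 0
      rw [hE, hx, map_zero]
  let L : (dRBIdeal lam I).Quotient →ₗ[k] R := (dRBIdeal lam I).toSubmodule.liftQ (toLin E) hK
  have hL : ∀ x, L ((dRBIdeal lam I).mkₗ x) = E x := fun x => rfl
  let F : (dRBIdeal lam I).Quotient →ₙₐ[k] R :=
    { toFun := L
      map_smul' := fun r x => map_smul L r x
      map_zero' := map_zero L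
      map_add' := fun x y => map_add L x y
      map_mul' := fun x y => by
        obtain ⟨x, rfl⟩ := (dRBIdeal lam I).mkₗ_surjective x
        obtain ⟨y, rfl⟩ := (dRBIdeal lam I).mkₗ_surjective y
        exact map_mul E x y }
  refine ⟨F, fun ω b => ?_, fun a => ?_⟩
  · obtain ⟨b, rfl⟩ := (dRBIdeal lam I).mkₗ_surjective b
    exact hE ω b
  · obtain ⟨a, rfl⟩ := I.mkₗ_surjective a
    exact evalHom_inclAlg I U f a

end Eval

theorem isFreeDiffRotaBaxter {lam : k} (hlam : lam ≠ 0) :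
    IsFreeDiffRotaBaxter.{w} lam (dRBOp lam I) (quotientIncl lam I) := by
  refine ⟨isDiffRotaBaxter_dRBOp I hlam, fun R _ _ _ _ U hU f => ?_⟩
  obtain ⟨F, hF, hFf⟩ := exists_lift I hlam hU f
  refine ⟨F, ⟨hF, hFf⟩, fun E hE => ?_⟩
  exact hom_ext_of_wordOp lam I hE.1 hF fun a => (hE.2 a).trans (hFf a).symm

end Free

end OpWord

theorem mainTheorem6 {k : Type*} [Field k] {Z : Type*} (lam : k) (hlam : lam ≠ 0)
    (I : AlgIdeal k (MonoidAlgebra k (FreeSemigroup Z))) :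
    (∃ ι : I.Quotient →ₙₐ[k] (dRBIdeal lam I).Quotient,
      (∀ f : MonoidAlgebra k (FreeSemigroup Z),
        ι (I.quotMk f) = (dRBIdeal lam I).quotMk (inclAlg f)) ∧
      IsFreeDiffRotaBaxter.{w} lam (dRBOp lam I) ι) ∧
    ∀ [LinearOrder Z] [WellFoundedLT Z] (G : Set (MonoidAlgebra k (FreeSemigroup Z))),
      AlgIdeal.span k G = I → IsAssocGSBasis G →
      (IsMonomialOrder (StarWord.plug (Z := Z)) OpWord.PDLt ∧
        IsOperatedGSBasis (SdRB lam Z ∪ inclAlg '' G) ∧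
        AlgIdeal.opSpan (wordOp k Z) (SdRB lam Z ∪ inclAlg '' G) = dRBIdeal lam I) ∧
      (Irr (StarWord.plug (Z := Z)) OpWord.PDLt (SdRB lam Z ∪ inclAlg '' G) =
        {w : OpWord Z | ∃ q : StarWord Z,
          (∃ s ∈ G, ∃ m : FreeSemigroup Z, IsLeading dlexLt s m ∧ w = q.plug (OpWord.incl Z m)) ∨
          ∃ u v : OpWord Z,
            w = q.plug (OpWord.op OpIdx.P u * OpWord.op OpIdx.P v) ∨
            w = q.plug (OpWord.op OpIdx.D u * OpWord.op OpIdx.D v) ∨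
            w = q.plug (OpWord.op OpIdx.D (OpWord.op OpIdx.P u)) ∨
            w = q.plug (OpWord.op OpIdx.P u * OpWord.op OpIdx.D v) ∨
            w = q.plug (OpWord.op OpIdx.D u * OpWord.op OpIdx.P v)}ᶜ ∧
        ∃ b : Module.Basis
            (Irr (StarWord.plug (Z := Z)) OpWord.PDLt (SdRB lam Z ∪ inclAlg '' G) :
              Set (OpWord Z)) k (dRBIdeal lam I).Quotient,
          ∀ w, b w = (dRBIdeal lam I).quotMk (mon k (w : OpWord Z))) := by
  refine ⟨⟨OpWord.quotientIncl lam I, OpWord.quotientIncl_quotMk lam I,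
    OpWord.isFreeDiffRotaBaxter I hlam⟩, ?_⟩
  intro _ _ G hI hG
  have h1 := OpWord.intersectionTrivial (lam := lam) hlam hG
  have h2 := OpWord.inclusionTrivial (lam := lam) hlam hG
  have hJ := OpWord.opSpan_eq_dRBIdeal lam hI
  refine ⟨⟨OpWord.isMonomialOrder_pdLt, OpWord.isOperatedGSBasis_iff.2 ⟨h1, h2⟩, hJ⟩,
    OpWord.irr_eq, OpWord.exists_basis_irr h1 h2 ?_⟩
  rw [← hJ]
  exact OpWord.opSpan_toSubmodule _
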